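/- Conventions. Manifolds are smooth, finite-dimensional, Hausdorff and second countable. A $(1,1)$ tensor field $\Theta$ on $M$ (a smooth field of endomorphisms of the tangent spaces) is *algebraically constant* if for all $x,y\in M$ some linear isomorphism $T_xM\to T_yM$ sends $\Theta_x$ to $\Theta_y$; it is *integrable* if some smooth torsion-free connection $\nabla$ satisfies $\nabla\Theta=0$. Its Nijenhuis tensor is $N(v,w)=\Theta[\Theta v,w]+\Theta[v,\Theta w]-[\Theta v,\Theta w]-\Theta^2[v,w]$. A distribution (a smooth vector subbundle of the tangent bundle) is *integrable* if it is tangent to a foliation, that is, if around each point some coordinate chart carries it to a constant distribution. Affine-bundle construction. Let $D$ be a distribution on a manifold $\Sigma$, and let $\pi:P\to\Sigma$ be a smooth affine bundle associated with the quotient vector bundle $T\Sigma/D$, so that every fibre $P_y=\pi^{-1}(y)$ is an affine space with translation space $T_y\Sigma/D_y$. Then $P$ carries the $(1,1)$ tensor field $\Theta^P$ given by $$\Theta^P_p\,\xi=[d\pi_p\,\xi]\in T_y\Sigma/D_y=T_p(P_y)\subseteq T_pP,\qquad p\in P_y,\ \xi\in T_pP .$$ A *local realization* of a $(1,1)$ tensor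 field $\Theta$ on $M$ over an open set $U\subseteq M$ consists of $\Sigma,D,P$ as above and a diffeomorphism $\varphi$ of $U$ onto an open subset of $P$ that meets every fibre of $P$, such that $\varphi$ sends $\Theta|_U$ to $\Theta^P|_{\varphi(U)}$. Theorem. Let $\Theta$ be an algebraically constant $(1,1)$ tensor field on a manifold $M$ such that $\Theta^2=0$ and $N=0$. Then: 1. Every point of $M$ lies in a connected open set over which $\Theta$ has a local realization. 2. In every local realization of $\Theta$, over any open set $U$, the fibre dimension of $D$ equals the codimension of $\operatorname{Im}\Theta$ in $\operatorname{Ker}\Theta$, and $\Theta|_U$ is integrable if and only if the distribution $D$ is integrable. 3. For any family of local realizations of $\Theta$ over open sets covering $M$, $\Theta$ is integrable on $M$ if and only if all the corresponding distributions $D$ are integrable. -/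

import Mathlib

open scoped Manifold ContDiff Bundle

universe u v w

noncomputable section

/-- A smooth tensor field of type `(1,1)` on an `n`-dimensional manifold `M`. -/
abbrev Tensor11 (n : ℕ) (M : Type u) [TopologicalSpace M]
    [ChartedSpace (EuclideanSpace ℝ (Fin n)) M] [IsManifold (𝓡 n) ∞ M] : Type u :=
  ContMDiffSection (𝓡 n) (EuclideanSpace ℝ (Fin n) →L[ℝ] EuclideanSpace ℝ (Fin n)) ∞
    (fun x : M => TangentSpace (𝓡 n) x →L[ℝ] TangentSpace (𝓡 n) x)

/-- Smoothness of a vector field on a set. -/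
def SmoothFieldOn {n : ℕ} {M : Type u} [TopologicalSpace M]
    [ChartedSpace (EuclideanSpace ℝ (Fin n)) M] [IsManifold (𝓡 n) ∞ M]
    (X : ∀ x : M, TangentSpace (𝓡 n) x) (W : Set M) : Prop :=
  ContMDiffOn (𝓡 n) (𝓡 n).tangent ∞ (fun x => (⟨x, X x⟩ : TangentBundle (𝓡 n) M)) W

/-- Differentiability of a vector field at a point. -/
def FieldDifferentiableAt {n : ℕ} {M : Type u} [TopologicalSpace M]
    [ChartedSpace (EuclideanSpace ℝ (Fin n)) M] [IsManifold (𝓡 n) ∞ M]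
    (X : ∀ x : M, TangentSpace (𝓡 n) x) (x : M) : Prop :=
  MDifferentiableAt (𝓡 n) (𝓡 n).tangent (fun z => (⟨z, X z⟩ : TangentBundle (𝓡 n) M)) x

namespace Tensor11

variable {n : ℕ} {M : Type u} [TopologicalSpace M]
  [ChartedSpace (EuclideanSpace ℝ (Fin n)) M] [IsManifold (𝓡 n) ∞ M]

/-- Between any two tangent spaces there is a linear isomorphism sending `Θ` to `Θ`. -/
def AlgebraicallyConstant (Θ : Tensor11 n M) : Prop :=
  ∀ x y : M, ∃ A : TangentSpace (𝓡 n) x ≃ₗ[ℝ] TangentSpace (𝓡 n) y,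
    ∀ ξ : TangentSpace (𝓡 n) x, A (Θ x ξ) = Θ y (A ξ)

/-- The Nijenhuis tensor
`N(X, Y) = Θ[ΘX, Y] + Θ[X, ΘY] - [ΘX, ΘY] - Θ²[X, Y]`, evaluated on vector fields. -/
def nijenhuis (Θ : Tensor11 n M) (X Y : ∀ x : M, TangentSpace (𝓡 n) x) (x : M) :
    TangentSpace (𝓡 n) x :=
  Θ x (VectorField.mlieBracket (𝓡 n) (fun z => Θ z (X z)) Y x)
    + Θ x (VectorField.mlieBracket (𝓡 n) X (fun z => Θ z (Y z)) x)
    - VectorField.mlieBracket (𝓡 n) (fun z => Θ z (X z)) (fun z => Θ z (Y z)) x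
    - Θ x (Θ x (VectorField.mlieBracket (𝓡 n) X Y x))

/-- The Nijenhuis tensor vanishes identically. -/
def NijenhuisVanishes (Θ : Tensor11 n M) : Prop :=
  ∀ X Y : ∀ x : M, TangentSpace (𝓡 n) x,
    SmoothFieldOn X Set.univ → SmoothFieldOn Y Set.univ → ∀ x : M, Θ.nijenhuis X Y x = 0

/-- `Θ` restricted to the open set `U` is integrable: some smooth torsion-free connection on (the
tangent bundle of) `U` makes it parallel. Here `conn Y x (X x)` is `∇_X Y` at `x`. -/
def IsIntegrableOn (Θ : Tensor11 n M) (U : Set M) : Prop :=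
  ∃ conn : (∀ x : M, TangentSpace (𝓡 n) x) →
      (∀ x : M, TangentSpace (𝓡 n) x →L[ℝ] TangentSpace (𝓡 n) x),
    IsCovariantDerivativeOn (EuclideanSpace ℝ (Fin n)) conn U ∧
    ContMDiffCovariantDerivativeOn (EuclideanSpace ℝ (Fin n)) ∞ conn U ∧
    -- the torsion vanishes
    (∀ x ∈ U, ∀ X Y : ∀ z : M, TangentSpace (𝓡 n) z,
      FieldDifferentiableAt X x → FieldDifferentiableAt Y x →
        conn Y x (X x) - conn X x (Y x) = VectorField.mlieBracket (𝓡 n) X Y x) ∧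
    -- `∇Θ = 0`
    (∀ x ∈ U, ∀ Y : ∀ z : M, TangentSpace (𝓡 n) z, FieldDifferentiableAt Y x →
      ∀ ξ : TangentSpace (𝓡 n) x, conn (fun z => Θ z (Y z)) x ξ = Θ x (conn Y x ξ))

/-- `Θ` is integrable: some smooth torsion-free connection on `M` makes it parallel. -/
def IsIntegrable (Θ : Tensor11 n M) : Prop :=
  Θ.IsIntegrableOn Set.univ

/-- The codimension of `Im Θ` in `Ker Θ` at `x`, for `Θ` with `Im Θ ⊆ Ker Θ`. -/
def codimImKer (Θ : Tensor11 n M) (x : M) : ℕ :=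
  Module.finrank ℝ
    ((Θ x).toLinearMap.ker ⧸ (Θ x).toLinearMap.range.submoduleOf (Θ x).toLinearMap.ker)

end Tensor11

/-- The differential at `y` of a coordinate chart, with values in the model space. -/
def chartDifferential {E : Type} [NormedAddCommGroup E] [NormedSpace ℝ E] {B : Type v}
    [TopologicalSpace B] [ChartedSpace E B] (e : OpenPartialHomeomorph B E) (y : B) :
    TangentSpace 𝓘(ℝ, E) y →L[ℝ] E :=
  mfderiv 𝓘(ℝ, E) 𝓘(ℝ, E) e y

/-- A (smooth) distribution on `B`: a vector subbundle of the tangent bundle, that is, a family of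
subspaces having, near each point, a basis of smooth vector fields. -/
structure SmoothDistribution (m : ℕ) (B : Type v) [TopologicalSpace B]
    [ChartedSpace (EuclideanSpace ℝ (Fin m)) B] [IsManifold (𝓡 m) ∞ B] where
  space : ∀ y : B, Submodule ℝ (TangentSpace (𝓡 m) y)
  exists_local_frame : ∀ y₀ : B, ∃ (k : ℕ) (W : Set B)
    (X : Fin k → ∀ y : B, TangentSpace (𝓡 m) y), IsOpen W ∧ y₀ ∈ W ∧
      (∀ i, SmoothFieldOn (X i) W) ∧
      ∀ y ∈ W, LinearIndependent ℝ (fun i => X i y) ∧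
        Submodule.span ℝ (Set.range fun i => X i y) = space y

namespace SmoothDistribution

variable {m : ℕ} {B : Type v} [TopologicalSpace B]
  [ChartedSpace (EuclideanSpace ℝ (Fin m)) B] [IsManifold (𝓡 m) ∞ B]

/-- The fibre at `y` of the quotient bundle `TB / D`. -/
abbrev Quot (D : SmoothDistribution m B) (y : B) : Type :=
  TangentSpace (𝓡 m) y ⧸ D.space y

/-- Integrability of a distribution: around each point there is a coordinate chart carrying the
distribution to a constant one, so that it is tangent to a foliation. -/
def IsIntegrable (D : SmoothDistribution m B) : Prop :=
  ∀ y₀ : B, ∃ e ∈ IsManifold.maximalAtlas (𝓡 m) ∞ B, y₀ ∈ e.source ∧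
    ∃ F : Submodule ℝ (EuclideanSpace ℝ (Fin m)), ∀ y ∈ e.source,
      ∀ η : TangentSpace (𝓡 m) y, η ∈ D.space y ↔ chartDifferential e y η ∈ F

end SmoothDistribution

/-- An affine bundle over `B`, with `n`-dimensional total space, associated with the quotient
vector bundle `TB / D`: every fibre is an affine space with translation space `T_y B / D_y`, and
locally, over open sets `W`, a section `s` and smooth vector fields `X i` inducing a frame of
`TB / D` turn `(y, c) ↦ s y + ∑ i, c i • [X i y]` into a diffeomorphism from `W × ℝ ^ r` onto the
part of the total space lying over `W`. -/
structure AffineQuotientBundle (n : ℕ) {m : ℕ} {B : Type v} [TopologicalSpace B]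
    [ChartedSpace (EuclideanSpace ℝ (Fin m)) B] [IsManifold (𝓡 m) ∞ B]
    (D : SmoothDistribution m B) where
  Total : Type v
  [topTotal : TopologicalSpace Total]
  [chartedTotal : ChartedSpace (EuclideanSpace ℝ (Fin n)) Total]
  [manifoldTotal : IsManifold (𝓡 n) ∞ Total]
  [t2Total : T2Space Total]
  [secondCountableTotal : SecondCountableTopology Total]
  proj : Total → B
  [torsor : ∀ y : B, AddTorsor (D.Quot y) {p : Total // proj p = y}]
  locally_trivial : ∀ y₀ : B, ∃ (r : ℕ) (W : Set B) (s : ∀ y : B, {p : Total // proj p = y})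
    (X : Fin r → ∀ y : B, TangentSpace (𝓡 m) y)
    (e : OpenPartialHomeomorph Total (B × EuclideanSpace ℝ (Fin r))),
      IsOpen W ∧ y₀ ∈ W ∧
      (∀ i, SmoothFieldOn (X i) W) ∧
      (∀ y ∈ W, LinearIndependent ℝ (fun i => (D.space y).mkQ (X i y)) ∧
        Submodule.span ℝ (Set.range fun i => (D.space y).mkQ (X i y)) = ⊤) ∧
      e.source = proj ⁻¹' W ∧ e.target = W ×ˢ Set.univ ∧
      ContMDiffOn (𝓡 n) ((𝓡 m).prod (𝓡 r)) ∞ e e.source ∧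
      ContMDiffOn ((𝓡 m).prod (𝓡 r)) (𝓡 n) ∞ e.symm e.target ∧
      ∀ y ∈ W, ∀ c : EuclideanSpace ℝ (Fin r),
        e.symm (y, c) = ((∑ i, c i • (D.space y).mkQ (X i y)) +ᵥ s y : {p : Total // proj p = y})

attribute [instance] AffineQuotientBundle.topTotal AffineQuotientBundle.chartedTotal
  AffineQuotientBundle.manifoldTotal AffineQuotientBundle.t2Total
  AffineQuotientBundle.secondCountableTotal AffineQuotientBundle.torsor

namespace AffineQuotientBundle

variable {n m : ℕ} {B : Type v} [TopologicalSpace B]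
  [ChartedSpace (EuclideanSpace ℝ (Fin m)) B] [IsManifold (𝓡 m) ∞ B]
  {D : SmoothDistribution m B}

/-- The line `t ↦ p + t q` in the fibre through `p`. -/
def fibreLine (A : AffineQuotientBundle n D) (p : A.Total) (q : D.Quot (A.proj p)) (t : ℝ) :
    A.Total :=
  ((t • q) +ᵥ (⟨p, rfl⟩ : {p' : A.Total // A.proj p' = A.proj p}) :
    {p' : A.Total // A.proj p' = A.proj p})

/-- The identification of `T_y B / D_y` with the tangent space at `p` of the affine space which is
the fibre over `y = π p`: a translation vector `q` goes to the velocity at `t = 0` of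
`t ↦ p + t q`. -/
def vertical (A : AffineQuotientBundle n D) (p : A.Total) (q : D.Quot (A.proj p)) :
    TangentSpace (𝓡 n) p :=
  mfderiv 𝓘(ℝ, ℝ) (𝓡 n) (A.fibreLine p q) 0 (1 : ℝ)

/-- The canonical `(1,1)` tensor of the affine bundle: `Θ_p ξ = [dπ_p ξ] ∈ T_y B / D_y`, which is
the tangent space at `p` of the fibre over `y = π p`. -/
def tensor (A : AffineQuotientBundle n D) (p : A.Total) (ξ : TangentSpace (𝓡 n) p) :
    TangentSpace (𝓡 n) p :=
  A.vertical p ((D.space (A.proj p)).mkQ (mfderiv (𝓡 n) (𝓡 m) A.proj p ξ))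

end AffineQuotientBundle

/-- A realization, over an open set `U = φ.source` of `M`, of the tensor `Θ` through the
affine-bundle construction: a manifold `Base` with a distribution `dist`, an affine bundle over
`Base` associated with `T Base / dist`, and a diffeomorphism `φ` of `U` onto an open subset of the
total space, meeting every fibre, that sends `Θ` to the canonical tensor of the affine bundle. -/
structure LocalRealization {n : ℕ} {M : Type u} [TopologicalSpace M]
    [ChartedSpace (EuclideanSpace ℝ (Fin n)) M] [IsManifold (𝓡 n) ∞ M] (Θ : Tensor11 n M) where
  baseDim : ℕ
  Base : Type v
  [topBase : TopologicalSpace Base]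
  [chartedBase : ChartedSpace (EuclideanSpace ℝ (Fin baseDim)) Base]
  [manifoldBase : IsManifold (𝓡 baseDim) ∞ Base]
  [t2Base : T2Space Base]
  [secondCountableBase : SecondCountableTopology Base]
  dist : SmoothDistribution baseDim Base
  bundle : AffineQuotientBundle n dist
  φ : OpenPartialHomeomorph M bundle.Total
  smooth_φ : ContMDiffOn (𝓡 n) (𝓡 n) ∞ φ φ.source
  smooth_φ_symm : ContMDiffOn (𝓡 n) (𝓡 n) ∞ φ.symm φ.target
  meets_fibres : ∀ y : Base, ∃ x ∈ φ.source, bundle.proj (φ x) = y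
  map_tensor : ∀ x ∈ φ.source, ∀ ξ : TangentSpace (𝓡 n) x,
    mfderiv (𝓡 n) (𝓡 n) φ x (Θ x ξ) = bundle.tensor (φ x) (mfderiv (𝓡 n) (𝓡 n) φ x ξ)

attribute [instance] LocalRealization.topBase LocalRealization.chartedBase
  LocalRealization.manifoldBase LocalRealization.t2Base LocalRealization.secondCountableBase

end

/-! Read `Θ` in coordinates as a matrix-valued function `T`; its rank is constant. Vanishing of the
Nijenhuis tensor makes `Im Θ` involutive, so coordinates exist in which `Im Θ` is a constant
subspace `E` of `F × E` (`exists_straightening_range`). Since `Θ² = 0` kills the image, `Θ` then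
reads `(f, e) ↦ (0, H_p f)` with `H_p : F → E` surjective, and `N = 0` says exactly that the
vertical fields `(0, H f)`, for constant `f`, commute. Let `S` be a right inverse of `H` at the base
point. The commuting frame `(0, H S h)` of the vertical directions can be made constant without
touching the `F`-coordinate (`exists_straightening_vertical`), so that `H_p S = id` everywhere. The
vertical derivative of `H` now vanishes: on the image of `S` because `H S` is constant, and on `ker
H_p` by the symmetry that expresses `N = 0` (`eq_of_fst_eq_of_rightInverse`). Hence `Θ` is `(f, e) ↦
(0, G_y f)` with `G` a function on the base alone. This is the affine-bundle tensor of `D = ker G`,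
where `G_y` identifies the quotient by `D_y` with `E`.

Conversely, a base chart and a local trivialization put any realization into this normal form with
`ker G = D` (`LocalRealization.exists_isAdapted`), and the rank of `D` follows by counting
dimensions. If `Θ` is parallel for a torsion-free connection, then `Ker Θ` is closed under brackets;
fields in `D` lift to fields in `Ker Θ`, so `D` is involutive and Frobenius' theorem applies
(`exists_straightening_ker`). If `D` is constant in a base chart, all the `G_u` have the same
kernel, so `G_u = K_u G_{u₀}` with `K_u` invertible nearby. Applying `K_u⁻¹` in the fibres makes `Θ`
constant, hence parallel for a flat connection. The torsion-free connections making `Θ` parallel are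
closed under affine combinations, so the local ones glue (`Tensor11.isIntegrableOn_of_locally`);
this serves a single domain and all of `M` alike.

All the straightening results come from one statement on commuting frames, `exists_straightening`.
It rests on the solution of `α' = L(α) h`, smooth in `h` and in the initial point, obtained by the
inverse function theorem in a space of curves (`exists_local_action`). -/

noncomputable section Development

open scoped Topology
open Set Filter

/-! ### Calculus on spaces of continuous curves, and the inverse function theorem. -/

section

set_option synthInstance.maxHeartbeats 400000

/-- A bounded bilinear map, applied pointwise to continuous functions. -/
def ContinuousMap.bilinCLM (X : Type*) [TopologicalSpace X] [CompactSpace X]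
    {Y V W : Type*} [NormedAddCommGroup Y] [NormedSpace ℝ Y] [NormedAddCommGroup V]
    [NormedSpace ℝ V] [NormedAddCommGroup W] [NormedSpace ℝ W] (B : Y →L[ℝ] V →L[ℝ] W) :
    C(X, Y) →L[ℝ] C(X, V) →L[ℝ] C(X, W) :=
  LinearMap.mkContinuous₂
    (LinearMap.mk₂ ℝ (fun (A : C(X, Y)) (β : C(X, V)) =>
        (⟨fun x => B (A x) (β x), (B.continuous.comp A.continuous).clm_apply β.continuous⟩ : C(X, W)))
      (fun A A' β => by ext; simp) (fun c A β => by ext; simp)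
      (fun A β β' => by ext; simp) (fun c A β => by ext; simp)) ‖B‖
    (fun A β => by
      refine (ContinuousMap.norm_le _ (by positivity)).2 fun x => ?_
      refine (B.le_opNorm₂ _ _).trans ?_
      gcongr
      · exact A.norm_coe_le_norm x
      · exact β.norm_coe_le_norm x)

@[simp]
lemma ContinuousMap.bilinCLM_apply {X : Type*} [TopologicalSpace X] [CompactSpace X]
    {Y V W : Type*} [NormedAddCommGroup Y] [NormedSpace ℝ Y] [NormedAddCommGroup V]
    [NormedSpace ℝ V] [NormedAddCommGroup W] [NormedSpace ℝ W] (B : Y →L[ℝ] V →L[ℝ] W)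
    (A : C(X, Y)) (β : C(X, V)) (x : X) :
    ContinuousMap.bilinCLM X B A β x = B (A x) (β x) := rfl

/-- Pointwise application `C(X, V →L W) → C(X, V) → C(X, W)` as a bounded bilinear map. -/
def ContinuousMap.applyCLM (X : Type*) [TopologicalSpace X] [CompactSpace X]
    (V W : Type*) [NormedAddCommGroup V] [NormedSpace ℝ V] [NormedAddCommGroup W]
    [NormedSpace ℝ W] : C(X, V →L[ℝ] W) →L[ℝ] C(X, V) →L[ℝ] C(X, W) :=
  ContinuousMap.bilinCLM X (ContinuousLinearMap.id ℝ (V →L[ℝ] W))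

@[simp]
lemma ContinuousMap.applyCLM_apply {X : Type*} [TopologicalSpace X] [CompactSpace X]
    {V W : Type*} [NormedAddCommGroup V] [NormedSpace ℝ V] [NormedAddCommGroup W]
    [NormedSpace ℝ W] (A : C(X, V →L[ℝ] W)) (β : C(X, V)) (x : X) :
    ContinuousMap.applyCLM X V W A β x = A x (β x) := rfl

/-- Postcomposition with `f'` is continuous for the sup norm, so `f'` varies by at most `ε` on all
the segments from `α x` to `α x + β x` at once. The mean value inequality then bounds the remainder
by `ε ‖β‖` uniformly in `x`. -/
lemma ContinuousMap.hasFDerivAt_postcomp {X : Type*} [TopologicalSpace X] [CompactSpace X]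
    {V W : Type*} [NormedAddCommGroup V] [NormedSpace ℝ V] [NormedAddCommGroup W]
    [NormedSpace ℝ W] (f : C(V, W)) (f' : C(V, V →L[ℝ] W)) (hf : ∀ v, HasFDerivAt f (f' v) v)
    (α : C(X, V)) :
    HasFDerivAt (fun α : C(X, V) => f.comp α) (ContinuousMap.applyCLM X V W (f'.comp α)) α := by
  rw [hasFDerivAt_iff_isLittleO_nhds_zero, Asymptotics.isLittleO_iff]
  intro ε hε
  have hc : Continuous fun β : C(X, V) => f'.comp β := f'.continuous_postcomp
  obtain ⟨δ, hδ, hδ'⟩ := (Metric.continuousAt_iff (α := C(X, V)) (β := C(X, V →L[ℝ] W))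
    (f := fun β => f'.comp β) (a := α)).1 hc.continuousAt ε hε
  filter_upwards [Metric.ball_mem_nhds (0 : C(X, V)) hδ] with β hβ
  rw [mem_ball_zero_iff] at hβ
  refine (ContinuousMap.norm_le _ (by positivity)).2 fun x => ?_
  have key : ∀ v ∈ segment ℝ (α x) (α x + β x), ‖f' v - f' (α x)‖ ≤ ε := by
    intro v hv
    rw [segment_eq_image'] at hv
    obtain ⟨s, hs, rfl⟩ := hv
    have h1 : dist (α + s • β) α < δ := by
      rw [dist_eq_norm, add_sub_cancel_left, norm_smul, Real.norm_of_nonneg hs.1]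
      exact lt_of_le_of_lt (mul_le_of_le_one_left (norm_nonneg _) hs.2) hβ
    have h2 := ((f'.comp (α + s • β) - f'.comp α).norm_coe_le_norm x).trans
      ((dist_eq_norm _ _).symm.trans_le (hδ' h1).le)
    simpa using h2
  have h := Convex.norm_image_sub_le_of_norm_hasFDerivWithin_le' (𝕜 := ℝ) (f := f) (f' := f')
    (φ := f' (α x)) (fun v _ => (hf v).hasFDerivWithinAt) key (convex_segment _ _)
    (left_mem_segment ℝ _ _) (right_mem_segment ℝ _ _)
  simp only [add_sub_cancel_left] at h
  refine (le_of_eq ?_).trans (h.trans (mul_le_mul_of_nonneg_left (β.norm_coe_le_norm x) hε.le))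
  simp

/-- Composition with a `C^n` map is a `C^n` map between spaces of continuous functions. -/
lemma ContinuousMap.contDiff_postcomp {X : Type*} [TopologicalSpace X] [CompactSpace X]
    {V : Type u} {W : Type u} [NormedAddCommGroup V] [NormedSpace ℝ V] [NormedAddCommGroup W]
    [NormedSpace ℝ W] (n : ℕ) (f : C(V, W)) (hf : ContDiff ℝ n f) :
    ContDiff ℝ n (fun α : C(X, V) => f.comp α) := by
  -- The target has to vary, because the derivative is postcomposition with `fderiv ℝ f`, valued in
  -- `V →L[ℝ] W`. A common universe for `V` and `W` keeps that space an admissible target.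
  induction n generalizing W with
  | zero => exact contDiff_zero.2 f.continuous_postcomp
  | succ n ih =>
    have hf' := hf
    rw [Nat.cast_succ, contDiff_succ_iff_fderiv] at hf'
    obtain ⟨h1, -, h2⟩ := hf'
    have hd := ContinuousMap.hasFDerivAt_postcomp (X := X) f ⟨fderiv ℝ f, h2.continuous⟩
      (fun v => (h1 v).hasFDerivAt)
    rw [Nat.cast_succ, contDiff_succ_iff_fderiv]
    refine ⟨fun α => (hd α).differentiableAt, by simp, ?_⟩
    have : fderiv ℝ (fun α : C(X, V) => f.comp α) = fun α =>
        ContinuousMap.applyCLM X V W ((⟨fderiv ℝ f, h2.continuous⟩ : C(V, V →L[ℝ] W)).comp α) :=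
      funext fun α => (hd α).fderiv
    rw [this]
    exact (ContinuousMap.applyCLM X V W).contDiff.comp (ih ⟨fderiv ℝ f, h2.continuous⟩ h2)

/-- Primitive vanishing at `0`, on the space of continuous functions on the unit interval. -/
def ContinuousMap.primitiveCLM (V : Type*) [NormedAddCommGroup V] [NormedSpace ℝ V]
    : C(unitInterval, V) →L[ℝ] C(unitInterval, V) :=
  have hint : ∀ (α : C(unitInterval, V)) (a b : ℝ),
      IntervalIntegrable (Set.IccExtend zero_le_one α) MeasureTheory.volume a b := fun α a b =>
    (α.continuous.Icc_extend' (h := zero_le_one)).intervalIntegrable a b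
  LinearMap.mkContinuous
    { toFun := fun α => ⟨fun t => ∫ s in (0 : ℝ)..t, Set.IccExtend zero_le_one α s,
        (intervalIntegral.continuous_primitive (hint α) 0).comp continuous_subtype_val⟩
      map_add' := fun α β => by
        ext t
        simpa [Set.IccExtend, Function.comp_def] using
          intervalIntegral.integral_add (hint α 0 t) (hint β 0 t)
      map_smul' := fun c α => by
        ext t
        simp [Set.IccExtend] } 1
    (fun α => by
      rw [one_mul]
      refine (ContinuousMap.norm_le _ (norm_nonneg _)).2 fun t => ?_
      have h := intervalIntegral.norm_integral_le_of_norm_le_const (a := 0) (b := (t : ℝ))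
        (f := Set.IccExtend zero_le_one α) (C := ‖α‖) (fun s _ => α.norm_coe_le_norm _)
      refine h.trans ?_
      rw [sub_zero, abs_of_nonneg t.2.1]
      exact mul_le_of_le_one_right (norm_nonneg _) t.2.2)

lemma ContinuousMap.primitiveCLM_apply {V : Type*} [NormedAddCommGroup V] [NormedSpace ℝ V]
    (α : C(unitInterval, V)) (t : unitInterval) :
    ContinuousMap.primitiveCLM V α t = ∫ s in (0 : ℝ)..t, Set.IccExtend zero_le_one α s := rfl

/-- A curve whose derivative is the restriction of `β` is recovered as a primitive. -/
lemma ContinuousMap.primitiveCLM_eq_of_hasDerivAt {V : Type*} [NormedAddCommGroup V]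
    [NormedSpace ℝ V] [CompleteSpace V] (g : ℝ → V) (β : C(unitInterval, V))
    (hg : ∀ t : ℝ, t ∈ Icc (0 : ℝ) 1 → HasDerivWithinAt g (Set.IccExtend zero_le_one β t) (Icc 0 1) t)
    (t : unitInterval) : ContinuousMap.primitiveCLM V β t = g t - g 0 := by
  rw [ContinuousMap.primitiveCLM_apply]
  refine intervalIntegral.integral_eq_sub_of_hasDeriv_right_of_le t.2.1 ?_ ?_
    ((β.continuous.Icc_extend' (h := zero_le_one)).intervalIntegrable _ _)
  · exact fun s hs => (hg s ⟨hs.1, hs.2.trans t.2.2⟩).continuousWithinAt.mono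
      (Icc_subset_Icc_right t.2.2)
  · intro s hs
    have hs1 : s < 1 := hs.2.trans_le t.2.2
    refine (hg s ⟨hs.1.le, hs1.le⟩).mono_of_mem_nhdsWithin ?_
    exact mem_of_superset (Ioo_mem_nhdsGT hs1) fun r hr => ⟨hs.1.le.trans hr.1.le, hr.2.le⟩

lemma ContinuousMap.hasDerivWithinAt_primitiveCLM {V : Type*} [NormedAddCommGroup V]
    [NormedSpace ℝ V] [CompleteSpace V] (β : C(unitInterval, V)) (t : ℝ) :
    HasDerivAt (fun t : ℝ => ∫ s in (0 : ℝ)..t, Set.IccExtend zero_le_one β s)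
      (Set.IccExtend zero_le_one β t) t := by
  have hc := β.continuous.Icc_extend' (h := zero_le_one)
  exact intervalIntegral.integral_hasDerivAt_right (hc.intervalIntegrable _ _)
    (hc.stronglyMeasurableAtFilter _ _) hc.continuousAt

/-- The inverse function theorem, on a neighbourhood. -/
lemma exists_openPartialHomeomorph_contDiffOn {V W : Type*} [NormedAddCommGroup V]
    [NormedSpace ℝ V] [CompleteSpace V] [NormedAddCommGroup W] [NormedSpace ℝ W]
    {f : V → W} {s : Set V} (hs : IsOpen s) {x : V} (hx : x ∈ s) (hf : ContDiffOn ℝ ∞ f s)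
    (f' : V ≃L[ℝ] W) (hf' : HasFDerivAt f (f' : V →L[ℝ] W) x) :
    ∃ Φ : OpenPartialHomeomorph V W, x ∈ Φ.source ∧ Φ.source ⊆ s ∧ (∀ y, Φ y = f y) ∧
      ContDiffOn ℝ ∞ Φ Φ.source ∧ ContDiffOn ℝ ∞ Φ.symm Φ.target ∧
      ∀ y ∈ Φ.source, ∃ e : V ≃L[ℝ] W, HasFDerivAt f (e : V →L[ℝ] W) y := by
  have hfx : ContDiffAt ℝ ∞ f x := hf.contDiffAt (hs.mem_nhds hx)
  let Φ₀ := hfx.toOpenPartialHomeomorph f hf' (by simp)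
  have hx₀ : x ∈ Φ₀.source := hfx.mem_toOpenPartialHomeomorph_source hf' (by simp)
  have hc : ContinuousOn (fderiv ℝ f) s := hf.continuousOn_fderiv_of_isOpen hs (by simp)
  -- Invertible operators form an open set; restricting to points with invertible derivative makes
  -- the inverse smooth on the whole target and not only at one point.
  let t : Set V := s ∩ fderiv ℝ f ⁻¹' range ((↑) : (V ≃L[ℝ] W) → V →L[ℝ] W)
  have ht : IsOpen t := hc.isOpen_inter_preimage hs ContinuousLinearEquiv.isOpen
  have hxt : x ∈ t := ⟨hx, f', hf'.fderiv.symm⟩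
  have hder : ∀ y ∈ t, ∃ e : V ≃L[ℝ] W, HasFDerivAt f (e : V →L[ℝ] W) y := by
    rintro y ⟨hy, e, he⟩
    refine ⟨e, ?_⟩
    rw [he]
    exact ((hf.contDiffAt (hs.mem_nhds hy)).differentiableAt (by simp)).hasFDerivAt
  refine ⟨Φ₀.restrOpen t ht, ⟨hx₀, hxt⟩, fun y hy => hy.2.1, fun y => rfl, ?_, ?_, ?_⟩
  · exact hf.mono fun y hy => hy.2.1
  · intro w hw
    have hy := (Φ₀.restrOpen t ht).map_target hw
    obtain ⟨e, he⟩ := hder _ hy.2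
    exact (OpenPartialHomeomorph.contDiffAt_symm (Φ₀.restrOpen t ht) hw he
      (hf.contDiffAt (hs.mem_nhds hy.2.1))).contDiffWithinAt
  · exact fun y hy => hder y hy.2

end

/-! ### Integrating commuting vector fields to a smooth local action. -/

section

set_option synthInstance.maxHeartbeats 400000

lemma ContinuousMap.norm_primitiveCLM_apply_le {V : Type*} [NormedAddCommGroup V]
    [NormedSpace ℝ V] (α : C(unitInterval, V)) : ‖ContinuousMap.primitiveCLM V α‖ ≤ ‖α‖ := by
  refine (ContinuousMap.norm_le _ (norm_nonneg _)).2 fun t => ?_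
  have h := intervalIntegral.norm_integral_le_of_norm_le_const (a := 0) (b := (t : ℝ))
    (f := Set.IccExtend zero_le_one α) (C := ‖α‖) (fun s _ => α.norm_coe_le_norm _)
  refine h.trans ?_
  rw [sub_zero, abs_of_nonneg t.2.1]
  exact mul_le_of_le_one_right (norm_nonneg _) t.2.2

/-- The constant-in-time pairing of a vector with a curve. -/
def ContinuousMap.pairCLM (X : Type*) [TopologicalSpace X] [CompactSpace X] (E V : Type*)
    [NormedAddCommGroup E] [NormedSpace ℝ E] [NormedAddCommGroup V] [NormedSpace ℝ V] :
    E × C(X, V) →L[ℝ] C(X, E × V) :=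
  ((ContinuousLinearMap.inl ℝ E V).compLeftContinuous ℝ X ∘L ContinuousLinearMap.const ℝ X) ∘L
      ContinuousLinearMap.fst ℝ E C(X, V)
    + (ContinuousLinearMap.inr ℝ E V).compLeftContinuous ℝ X ∘L
      ContinuousLinearMap.snd ℝ E C(X, V)

@[simp]
lemma ContinuousMap.pairCLM_apply {X : Type*} [TopologicalSpace X] [CompactSpace X] {E V : Type*}
    [NormedAddCommGroup E] [NormedSpace ℝ E] [NormedAddCommGroup V] [NormedSpace ℝ V]
    (q : E × C(X, V)) (x : X) : ContinuousMap.pairCLM X E V q x = (q.1, q.2 x) := by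
  simp [ContinuousMap.pairCLM]

section LocalAction

variable {E V : Type u} [NormedAddCommGroup E] [NormedSpace ℝ E] [NormedAddCommGroup V]
  [NormedSpace ℝ V]

/-- The velocity `t ↦ L (α t) h` as a map on spaces of curves. -/
def velocityMap (L : V → E →L[ℝ] V) (hL : Continuous L) (q : E × C(unitInterval, V)) :
    C(unitInterval, V) :=
  (⟨fun r : E × V => L r.2 r.1, (hL.comp continuous_snd).clm_apply continuous_fst⟩ :
    C(E × V, V)).comp (ContinuousMap.pairCLM unitInterval E V q)

@[simp]
lemma velocityMap_apply (L : V → E →L[ℝ] V) (hL : Continuous L) (q : E × C(unitInterval, V))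
    (t : unitInterval) : velocityMap L hL q t = L (q.2 t) q.1 := by
  simp [velocityMap]

lemma contDiff_velocityMap (L : V → E →L[ℝ] V) (hL : ContDiff ℝ ∞ L) :
    ContDiff ℝ ∞ (velocityMap L hL.continuous) := by
  rw [contDiff_infty]
  intro n
  refine (ContinuousMap.contDiff_postcomp n _ ?_).comp
    (ContinuousMap.pairCLM unitInterval E V).contDiff
  exact ((hL.of_le (by exact_mod_cast le_top)).comp contDiff_snd).clm_apply contDiff_fst

/-- Evaluation at `t` is continuous and linear, so the derivative on the curve space is found
pointwise from the product rule for `(h, v) ↦ L v h`. -/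
lemma fderiv_velocityMap_apply (L : V → E →L[ℝ] V) (hL : ContDiff ℝ ∞ L)
    (q r : E × C(unitInterval, V)) (t : unitInterval) :
    fderiv ℝ (velocityMap L hL.continuous) q r t
      = fderiv ℝ L (q.2 t) (r.2 t) q.1 + L (q.2 t) r.1 := by
  have hd := (((contDiff_velocityMap L hL).differentiable (by simp)) q).hasFDerivAt
  have h1 := ((ContinuousMap.evalCLM ℝ t : C(unitInterval, V) →L[ℝ] V).hasFDerivAt.comp q hd)
  have h2 : HasFDerivAt (fun q : E × C(unitInterval, V) => L (q.2 t) q.1)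
      (((L (q.2 t)).comp (ContinuousLinearMap.fst ℝ E C(unitInterval, V))) +
        (((fderiv ℝ L (q.2 t)).comp ((ContinuousMap.evalCLM ℝ t : C(unitInterval, V) →L[ℝ] V).comp
          (ContinuousLinearMap.snd ℝ E C(unitInterval, V)))).flip q.1)) q := by
    have h3 : HasFDerivAt (fun q : E × C(unitInterval, V) => L (q.2 t))
        ((fderiv ℝ L (q.2 t)).comp ((ContinuousMap.evalCLM ℝ t : C(unitInterval, V) →L[ℝ] V).comp
          (ContinuousLinearMap.snd ℝ E C(unitInterval, V)))) q :=
      HasFDerivAt.comp (f := fun q : E × C(unitInterval, V) => q.2 t) q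
        ((hL.differentiable (by simp)) (q.2 t)).hasFDerivAt
        (((ContinuousMap.evalCLM ℝ t : C(unitInterval, V) →L[ℝ] V).comp
          (ContinuousLinearMap.snd ℝ E C(unitInterval, V))).hasFDerivAt)
    exact h3.clm_apply hasFDerivAt_fst
  have h4 : ((ContinuousMap.evalCLM ℝ t : C(unitInterval, V) →L[ℝ] V) ∘
      velocityMap L hL.continuous) = fun q : E × C(unitInterval, V) => L (q.2 t) q.1 := by
    ext q; simp [ContinuousMap.evalCLM]
  rw [h4] at h1
  have h5 := congrArg (fun A => A r) (h1.unique h2)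
  simp only [ContinuousLinearMap.comp_apply, add_apply,
    ContinuousLinearMap.flip_apply] at h5
  exact h5.trans (add_comm _ _)

/-- The linearized integral equation, in the direction of the parameter. -/
lemma fderiv_apply_inl_of_integral_eq (L : V → E →L[ℝ] V) (hL : ContDiff ℝ ∞ L)
    {α : E × V → C(unitInterval, V)} {q : E × V} (hα : DifferentiableAt ℝ α q)
    (hsol : ∀ᶠ r in 𝓝 q, α r = ContinuousLinearMap.const ℝ unitInterval r.2 +
      ContinuousMap.primitiveCLM V (velocityMap L hL.continuous (r.1, α r))) (k : E) :
    fderiv ℝ α q (k, 0) = ContinuousMap.primitiveCLM V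
      (fderiv ℝ (velocityMap L hL.continuous) (q.1, α q) (k, fderiv ℝ α q (k, 0))) := by
  have hT := (contDiff_velocityMap L hL).differentiable (by simp)
  generalize velocityMap L hL.continuous = T at *
  have h0 : HasFDerivAt (fun q : E × V => T (q.1, α q)) _ q :=
    (hT (q.1, α q)).hasFDerivAt.comp (f := fun q : E × V => (q.1, α q)) q
      (hasFDerivAt_fst.prodMk hα.hasFDerivAt)
  have h1 : HasFDerivAt (fun r : E × V => ContinuousLinearMap.const ℝ unitInterval r.2 +
      ContinuousMap.primitiveCLM V (T (r.1, α r))) _ q :=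
    ((ContinuousLinearMap.const ℝ unitInterval (M := V)).hasFDerivAt.comp q hasFDerivAt_snd).add
      ((ContinuousMap.primitiveCLM V).hasFDerivAt.comp q h0)
  have h3 := congrArg (fun A => A (k, 0))
    (hα.hasFDerivAt.unique (h1.congr_of_eventuallyEq hsol))
  simpa using h3

/-- Along a solution, `t • L (α t) k` has derivative `L (α t) k + t • DL(α t)(L (α t) h) k`.
Commutation exchanges `h` and `k` in the second term, which turns this into the linearized equation
in the direction `k`. The variation of the solution with the parameter thus has a closed form. -/
lemma exists_curve_integral_eq [CompleteSpace V] (L : V → E →L[ℝ] V) (hL : ContDiff ℝ ∞ L)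
    {α : C(unitInterval, V)} {h : E} {p : V}
    (hsol : α = ContinuousLinearMap.const ℝ unitInterval p +
      ContinuousMap.primitiveCLM V (velocityMap L hL.continuous (h, α)))
    (hcomm : ∀ t h k, fderiv ℝ L (α t) (L (α t) h) k = fderiv ℝ L (α t) (L (α t) k) h) (k : E) :
    ∃ ρ : C(unitInterval, V), (∀ t : unitInterval, ρ t = (t : ℝ) • L (α t) k) ∧
      ρ = ContinuousMap.primitiveCLM V (fderiv ℝ (velocityMap L hL.continuous) (h, α) (k, ρ)) := by
  let ρ : C(unitInterval, V) := ⟨fun t => (t : ℝ) • L (α t) k,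
    continuous_subtype_val.smul ((hL.continuous.comp α.continuous).clm_apply continuous_const)⟩
  refine ⟨ρ, fun t => rfl, ?_⟩
  let β := velocityMap L hL.continuous (h, α)
  let γ : ℝ → V := fun t => p + ∫ r in (0 : ℝ)..t, Set.IccExtend zero_le_one β r
  have hγ : ∀ t : ℝ, HasDerivAt γ (Set.IccExtend zero_le_one β t) t := fun t =>
    (ContinuousMap.hasDerivWithinAt_primitiveCLM β t).const_add _
  have hγα : ∀ t : unitInterval, γ t = α t := fun t => by
    conv_rhs => rw [hsol]
    rfl
  let g : ℝ → V := fun t => t • L (γ t) k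
  have hg : ∀ t : ℝ, HasDerivAt g (t • (fderiv ℝ L (γ t)
      (Set.IccExtend zero_le_one β t) k) + (1 : ℝ) • L (γ t) k) t := by
    intro t
    have h1 : HasDerivAt (fun t => L (γ t))
        (fderiv ℝ L (γ t) (Set.IccExtend zero_le_one β t)) t :=
      ((hL.differentiable (by simp)) (γ t)).hasFDerivAt.comp_hasDerivAt t (hγ t)
    have h2 : HasDerivAt (fun t => L (γ t) k) _ t := h1.clm_apply (hasDerivAt_const t k)
    exact HasDerivAt.congr_deriv (f := g) ((hasDerivAt_id t).smul h2) (by simp)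
  ext t
  rw [ContinuousMap.primitiveCLM_eq_of_hasDerivAt g]
  · simp [g, ρ, hγα]
  · intro t ht
    refine (hg t).hasDerivWithinAt.congr_deriv ?_
    rw [Set.IccExtend_of_mem _ _ ht, Set.IccExtend_of_mem _ _ ht, fderiv_velocityMap_apply L hL]
    have h3 := hγα ⟨t, ht⟩
    simp only at h3
    rw [h3, velocityMap_apply]
    simp only [ρ, ContinuousMap.coe_mk, one_smul, map_smul, smul_apply]
    rw [hcomm]

/-- The linearized integral operator has norm at most `K * ‖h‖ < 1`, so its only fixed point is
zero. This gives uniqueness for the linearized equation. -/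
lemma eq_zero_of_integral_eq (L : V → E →L[ℝ] V) (hL : ContDiff ℝ ∞ L)
    {α η : C(unitInterval, V)} {h : E} {K : ℝ} (hK : ∀ t, ‖fderiv ℝ L (α t)‖ ≤ K)
    (hKh : K * ‖h‖ < 1) (hη : η = ContinuousMap.primitiveCLM V
      (fderiv ℝ (velocityMap L hL.continuous) (h, α) (0, η))) : η = 0 := by
  have hK0 : 0 ≤ K := (norm_nonneg (fderiv ℝ L (α 0))).trans (hK 0)
  have h2 : ‖fderiv ℝ (velocityMap L hL.continuous) (h, α) (0, η)‖ ≤ K * ‖h‖ * ‖η‖ := by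
    refine (ContinuousMap.norm_le _ (by positivity)).2 fun t => ?_
    rw [fderiv_velocityMap_apply L hL]
    simp only [map_zero, add_zero]
    refine (ContinuousLinearMap.le_opNorm₂ _ _ _).trans ?_
    have h3 := hK t
    have h4 := η.norm_coe_le_norm t
    calc _ ≤ K * ‖η‖ * ‖h‖ := by gcongr
      _ = _ := by ring
  have h3 : ‖η‖ ≤ K * ‖h‖ * ‖η‖ := by
    conv_lhs => rw [hη]
    exact (ContinuousMap.norm_primitiveCLM_apply_le _).trans h2
  by_contra hne
  have h5 : 0 < ‖η‖ := norm_pos_iff.2 hne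
  nlinarith

/-- A commuting family `L` of vector fields, depending linearly on a parameter, integrates near a
point to a smooth local action `u` of the additive group of parameters. -/
theorem exists_local_action [CompleteSpace E] [CompleteSpace V] {W : Type*} [NormedAddCommGroup W]
    [NormedSpace ℝ W] [CompleteSpace W] (L : V → E →L[ℝ] V) (hL : ContDiff ℝ ∞ L) {p₀ : V}
    {Ω : Set V} (hΩ : IsOpen Ω)
    (hp₀ : p₀ ∈ Ω)
    (hcomm : ∀ p ∈ Ω, ∀ h k, fderiv ℝ L p (L p h) k = fderiv ℝ L p (L p k) h)
    (Q : V →L[ℝ] W) (hQ : ∀ p ∈ Ω, ∀ h, Q (L p h) = Q (L p₀ h)) :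
    ∃ (u : E × V → V) (O : Set (E × V)), IsOpen O ∧ (0, p₀) ∈ O ∧ ContDiffOn ℝ ∞ u O ∧
      (∀ p, (0, p) ∈ O → u (0, p) = p) ∧ (∀ q ∈ O, u q ∈ Ω) ∧
      (∀ q ∈ O, ∀ k, fderiv ℝ u q (k, 0) = L (u q) k) ∧
      (∀ q ∈ O, Q (u q) = Q q.2 + Q (L p₀ q.1)) := by
  set I := unitInterval
  let cst : V →L[ℝ] C(I, V) := ContinuousLinearMap.const ℝ I
  let P := ContinuousMap.primitiveCLM V
  let T := velocityMap L hL.continuous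
  have hT : ContDiff ℝ ∞ T := contDiff_velocityMap L hL
  have hTd : ∀ q, HasFDerivAt T (fderiv ℝ T q) q := fun q =>
    (hT.differentiable (by simp) q).hasFDerivAt
  let pr : (E × V) × C(I, V) →L[ℝ] E × C(I, V) :=
    ((ContinuousLinearMap.fst ℝ E V).comp (ContinuousLinearMap.fst ℝ (E × V) C(I, V))).prod
      (ContinuousLinearMap.snd ℝ (E × V) C(I, V))
  -- Zeros of `G` are the curves with `α(t) = p + ∫ L(α) h`. Pairing `G` with the parameters turns
  -- the inverse function theorem for `Ψ` into an implicit function theorem.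
  let G : (E × V) × C(I, V) → C(I, V) := fun x => x.2 - cst x.1.2 - P (T (pr x))
  have hG : ContDiff ℝ ∞ G :=
    (contDiff_snd.sub (cst.contDiff.comp (contDiff_snd.comp contDiff_fst))).sub
      (P.contDiff.comp (hT.comp pr.contDiff))
  let Ψ : (E × V) × C(I, V) → (E × V) × C(I, V) := fun x => (x.1, G x)
  have hΨ : ContDiff ℝ ∞ Ψ := contDiff_fst.prodMk hG
  let x₀ : (E × V) × C(I, V) := ((0, p₀), cst p₀)
  have hL'c : Continuous (fderiv ℝ L) := hL.continuous_fderiv (by simp)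
  let K := ‖fderiv ℝ L p₀‖ + 1
  obtain ⟨ε, hε, hεΩ⟩ := Metric.isOpen_iff.1
    (hΩ.inter (isOpen_lt (f := fun p => ‖fderiv ℝ L p‖) (Continuous.norm (f := fderiv ℝ L) hL'c) (continuous_const (y := K)))) p₀
    ⟨hp₀, show ‖fderiv ℝ L p₀‖ < K from lt_add_of_pos_right _ one_pos⟩
  -- The first condition keeps the curve where `L` commutes and `‖DL‖ < K`; the second makes the
  -- linearized operator a contraction.
  let s : Set ((E × V) × C(I, V)) := {x | dist x.2 (cst p₀) < ε ∧ K * ‖x.1.1‖ < 1}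
  have hs : IsOpen s :=
    (isOpen_lt (f := fun x : (E × V) × C(I, V) => dist x.2 (cst p₀)) (by fun_prop)
      continuous_const).inter
    (isOpen_lt (f := fun x : (E × V) × C(I, V) => K * ‖x.1.1‖) (by fun_prop) continuous_const)
  have hxs : x₀ ∈ s := by simp [s, x₀, hε]
  have hs1 : ∀ x ∈ s, ∀ t : I, x.2 t ∈ Ω ∧ ‖fderiv ℝ L (x.2 t)‖ ≤ K := by
    intro x hx t
    have h1 := hεΩ ((ContinuousMap.dist_apply_le_dist (f := x.2) (g := cst p₀) t).trans_lt hx.1)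
    exact ⟨h1.1, h1.2.le⟩
  -- the derivative at the base point
  let A : E × V →L[ℝ] C(I, V) := cst.comp (ContinuousLinearMap.snd ℝ E V) +
    P.comp (cst.comp ((L p₀).comp (ContinuousLinearMap.fst ℝ E V)))
  let Ψ' : ((E × V) × C(I, V)) ≃L[ℝ] ((E × V) × C(I, V)) :=
    ContinuousLinearEquiv.equivOfInverse
      ((ContinuousLinearMap.fst ℝ _ _).prod
        (ContinuousLinearMap.snd ℝ _ _ - A.comp (ContinuousLinearMap.fst ℝ _ _)))
      ((ContinuousLinearMap.fst ℝ _ _).prod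
        (ContinuousLinearMap.snd ℝ _ _ + A.comp (ContinuousLinearMap.fst ℝ _ _)))
      (fun x => by simp) (fun x => by simp)
  have hΨ' : HasFDerivAt Ψ (Ψ' : ((E × V) × C(I, V)) →L[ℝ] ((E × V) × C(I, V))) x₀ := by
    have h1 : HasFDerivAt G _ x₀ :=
      ((ContinuousLinearMap.snd ℝ (E × V) C(I, V)).hasFDerivAt.sub
        (cst.comp ((ContinuousLinearMap.snd ℝ E V).comp
          (ContinuousLinearMap.fst ℝ (E × V) C(I, V)))).hasFDerivAt).sub
      (P.hasFDerivAt.comp x₀ ((hTd (pr x₀)).comp x₀ pr.hasFDerivAt))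
    have h2 : HasFDerivAt Ψ _ x₀ := hasFDerivAt_fst.prodMk h1
    refine h2.congr_fderiv ?_
    refine ContinuousLinearMap.ext fun x => Prod.ext rfl ?_
    -- The base point has parameter `h = 0`, so varying the curve does not change the velocity to
    -- first order and `Ψ'` is triangular with identity diagonal.
    have h3 : fderiv ℝ T (pr x₀) (pr x) = cst (L p₀ x.1.1) := by
      ext t
      rw [fderiv_velocityMap_apply L hL]
      simp [pr, x₀, cst]
      rfl
    simp only [ContinuousLinearMap.prod_apply, sub_apply,
      ContinuousLinearMap.comp_apply, h3]
    simp [Ψ', A, sub_sub]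
  obtain ⟨Φ, hxΦ, hΦs, hΦ, -, hΦsymm, -⟩ :=
    exists_openPartialHomeomorph_contDiffOn hs hxs hΨ.contDiffOn Ψ' hΨ'
  let ι : E × V →L[ℝ] (E × V) × C(I, V) := ContinuousLinearMap.inl ℝ _ _
  let O : Set (E × V) := ι ⁻¹' Φ.target
  have hO : IsOpen O := Φ.open_target.preimage ι.continuous
  let α : E × V → C(I, V) := fun q => (Φ.symm (ι q)).2
  have hα : ContDiffOn ℝ ∞ α O :=
    contDiff_snd.comp_contDiffOn (hΦsymm.comp ι.contDiff.contDiffOn fun q hq => hq)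
  have hsol : ∀ q ∈ O, (q, α q) ∈ s ∧ α q = cst q.2 + P (T (q.1, α q)) := by
    intro q hq
    have h1 : Φ.symm (ι q) ∈ Φ.source := Φ.map_target hq
    have h2 : Ψ (Φ.symm (ι q)) = (q, 0) := by rw [← hΦ, Φ.right_inv hq]; rfl
    have h3 : (Φ.symm (ι q)).1 = q := congrArg Prod.fst h2
    have h4 : Φ.symm (ι q) = (q, α q) := Prod.ext h3 rfl
    have h5 : G (Φ.symm (ι q)) = 0 := congrArg Prod.snd h2
    rw [h4] at h5 h1
    refine ⟨hΦs h1, ?_⟩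
    have h6 : α q - cst q.2 - P (T (q.1, α q)) = 0 := h5
    rwa [sub_sub, sub_eq_zero] at h6
  let one : I := 1
  let u : E × V → V := fun q => α q one
  refine ⟨u, O, hO, ?_, ?_, ?_, ?_, ?_, ?_⟩
  · have h1 : Φ x₀ = ι (0, p₀) := by
      rw [hΦ]
      have : T (pr x₀) = 0 := by ext t; simp [T, pr, x₀]
      refine Prod.ext rfl ?_
      change cst p₀ - cst p₀ - P (T (pr x₀)) = 0
      simp [this]
    change ι (0, p₀) ∈ Φ.target
    rw [← h1]
    exact Φ.map_source hxΦ
  · exact (ContinuousMap.evalCLM ℝ one : C(I, V) →L[ℝ] V).contDiff.comp_contDiffOn hα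
  · intro p hp
    have h1 := (hsol _ hp).2
    have : T ((0 : E), α (0, p)) = 0 := by ext t; simp [T]
    simp only [this, map_zero, add_zero] at h1
    change α (0, p) one = p
    rw [h1]; rfl
  · exact fun q hq => (hs1 _ (hsol q hq).1 one).1
  · intro q hq k
    obtain ⟨hqs, hqe⟩ := hsol q hq
    have hαd : HasFDerivAt α (fderiv ℝ α q) q :=
      ((hα.contDiffAt (hO.mem_nhds hq)).differentiableAt (by simp)).hasFDerivAt
    set β : C(I, V) := fderiv ℝ α q (k, 0) with hβ
    have hβe : β = P (fderiv ℝ T (q.1, α q) (k, β)) :=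
      fderiv_apply_inl_of_integral_eq L hL hαd.differentiableAt
        (by filter_upwards [hO.mem_nhds hq] with r hr using (hsol r hr).2) k
    obtain ⟨ρ, hρ, hρe⟩ := exists_curve_integral_eq L hL hqe (fun t => hcomm _ (hs1 _ hqs t).1) k
    -- The true derivative `β` and the explicit curve `ρ` solve the same inhomogeneous linear
    -- equation; their difference solves the homogeneous one.
    have hω : β - ρ = 0 := by
      refine eq_zero_of_integral_eq L hL (h := q.1) (α := α q) (fun t => (hs1 _ hqs t).2) hqs.2 ?_
      conv_lhs => rw [hβe, hρe]
      rw [← map_sub, ← map_sub]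
      simp only [Prod.mk_sub_mk, sub_self]
      rfl
    have h1 : fderiv ℝ u q (k, 0) = β one := by
      have h2 : HasFDerivAt u _ q :=
        (ContinuousMap.evalCLM ℝ one : C(I, V) →L[ℝ] V).hasFDerivAt.comp q hαd
      rw [h2.fderiv]
      rfl
    rw [h1, sub_eq_zero.1 hω]
    simp [hρ, u, one]
  · intro q hq
    obtain ⟨hqs, hqe⟩ := hsol q hq
    change Q (α q one) = _
    conv_lhs => rw [hqe]
    rw [ContinuousMap.add_apply, map_add]
    congr 1
    change Q (ContinuousMap.primitiveCLM V _ _) = _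
    rw [ContinuousMap.primitiveCLM_apply, ← ContinuousLinearMap.intervalIntegral_comp_comm]
    · have h1 : ∀ r : ℝ, Q (Set.IccExtend zero_le_one (T (q.1, α q)) r) = Q (L p₀ q.1) := by
        intro r
        change Q (T (q.1, α q) _) = _
        rw [velocityMap_apply]
        exact hQ _ (hs1 _ hqs _).1 _
      simp [h1, one]
    · exact ((T (q.1, α q)).continuous.Icc_extend' (h := zero_le_one)).intervalIntegrable _ _

end LocalAction

end

/-! ### Simultaneous straightening of commuting fields. -/

section

/-- A smooth function on a neighbourhood of a point agrees near that point with a globally smooth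
function. -/
lemma ContDiffOn.exists_contDiff_eqOn_ball {V F : Type*} [NormedAddCommGroup V] [NormedSpace ℝ V]
    [FiniteDimensional ℝ V] [NormedAddCommGroup F] [NormedSpace ℝ F] {f : V → F} {Ω : Set V}
    (hf : ContDiffOn ℝ ∞ f Ω) (hΩ : IsOpen Ω) {p₀ : V} (hp₀ : p₀ ∈ Ω) :
    ∃ (g : V → F) (ε : ℝ), 0 < ε ∧ ContDiff ℝ ∞ g ∧ Metric.ball p₀ ε ⊆ Ω ∧
      EqOn g f (Metric.ball p₀ ε) := by
  obtain ⟨ε, hε, hεΩ⟩ := Metric.nhds_basis_closedBall.mem_iff.1 (hΩ.mem_nhds hp₀)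
  let χ : ContDiffBump p₀ := ⟨ε / 2, ε, by positivity, by linarith⟩
  refine ⟨fun p => χ p • f p, ε / 2, by positivity, ?_, ?_, ?_⟩
  · rw [contDiff_iff_contDiffAt]
    intro p
    by_cases hp : p ∈ Ω
    · exact χ.contDiffAt.smul (hf.contDiffAt (hΩ.mem_nhds hp))
    · have h1 : p ∉ tsupport χ := by
        rw [χ.tsupport_eq]
        exact fun h => hp (hεΩ h)
      refine (contDiffAt_const (c := (0 : F))).congr_of_eventuallyEq ?_
      filter_upwards [notMem_tsupport_iff_eventuallyEq.1 h1] with q hq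
      simp [hq]
  · exact (Metric.ball_subset_closedBall.trans
      (Metric.closedBall_subset_closedBall (by linarith))).trans hεΩ
  · intro p hp
    simp [χ.one_of_mem_closedBall (Metric.ball_subset_closedBall hp)]

/-- Simultaneous straightening of a commuting, linearly independent family of vector fields. -/
theorem exists_straightening {E V : Type u} [NormedAddCommGroup E] [NormedSpace ℝ E]
    [CompleteSpace E] [NormedAddCommGroup V] [NormedSpace ℝ V] [FiniteDimensional ℝ V]
    {W : Type*} [NormedAddCommGroup W] [NormedSpace ℝ W] [CompleteSpace W]
    {L : V → E →L[ℝ] V} {Ω : Set V} (hL : ContDiffOn ℝ ∞ L Ω) (hΩ : IsOpen Ω) {p₀ : V}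
    (hp₀ : p₀ ∈ Ω)
    (hcomm : ∀ p ∈ Ω, ∀ h k, fderiv ℝ L p (L p h) k = fderiv ℝ L p (L p k) h)
    {P : V →L[ℝ] E} (hP : ∀ h, P (L p₀ h) = h)
    (Q : V →L[ℝ] W) (hQ : ∀ p ∈ Ω, ∀ h, Q (L p h) = Q (L p₀ h)) :
    ∃ Φ : OpenPartialHomeomorph V V, p₀ ∈ Φ.source ∧ Φ.source ⊆ Ω ∧ Φ p₀ = p₀ ∧
      ContDiffOn ℝ ∞ Φ Φ.source ∧ ContDiffOn ℝ ∞ Φ.symm Φ.target ∧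
      (∀ p ∈ Φ.source, ∀ h, fderiv ℝ Φ p (L p h) = L p₀ h) ∧
      ∀ p ∈ Φ.source, Q (Φ p) = Q p := by
  have : CompleteSpace V := FiniteDimensional.complete ℝ V
  -- The local action requires a family smooth on all of `V`; only its values on a ball around `p₀`
  -- matter.
  obtain ⟨L', ε, hε, hL', hεΩ, hLL'⟩ := hL.exists_contDiff_eqOn_ball hΩ hp₀
  have hpB : p₀ ∈ Metric.ball p₀ ε := Metric.mem_ball_self hε
  have hfd : ∀ p ∈ Metric.ball p₀ ε, fderiv ℝ L' p = fderiv ℝ L p := fun p hp =>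
    (hLL'.eventuallyEq_of_mem (Metric.isOpen_ball.mem_nhds hp)).fderiv_eq
  obtain ⟨u, O, hO, hpO, hu, hu0, huB, hud, huQ⟩ := exists_local_action L' hL'
    Metric.isOpen_ball hpB
    (fun p hp h k => by rw [hfd p hp, hLL' hp]; exact hcomm p (hεΩ hp) h k) Q
    (fun p hp h => by rw [hLL' hp, hLL' hpB]; exact hQ p (hεΩ hp) h)
  have hL0 : L' p₀ = L p₀ := hLL' hpB
  -- The displacement from `p₀` is split into a parameter in `E` and a transverse part in `ker P`.
  -- `Ξ` moves the transverse point by the action with that parameter, and its derivative at `p₀` is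
  -- the identity.
  let B : V →L[ℝ] E × V := P.prod (ContinuousLinearMap.id ℝ V - (L p₀).comp P)
  let b : V → E × V := fun w => B (w - p₀) + (0, p₀)
  have hb : ∀ w, HasFDerivAt b B w := fun w =>
    (B.hasFDerivAt.comp w ((hasFDerivAt_id w).sub_const p₀)).add_const _
  have hbc : ContDiff ℝ ∞ b := (B.contDiff.comp (contDiff_id.sub contDiff_const)).add contDiff_const
  have hbp : b p₀ = (0, p₀) := by simp [b]
  let Ξ : V → V := fun w => u (b w)
  have hO' : IsOpen (b ⁻¹' O) := hO.preimage hbc.continuous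
  have hΞ : ContDiffOn ℝ ∞ Ξ (b ⁻¹' O) := hu.comp hbc.contDiffOn fun w hw => hw
  have hud' : ∀ q ∈ O, HasFDerivAt u (fderiv ℝ u q) q := fun q hq =>
    ((hu.contDiffAt (hO.mem_nhds hq)).differentiableAt (by simp)).hasFDerivAt
  have hΞd : ∀ w ∈ b ⁻¹' O, HasFDerivAt Ξ ((fderiv ℝ u (b w)).comp B) w := fun w hw =>
    (hud' _ hw).comp w (hb w)
  have hΞ0 : HasFDerivAt Ξ ((ContinuousLinearEquiv.refl ℝ V : V ≃L[ℝ] V) : V →L[ℝ] V) p₀ := by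
    have hp : p₀ ∈ b ⁻¹' O := by simpa [hbp] using hpO
    refine (hΞd p₀ hp).congr_fderiv ?_
    have h1 : ∀ v, fderiv ℝ u (0, p₀) (0, v) = v := by
      intro v
      have h2 : HasFDerivAt (fun p => u (0, p))
          ((fderiv ℝ u (0, p₀)).comp (ContinuousLinearMap.inr ℝ E V)) p₀ :=
        HasFDerivAt.comp (g := u) (f := fun p => (0, p)) p₀ (hud' _ hpO)
          (ContinuousLinearMap.inr ℝ E V).hasFDerivAt
      have h3 : (fun p => u (0, p)) =ᶠ[𝓝 p₀] id := by
        have : Tendsto (fun p : V => ((0 : E), p)) (𝓝 p₀) (𝓝 (0, p₀)) :=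
          (Continuous.prodMk_right (0 : E)).tendsto p₀
        filter_upwards [this (hO.mem_nhds hpO)] with p hp using hu0 p hp
      have h4 := congrArg (fun A => A v) (h2.unique ((hasFDerivAt_id p₀).congr_of_eventuallyEq h3))
      simpa using h4
    ext v
    have h5 : B v = (P v, 0) + (0, v - L p₀ (P v)) := by simp [B]
    simp only [ContinuousLinearMap.comp_apply, hbp]
    rw [h5, map_add, h1, hud _ hpO, hu0 _ hpO, hL0]
    simp
  obtain ⟨Ψ, hpΨ, hΨO, hΨ, hΨc, hΨs, hΨd⟩ := exists_openPartialHomeomorph_contDiffOn hO'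
    (by simpa [hbp] using hpO : p₀ ∈ b ⁻¹' O) hΞ _ hΞ0
  have hΨp : Ψ p₀ = p₀ := by rw [hΨ]; simp only [Ξ, hbp]; exact hu0 _ hpO
  have hsrc : ∀ p ∈ Ψ.target, Ψ.symm p ∈ b ⁻¹' O ∧ u (b (Ψ.symm p)) = p := fun p hp =>
    ⟨hΨO (Ψ.map_target hp), (hΨ _).symm.trans (Ψ.right_inv hp)⟩
  refine ⟨Ψ.symm, ?_, ?_, ?_, hΨs, hΨc, ?_, ?_⟩
  · have := Ψ.map_source hpΨ
    rwa [hΨp] at this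
  · intro p hp
    obtain ⟨h1, h2⟩ := hsrc p hp
    exact hεΩ (h2 ▸ huB _ h1)
  · conv_lhs => rw [← hΨp]
    exact Ψ.left_inv hpΨ
  · intro p hp h
    obtain ⟨h1, h2⟩ := hsrc p hp
    have hpB : p ∈ Metric.ball p₀ ε := h2 ▸ huB _ h1
    -- `Ξ` carries the constant field `L p₀ h` to `L · h`, because `B` sends `L p₀ h` to a pure
    -- parameter. The inverse of `Ξ` is therefore the straightening.
    have h3 : fderiv ℝ u (b (Ψ.symm p)) (B (L p₀ h)) = L p h := by
      have h4 : B (L p₀ h) = (h, 0) := by simp [B, hP]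
      rw [h4, hud _ h1, h2, hLL' hpB]
    have h5 : HasFDerivAt Ψ.symm (fderiv ℝ Ψ.symm p) p :=
      ((hΨs.contDiffAt (Ψ.open_target.mem_nhds hp)).differentiableAt (by simp)).hasFDerivAt
    have h6 : HasFDerivAt Ψ ((fderiv ℝ u (b (Ψ.symm p))).comp B) (Ψ.symm p) :=
      (hΞd _ h1).congr_of_eventuallyEq (Eventually.of_forall hΨ)
    have h7 : HasFDerivAt (Ψ.symm ∘ Ψ) _ (Ψ.symm p) :=
      HasFDerivAt.comp (Ψ.symm p) (by rwa [Ψ.right_inv hp]) h6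
    have h8 : Ψ.symm ∘ Ψ =ᶠ[𝓝 (Ψ.symm p)] id := by
      filter_upwards [Ψ.open_source.mem_nhds (Ψ.map_target hp)] with w hw using Ψ.left_inv hw
    have h9 := congrArg (fun A => A (L p₀ h))
      (h7.unique ((hasFDerivAt_id _).congr_of_eventuallyEq h8))
    simpa [h3] using h9
  · intro p hp
    obtain ⟨h1, h2⟩ := hsrc p hp
    have h3 := huQ _ h1
    rw [h2] at h3
    rw [h3, hL0, ← map_add]
    simp only [b, B, ContinuousLinearMap.prod_apply, sub_apply, map_sub, map_add,
      ContinuousLinearMap.comp_apply, ContinuousLinearMap.id_apply, Prod.fst_add, Prod.snd_add]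
    simp
    abel

end

/-! ### Straightening images, vertical frames and kernels. -/

section

lemma LinearMap.exists_clm_rightInverse {V E : Type*} [NormedAddCommGroup V] [NormedSpace ℝ V]
    [NormedAddCommGroup E] [NormedSpace ℝ E] [FiniteDimensional ℝ E] {A : V →L[ℝ] E}
    (hA : Function.Surjective A) : ∃ S : E →L[ℝ] V, ∀ h, A (S h) = h := by
  obtain ⟨S, hS⟩ := A.toLinearMap.exists_rightInverse_of_surjective (LinearMap.range_eq_top.2 hA)
  exact ⟨LinearMap.toContinuousLinearMap S, fun h => LinearMap.congr_fun hS h⟩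

lemma Submodule.exists_clm_projection {V : Type*} [NormedAddCommGroup V] [NormedSpace ℝ V]
    [FiniteDimensional ℝ V] (E : Submodule ℝ V) : ∃ P : V →L[ℝ] E, ∀ h : E, P h = h := by
  obtain ⟨S, hS⟩ := E.subtype.exists_leftInverse_of_injective (by simp)
  exact ⟨LinearMap.toContinuousLinearMap S, fun h => LinearMap.congr_fun hS h⟩

/-- A smooth family of linear maps which is invertible at a point is invertible nearby, with
smooth inverse. -/
lemma ContDiffOn.exists_inverse {V E F : Type*} [NormedAddCommGroup V] [NormedSpace ℝ V]
    [NormedAddCommGroup E] [NormedSpace ℝ E] [CompleteSpace E]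
    [NormedAddCommGroup F] [NormedSpace ℝ F] {A : V → E →L[ℝ] F} {Ω : Set V}
    (hA : ContDiffOn ℝ ∞ A Ω) (hΩ : IsOpen Ω) {p₀ : V} (hp₀ : p₀ ∈ Ω)
    (h₀ : (A p₀).IsInvertible) :
    ∃ Ω' ⊆ Ω, IsOpen Ω' ∧ p₀ ∈ Ω' ∧ ContDiffOn ℝ ∞ (fun p => (A p).inverse) Ω' ∧
      ∀ p ∈ Ω', (∀ h, A p ((A p).inverse h) = h) ∧ ∀ h, (A p).inverse (A p h) = h := by
  refine ⟨Ω ∩ A ⁻¹' range ((↑) : (E ≃L[ℝ] F) → E →L[ℝ] F), inter_subset_left,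
    hA.continuousOn.isOpen_inter_preimage hΩ ContinuousLinearEquiv.isOpen, ⟨hp₀, h₀⟩, ?_, ?_⟩
  · rintro p ⟨hp, e, he⟩
    refine ContDiffAt.contDiffWithinAt ?_
    have h1 : ContDiffAt ℝ ∞ ContinuousLinearMap.inverse (A p) := he ▸ contDiffAt_map_inverse e
    exact h1.comp p (hA.contDiffAt (hΩ.mem_nhds hp))
  · rintro p ⟨-, e, he⟩
    simp [← he]

set_option maxHeartbeats 400000 in
/-- The range of a field of endomorphisms of constant rank with vanishing Nijenhuis tensor can be
made constant by a change of coordinates. -/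
theorem exists_straightening_range {V : Type u} [NormedAddCommGroup V] [NormedSpace ℝ V]
    [FiniteDimensional ℝ V] {T : V → V →L[ℝ] V} {Ω : Set V} (hT : ContDiffOn ℝ ∞ T Ω)
    (hΩ : IsOpen Ω) {p₀ : V} (hp₀ : p₀ ∈ Ω)
    (hrank : ∀ p ∈ Ω, Module.finrank ℝ (T p).range = Module.finrank ℝ (T p₀).range)
    (hN : ∀ p ∈ Ω, ∀ a b, T p (fderiv ℝ T p a b - fderiv ℝ T p b a)
      = fderiv ℝ T p (T p a) b - fderiv ℝ T p (T p b) a) :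
    ∃ Φ : OpenPartialHomeomorph V V, p₀ ∈ Φ.source ∧ Φ.source ⊆ Ω ∧ Φ p₀ = p₀ ∧
      ContDiffOn ℝ ∞ Φ Φ.source ∧ ContDiffOn ℝ ∞ Φ.symm Φ.target ∧
      ∀ p ∈ Φ.source, ∀ v, fderiv ℝ Φ p (T p v) ∈ (T p₀).range := by
  set E := (T p₀).range with hE
  obtain ⟨J₀, hJ₀⟩ := (T p₀).toLinearMap.rangeRestrict.exists_rightInverse_of_surjective
    (LinearMap.range_rangeRestrict _)
  let J : E →L[ℝ] V := LinearMap.toContinuousLinearMap J₀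
  have hJ : ∀ h : E, T p₀ (J h) = h := fun h => congrArg Subtype.val (LinearMap.congr_fun hJ₀ h)
  obtain ⟨P, hP⟩ := E.exists_clm_projection
  -- `K` is the identity at `p₀`, hence invertible nearby; composing with its inverse normalizes the
  -- frame `L` of the range of `T` so that `P (L p h) = h`.
  let K : V → E →L[ℝ] E := fun p => P.comp ((T p).comp J)
  have hK : ContDiffOn ℝ ∞ K Ω := contDiffOn_const.clm_comp (hT.clm_comp contDiffOn_const)
  have hK0 : K p₀ = ContinuousLinearMap.id ℝ E := by
    ext h
    simp [K, hJ, hP]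
  obtain ⟨Ω', hΩ'Ω, hΩ', hpΩ', hKi, hKinv⟩ := hK.exists_inverse hΩ hp₀
    (by rw [hK0]; exact ⟨ContinuousLinearEquiv.refl ℝ E, rfl⟩)
  let M : V → E →L[ℝ] V := fun p => J.comp (K p).inverse
  have hM : ContDiffOn ℝ ∞ M Ω' := contDiffOn_const.clm_comp hKi
  let L : V → E →L[ℝ] V := fun p => (T p).comp (M p)
  have hL : ContDiffOn ℝ ∞ L Ω' := (hT.mono hΩ'Ω).clm_comp hM
  have hPL : ∀ p ∈ Ω', ∀ h, P (L p h) = h := fun p hp h => (hKinv p hp).1 h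
  have hLinj : ∀ p ∈ Ω', Function.Injective (L p) := fun p hp =>
    Function.LeftInverse.injective (hPL p hp)
  have hrange : ∀ p ∈ Ω', (L p).range = (T p).range := by
    intro p hp
    refine Submodule.eq_of_le_of_finrank_eq ?_ ?_
    · rintro _ ⟨h, rfl⟩
      exact ⟨M p h, rfl⟩
    · rw [hrank p (hΩ'Ω hp)]
      exact LinearMap.finrank_range_of_inj (hLinj p hp)
  have hLd : ∀ p ∈ Ω', ∀ v k, fderiv ℝ L p v k = fderiv ℝ T p v (M p k) + T p (fderiv ℝ M p v k) := by
    intro p hp v k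
    have h1 := ((hT.contDiffAt (hΩ.mem_nhds (hΩ'Ω hp))).differentiableAt (by simp)).hasFDerivAt
    have h2 := ((hM.contDiffAt (hΩ'.mem_nhds hp)).differentiableAt (by simp)).hasFDerivAt
    have h3 : HasFDerivAt L _ p := h1.clm_comp h2
    rw [h3.fderiv]
    exact add_comm (T p (fderiv ℝ M p v k)) (fderiv ℝ T p v (M p k))
  have hPLd : ∀ p ∈ Ω', ∀ v k, P (fderiv ℝ L p v k) = 0 := by
    intro p hp v k
    have h1 := ((hL.contDiffAt (hΩ'.mem_nhds hp)).differentiableAt (by simp)).hasFDerivAt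
    have h2 : HasFDerivAt (fun p => P (L p k)) _ p :=
      P.hasFDerivAt.comp p (h1.clm_apply (hasFDerivAt_const k p))
    have h3 : (fun p => P (L p k)) =ᶠ[𝓝 p] fun _ => k := by
      filter_upwards [hΩ'.mem_nhds hp] with q hq using hPL q hq k
    have h4 := congrArg (fun A => A v)
      (h2.unique ((hasFDerivAt_const k p).congr_of_eventuallyEq h3))
    simpa using h4
  -- The bracket of two normalized fields lies in the range of `L p` by `hN`, and in `ker P` because
  -- `P ∘ L` is constant. As `P` is injective on that range, the bracket vanishes.
  have hcomm : ∀ p ∈ Ω', ∀ h k, fderiv ℝ L p (L p h) k = fderiv ℝ L p (L p k) h := by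
    intro p hp h k
    rw [← sub_eq_zero]
    have h1 : fderiv ℝ L p (L p h) k - fderiv ℝ L p (L p k) h ∈ (L p).range := by
      rw [hrange p hp, hLd p hp, hLd p hp]
      refine ⟨(fderiv ℝ T p (M p h) (M p k) - fderiv ℝ T p (M p k) (M p h)) +
        fderiv ℝ M p (L p h) k - fderiv ℝ M p (L p k) h, ?_⟩
      have h2 := hN p (hΩ'Ω hp) (M p h) (M p k)
      change T p _ = _
      rw [map_sub, map_add, h2]
      simp only [L, ContinuousLinearMap.comp_apply]
      abel
    obtain ⟨l, hl⟩ := h1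
    have h2 : P (L p l) = 0 := by
      have : L p l = _ := hl
      rw [this, map_sub, hPLd p hp, hPLd p hp, sub_zero]
    rw [hPL p hp] at h2
    rw [← hl, h2, map_zero]
  have hL0 : ∀ h : E, L p₀ h ∈ E := fun h => ⟨M p₀ h, rfl⟩
  obtain ⟨Φ, h1, h2, h3, h4, h5, h6, -⟩ := exists_straightening hL hΩ' hpΩ' hcomm
    (hPL p₀ hpΩ') (0 : V →L[ℝ] V) (fun p hp h => rfl)
  refine ⟨Φ, h1, h2.trans hΩ'Ω, h3, h4, h5, fun p hp v => ?_⟩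
  have h7 : T p v ∈ (L p).range := by
    rw [hrange p (h2 hp)]
    exact ⟨v, rfl⟩
  obtain ⟨k, hk⟩ := h7
  have hk' : L p k = T p v := hk
  rw [← hk', h6 p hp]
  exact hL0 k

/-- Coordinates in which the commuting vector fields `(0, H p (S h))` become constant. -/
theorem exists_straightening_vertical {F E : Type u} [NormedAddCommGroup F] [NormedSpace ℝ F]
    [FiniteDimensional ℝ F] [NormedAddCommGroup E] [NormedSpace ℝ E] [FiniteDimensional ℝ E]
    {H : F × E → F →L[ℝ] E} {Ω : Set (F × E)} (hH : ContDiffOn ℝ ∞ H Ω)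
    (hΩ : IsOpen Ω) {p₀ : F × E} (hp₀ : p₀ ∈ Ω)
    (hN : ∀ p ∈ Ω, ∀ f g, fderiv ℝ H p (0, H p f) g = fderiv ℝ H p (0, H p g) f)
    {S : E →L[ℝ] F} (hS : ∀ h, H p₀ (S h) = h) :
    ∃ Φ : OpenPartialHomeomorph (F × E) (F × E), p₀ ∈ Φ.source ∧ Φ.source ⊆ Ω ∧ Φ p₀ = p₀ ∧
      ContDiffOn ℝ ∞ Φ Φ.source ∧ ContDiffOn ℝ ∞ Φ.symm Φ.target ∧
      (∀ p ∈ Φ.source, ∀ h, fderiv ℝ Φ p (0, H p (S h)) = (0, h)) ∧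
      ∀ p ∈ Φ.source, (Φ p).1 = p.1 := by
  have : CompleteSpace E := FiniteDimensional.complete ℝ E
  have : CompleteSpace F := FiniteDimensional.complete ℝ F
  let L : F × E → E →L[ℝ] F × E := fun p => (ContinuousLinearMap.inr ℝ F E).comp ((H p).comp S)
  have hL : ContDiffOn ℝ ∞ L Ω := contDiffOn_const.clm_comp (hH.clm_comp contDiffOn_const)
  have hLd : ∀ p ∈ Ω, ∀ v k, fderiv ℝ L p v k = (0, fderiv ℝ H p v (S k)) := by
    intro p hp v k
    have h1 := ((hH.contDiffAt (hΩ.mem_nhds hp)).differentiableAt (by simp)).hasFDerivAt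
    have h2 : HasFDerivAt L _ p :=
      (hasFDerivAt_const (ContinuousLinearMap.inr ℝ F E) p).clm_comp
        (h1.clm_comp (hasFDerivAt_const S p))
    rw [h2.fderiv]
    simp
  obtain ⟨Φ, h1, h2, h3, h4, h5, h6, h7⟩ := exists_straightening hL hΩ hp₀
    (fun p hp h k => by
      rw [hLd p hp, hLd p hp]
      exact Prod.ext rfl (hN p hp (S h) (S k)))
    (P := ContinuousLinearMap.snd ℝ F E) hS
    -- The fields are vertical, so the first projection is a conserved linear quantity and the
    -- straightening preserves it.
    (ContinuousLinearMap.fst ℝ F E) (fun p hp h => rfl)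
  refine ⟨Φ, h1, h2, h3, h4, h5, fun p hp h => ?_, h7⟩
  have := h6 p hp h
  simpa [L, hS] using this

/-- The normalized vertical structure is constant along the fibres. -/
lemma eq_of_fst_eq_of_rightInverse {F E : Type*} [NormedAddCommGroup F] [NormedSpace ℝ F]
    [NormedAddCommGroup E] [NormedSpace ℝ E]
    {H : F × E → F →L[ℝ] E} {B : Set (F × E)} (hB : IsOpen B) (hBc : Convex ℝ B)
    (hH : ContDiffOn ℝ ∞ H B)
    (hN : ∀ p ∈ B, ∀ f g, fderiv ℝ H p (0, H p f) g = fderiv ℝ H p (0, H p g) f)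
    {S : E →L[ℝ] F} (hS : ∀ p ∈ B, ∀ h, H p (S h) = h) {y : F} {z z' : E} (hz : (y, z) ∈ B)
    (hz' : (y, z') ∈ B) : H (y, z) = H (y, z') := by
  have hd : ∀ p ∈ B, HasFDerivAt H (fderiv ℝ H p) p := fun p hp =>
    ((hH.contDiffAt (hB.mem_nhds hp)).differentiableAt (by simp)).hasFDerivAt
  -- Decompose `g` as `S (H p g)` plus an element of `ker (H p)`. On the first summand `H ∘ S` is
  -- constant; on the second, `hN` with `f = S c` replaces the direction `(0, c)` by the zero
  -- vector.
  have key : ∀ p ∈ B, ∀ c, fderiv ℝ H p (0, c) = 0 := by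
    intro p hp c
    have h1 : ∀ v e, fderiv ℝ H p v (S e) = 0 := by
      intro v e
      have h2 : HasFDerivAt (fun p => H p (S e)) _ p :=
        (hd p hp).clm_apply (hasFDerivAt_const (S e) p)
      have h3 : (fun p => H p (S e)) =ᶠ[𝓝 p] fun _ => e := by
        filter_upwards [hB.mem_nhds hp] with q hq using hS q hq e
      have h4 := congrArg (fun A => A v)
        (h2.unique ((hasFDerivAt_const e p).congr_of_eventuallyEq h3))
      simpa using h4
    ext g
    have h2 : H p (g - S (H p g)) = 0 := by rw [map_sub, hS p hp, sub_self]
    have h3 := hN p hp (S c) (g - S (H p g))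
    rw [h2, hS p hp] at h3
    have h4 : ((0 : F), (0 : E)) = 0 := rfl
    rw [h4, map_zero, map_sub, h1, sub_zero] at h3
    simpa using h3
  let line : Set E := (fun z => (y, z)) ⁻¹' B
  have hline : Convex ℝ line := by
    intro a ha b hb s t hs ht hst
    have h1 := hBc ha hb hs ht hst
    have h2 : s • (y, a) + t • (y, b) = (y, s • a + t • b) := by
      refine Prod.ext ?_ rfl
      simp [← add_smul, hst]
    rwa [h2] at h1
  have hlo : IsOpen line := hB.preimage (Continuous.prodMk_right y)
  refine hline.is_const_of_fderivWithin_eq_zero (𝕜 := ℝ) (f := fun z => H (y, z)) ?_ ?_ hz hz'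
  · intro z hz
    exact ((hd _ hz).comp z ((hasFDerivAt_const y z).prodMk
      (hasFDerivAt_id z))).differentiableAt.differentiableWithinAt
  · intro z hz
    have h1 : HasFDerivAt (fun z => H (y, z)) _ z := (hd _ hz).comp z ((hasFDerivAt_const y z).prodMk
      (hasFDerivAt_id z))
    rw [fderivWithin_of_isOpen hlo hz, h1.fderiv]
    ext c
    simp only [ContinuousLinearMap.comp_apply, ContinuousLinearMap.prod_apply]
    have := key _ hz c
    simp [this]

/-- Frobenius' theorem for the kernel of a smooth family of surjective linear maps. -/
theorem exists_straightening_ker {F E : Type u} [NormedAddCommGroup F] [NormedSpace ℝ F]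
    [FiniteDimensional ℝ F] [NormedAddCommGroup E] [NormedSpace ℝ E] [FiniteDimensional ℝ E]
    {G : F → F →L[ℝ] E} {Ω : Set F} (hG : ContDiffOn ℝ ∞ G Ω) (hΩ : IsOpen Ω) {u₀ : F}
    (hu₀ : u₀ ∈ Ω) (hsurj : Function.Surjective (G u₀))
    (hinv : ∀ u ∈ Ω, ∀ η₁ η₂ : F → F, DifferentiableAt ℝ η₁ u → DifferentiableAt ℝ η₂ u →
      (∀ᶠ y in 𝓝 u, G y (η₁ y) = 0) → (∀ᶠ y in 𝓝 u, G y (η₂ y) = 0) →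
      G u (fderiv ℝ η₂ u (η₁ u) - fderiv ℝ η₁ u (η₂ u)) = 0) :
    ∃ Φ : OpenPartialHomeomorph F F, u₀ ∈ Φ.source ∧ Φ.source ⊆ Ω ∧
      ContDiffOn ℝ ∞ Φ Φ.source ∧ ContDiffOn ℝ ∞ Φ.symm Φ.target ∧
      ∃ D : Submodule ℝ F, ∀ u ∈ Φ.source, ∀ η, G u η = 0 ↔ fderiv ℝ Φ u η ∈ D := by
  have : CompleteSpace E := FiniteDimensional.complete ℝ E
  have : CompleteSpace F := FiniteDimensional.complete ℝ F
  obtain ⟨S, hS⟩ := LinearMap.exists_clm_rightInverse hsurj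
  let A : F → E →L[ℝ] E := fun u => (G u).comp S
  have hA : ContDiffOn ℝ ∞ A Ω := hG.clm_comp contDiffOn_const
  have hA0 : A u₀ = ContinuousLinearMap.id ℝ E := by ext h; simp [A, hS]
  obtain ⟨Ω', hΩ'Ω, hΩ', huΩ', hAi, hAinv⟩ := hA.exists_inverse hΩ hu₀
    (by rw [hA0]; exact ⟨ContinuousLinearEquiv.refl ℝ E, rfl⟩)
  -- `R u` is the projection onto `ker (G u)` along the image of `S`, a complement independent of
  -- `u`. Hence `R u' ∘ R u = R u'`, and `ker (G u₀)` parametrizes all the nearby kernels.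
  let R : F → F →L[ℝ] F := fun u => ContinuousLinearMap.id ℝ F - S.comp ((A u).inverse.comp (G u))
  have hR : ContDiffOn ℝ ∞ R Ω' := contDiffOn_const.sub
    (contDiffOn_const.clm_comp (hAi.clm_comp (hG.mono hΩ'Ω)))
  have hGR : ∀ u ∈ Ω', ∀ η, G u (R u η) = 0 := by
    intro u hu η
    have h1 : G u (S ((A u).inverse (G u η))) = G u η := (hAinv u hu).1 (G u η)
    simp [R, h1]
  have hRk : ∀ u, ∀ η, G u η = 0 → R u η = η := by
    intro u η h
    simp [R, h]
  have hRS : ∀ u ∈ Ω', ∀ e, R u (S e) = 0 := by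
    intro u hu e
    have h1 : (A u).inverse (G u (S e)) = e := (hAinv u hu).2 e
    simp [R, h1]
  have hRd : ∀ u η, ∃ e, η - R u η = S e := fun u η => ⟨(A u).inverse (G u η), by simp [R]⟩
  have hRR : ∀ u ∈ Ω', ∀ u' ∈ Ω', ∀ η, R u' (R u η) = R u' η := by
    intro u hu u' hu' η
    obtain ⟨e, he⟩ := hRd u η
    have h1 := congrArg (R u') he
    rw [hRS u' hu', map_sub, sub_eq_zero] at h1
    exact h1.symm
  let D : Submodule ℝ F := (G u₀).ker
  let P : F →L[ℝ] D := (R u₀).codRestrict D (fun η => hGR u₀ huΩ' η)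
  let L : F → D →L[ℝ] F := fun u => (R u).comp D.subtypeL
  have hL : ContDiffOn ℝ ∞ L Ω' := hR.clm_comp contDiffOn_const
  have hPL : ∀ u ∈ Ω', ∀ h, P (L u h) = h := by
    intro u hu h
    refine Subtype.ext ?_
    change R u₀ (R u h) = h
    rw [hRR u hu u₀ huΩ', hRk u₀ h h.2]
  have hLG : ∀ u ∈ Ω', ∀ η, G u η = 0 → ∃ h, L u h = η := by
    intro u hu η hη
    refine ⟨P η, ?_⟩
    change R u (R u₀ η) = η
    rw [hRR u₀ huΩ' u hu, hRk u η hη]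
  have hLd : ∀ u ∈ Ω', HasFDerivAt L (fderiv ℝ L u) u := fun u hu =>
    ((hL.contDiffAt (hΩ'.mem_nhds hu)).differentiableAt (by simp)).hasFDerivAt
  have hLh : ∀ u ∈ Ω', ∀ h, HasFDerivAt (fun u => L u h) ((fderiv ℝ L u).flip h) u := by
    intro u hu h
    refine ((hLd u hu).clm_apply (hasFDerivAt_const h u)).congr_fderiv ?_
    ext; simp
  have hPLd : ∀ u ∈ Ω', ∀ v k, P (fderiv ℝ L u v k) = 0 := by
    intro u hu v k
    have h2 : HasFDerivAt (fun p => P (L p k)) _ u := P.hasFDerivAt.comp u (hLh u hu k)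
    have h3 : (fun p => P (L p k)) =ᶠ[𝓝 u] fun _ => k := by
      filter_upwards [hΩ'.mem_nhds hu] with q hq using hPL q hq k
    have h4 := congrArg (fun A => A v)
      (h2.unique ((hasFDerivAt_const k u).congr_of_eventuallyEq h3))
    simpa using h4
  -- Involutivity puts the bracket of two frame fields in the range of `L u`; the normalization `P ∘
  -- L = id` puts it in `ker P`. It is therefore zero.
  have hcomm : ∀ u ∈ Ω', ∀ h k, fderiv ℝ L u (L u h) k = fderiv ℝ L u (L u k) h := by
    intro u hu h k
    rw [← sub_eq_zero]
    have h1 := hinv u (hΩ'Ω hu) (fun u => L u h) (fun u => L u k) (hLh u hu h).differentiableAt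
      (hLh u hu k).differentiableAt
      (by filter_upwards [hΩ'.mem_nhds hu] with q hq using hGR q hq h)
      (by filter_upwards [hΩ'.mem_nhds hu] with q hq using hGR q hq k)
    rw [(hLh u hu h).fderiv, (hLh u hu k).fderiv] at h1
    simp only [ContinuousLinearMap.flip_apply] at h1
    obtain ⟨l, hl⟩ := hLG u hu _ h1
    have h2 := hPL u hu l
    rw [hl, map_sub, hPLd u hu, hPLd u hu, sub_zero] at h2
    rw [← hl, ← h2, map_zero]
  obtain ⟨Φ, h1, h2, h3, h4, h5, h6, -⟩ := exists_straightening hL hΩ' huΩ' hcomm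
    (hPL u₀ huΩ') (0 : F →L[ℝ] F) (fun p hp h => rfl)
  refine ⟨Φ, h1, h2.trans hΩ'Ω, h4, h5, D, fun u hu η => ⟨fun hη => ?_, fun hη => ?_⟩⟩
  · obtain ⟨h, rfl⟩ := hLG u (h2 hu) η hη
    rw [h6 u hu]
    exact hGR u₀ huΩ' _
  · have h7 : L u₀ ⟨_, hη⟩ = fderiv ℝ Φ u η := hRk u₀ _ hη
    rw [← h6 u hu] at h7
    have h8 : Function.Injective (fderiv ℝ Φ u) := by
      have h9 : HasFDerivAt Φ.symm (fderiv ℝ Φ.symm (Φ u)) (Φ u) :=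
        ((h5.contDiffAt (Φ.open_target.mem_nhds (Φ.map_source hu))).differentiableAt
          (by simp)).hasFDerivAt
      have h10 : HasFDerivAt Φ (fderiv ℝ Φ u) u :=
        ((h4.contDiffAt (Φ.open_source.mem_nhds hu)).differentiableAt (by simp)).hasFDerivAt
      have h11 : Φ.symm ∘ Φ =ᶠ[𝓝 u] id := by
        filter_upwards [Φ.open_source.mem_nhds hu] with w hw using Φ.left_inv hw
      have h12 := (h9.comp u h10).unique ((hasFDerivAt_id _).congr_of_eventuallyEq h11)
      exact Function.LeftInverse.injective (g := fderiv ℝ Φ.symm (Φ u)) fun v =>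
        congrArg (fun A => A v) h12
    rw [← h8 h7]
    exact hGR u (h2 hu) _

end

/-! ### Manifold coordinates with values in a normed space, such as a product. -/

section

section SmoothCoordinates

variable {n : ℕ} {M : Type u} [TopologicalSpace M] [ChartedSpace (EuclideanSpace ℝ (Fin n)) M]
  {V : Type v} [NormedAddCommGroup V] [NormedSpace ℝ V]

/-- A system of local coordinates with values in a normed space, smooth together with its
inverse. -/
structure IsSmoothCoord (χ : OpenPartialHomeomorph M V) : Prop where
  smooth : ContMDiffOn (𝓡 n) 𝓘(ℝ, V) ∞ χ χ.source
  smooth_symm : ContMDiffOn 𝓘(ℝ, V) (𝓡 n) ∞ χ.symm χ.target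

/-- The differential of a system of coordinates, with values in the model space. -/
def coordD (χ : OpenPartialHomeomorph M V) (z : M) : TangentSpace (𝓡 n) z →L[ℝ] V :=
  mfderiv (𝓡 n) 𝓘(ℝ, V) χ z

/-- The vector field on the domain of the coordinates corresponding to a vector field on the
model space. -/
def coordField (χ : OpenPartialHomeomorph M V) (X : V → V) (z : M) : TangentSpace (𝓡 n) z :=
  (coordD χ z).inverse (X (χ z))

namespace IsSmoothCoord

variable {χ : OpenPartialHomeomorph M V}

lemma mdifferentiable (hχ : IsSmoothCoord (n := n) χ) : χ.MDifferentiable (𝓡 n) 𝓘(ℝ, V) :=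
  ⟨hχ.smooth.mdifferentiableOn (by simp), hχ.smooth_symm.mdifferentiableOn (by simp)⟩

lemma contMDiffAt (hχ : IsSmoothCoord (n := n) χ) {z : M} (hz : z ∈ χ.source) :
    ContMDiffAt (𝓡 n) 𝓘(ℝ, V) ∞ χ z :=
  hχ.smooth.contMDiffAt (χ.open_source.mem_nhds hz)

lemma contMDiffAt_symm (hχ : IsSmoothCoord (n := n) χ) {p : V} (hp : p ∈ χ.target) :
    ContMDiffAt 𝓘(ℝ, V) (𝓡 n) ∞ χ.symm p :=
  hχ.smooth_symm.contMDiffAt (χ.open_target.mem_nhds hp)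

lemma hasMFDerivAt (hχ : IsSmoothCoord (n := n) χ) {z : M} (hz : z ∈ χ.source) :
    HasMFDerivAt (𝓡 n) 𝓘(ℝ, V) χ z (coordD χ z) :=
  ((hχ.contMDiffAt hz).mdifferentiableAt (by simp)).hasMFDerivAt

lemma isInvertible (hχ : IsSmoothCoord (n := n) χ) {z : M} (hz : z ∈ χ.source) :
    (coordD (n := n) χ z).IsInvertible :=
  ⟨hχ.mdifferentiable.mfderiv hz, rfl⟩

lemma coordD_inverse (hχ : IsSmoothCoord (n := n) χ) {z : M} (hz : z ∈ χ.source) (v : V) :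
    coordD (n := n) χ z ((coordD χ z).inverse v) = v := by
  obtain ⟨e, he⟩ := hχ.isInvertible hz
  simp [← he]

lemma inverse_coordD (hχ : IsSmoothCoord (n := n) χ) {z : M} (hz : z ∈ χ.source)
    (ξ : TangentSpace (𝓡 n) z) : (coordD χ z).inverse (coordD χ z ξ) = ξ := by
  obtain ⟨e, he⟩ := hχ.isInvertible hz
  simp [← he]

lemma coordD_injective (hχ : IsSmoothCoord (n := n) χ) {z : M} (hz : z ∈ χ.source) :
    Function.Injective (coordD (n := n) χ z) :=
  Function.LeftInverse.injective (hχ.inverse_coordD hz)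

lemma coordD_coordField (hχ : IsSmoothCoord (n := n) χ) {z : M} (hz : z ∈ χ.source) (X : V → V) :
    coordD (n := n) χ z (coordField χ X z) = X (χ z) :=
  hχ.coordD_inverse hz _

lemma trans (hχ : IsSmoothCoord (n := n) χ) {V' : Type*} [NormedAddCommGroup V']
    [NormedSpace ℝ V'] {Φ : OpenPartialHomeomorph V V'} (hΦ : ContDiffOn ℝ ∞ Φ Φ.source)
    (hΦs : ContDiffOn ℝ ∞ Φ.symm Φ.target) : IsSmoothCoord (n := n) (χ.trans Φ) where
  smooth := hΦ.contMDiffOn.comp (hχ.smooth.mono inter_subset_left) fun _ hz => hz.2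
  smooth_symm := hχ.smooth_symm.comp (hΦs.contMDiffOn.mono inter_subset_left) fun _ hz => hz.2

lemma coordD_trans (hχ : IsSmoothCoord (n := n) χ) {V' : Type*} [NormedAddCommGroup V']
    [NormedSpace ℝ V'] {Φ : OpenPartialHomeomorph V V'} (hΦ : ContDiffOn ℝ ∞ Φ Φ.source)
    {z : M} (hz : z ∈ (χ.trans Φ).source) (ξ : TangentSpace (𝓡 n) z) :
    coordD (n := n) (χ.trans Φ) z ξ = fderiv ℝ Φ (χ z) (coordD χ z ξ) := by
  have h1 := hχ.hasMFDerivAt hz.1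
  have h2 : HasMFDerivAt 𝓘(ℝ, V) 𝓘(ℝ, V') Φ (χ z) (fderiv ℝ Φ (χ z)) :=
    ((hΦ.contDiffAt (Φ.open_source.mem_nhds hz.2)).differentiableAt
      (by simp)).hasFDerivAt.hasMFDerivAt
  have h3 := (h2.comp z h1).mfderiv
  exact congrArg (fun A => A ξ) h3

/-- A vector field is smooth where its coordinate expression is. -/
lemma contMDiffAt_field_iff [IsManifold (𝓡 n) ∞ M] (hχ : IsSmoothCoord (n := n) χ) {z : M}
    (hz : z ∈ χ.source) {X : ∀ z : M, TangentSpace (𝓡 n) z} :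
    ContMDiffAt (𝓡 n) (𝓡 n).tangent ∞ (fun x => (⟨x, X x⟩ : TangentBundle (𝓡 n) M)) z ↔
      ContMDiffAt (𝓡 n) 𝓘(ℝ, V) ∞ (fun x => coordD χ x (X x)) z := by
  constructor
  · intro h
    -- The coordinate expression is the vector part of the tangent map of `χ` applied to the field;
    -- the converse uses the tangent map of `χ.symm`.
    have h1 := hχ.smooth.contMDiffOn_tangentMapWithin (m := ∞) (by simp)
      χ.open_source.uniqueMDiffOn
    have h2 : ContMDiffAt (𝓡 n).tangent 𝓘(ℝ, V).tangent ∞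
        (tangentMapWithin (𝓡 n) 𝓘(ℝ, V) χ χ.source) (⟨z, X z⟩ : TangentBundle (𝓡 n) M) :=
      h1.contMDiffAt ((χ.open_source.preimage
        (FiberBundle.continuous_proj _ _)).mem_nhds hz)
    have h3 := (contMDiff_snd_tangentBundle_modelSpace V 𝓘(ℝ, V) (n := ∞)).contMDiffAt.comp z
      (h2.comp z h)
    refine h3.congr_of_eventuallyEq ?_
    filter_upwards [χ.open_source.mem_nhds hz] with y hy
    have h4 : mfderivWithin (𝓡 n) 𝓘(ℝ, V) χ χ.source y = coordD χ y :=
      mfderivWithin_of_isOpen χ.open_source hy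
    exact (congrArg (fun A => A (X y)) h4).symm
  · intro h
    have h1 := hχ.smooth_symm.contMDiffOn_tangentMapWithin (m := ∞) (by simp)
      χ.open_target.uniqueMDiffOn
    have h2 : ContMDiffAt 𝓘(ℝ, V).tangent (𝓡 n).tangent ∞
        (tangentMapWithin 𝓘(ℝ, V) (𝓡 n) χ.symm χ.target)
        (⟨χ z, coordD χ z (X z)⟩ : TangentBundle 𝓘(ℝ, V) V) :=
      h1.contMDiffAt ((χ.open_target.preimage
        (FiberBundle.continuous_proj _ _)).mem_nhds (χ.map_source hz))
    have h4 : ContMDiffAt (𝓡 n) 𝓘(ℝ, V).tangent ∞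
        (fun x => (⟨χ x, coordD χ x (X x)⟩ : TangentBundle 𝓘(ℝ, V) V)) z := by
      rw [Bundle.contMDiffAt_totalSpace]
      exact ⟨hχ.contMDiffAt hz, by simpa using h⟩
    refine (h2.comp z h4).congr_of_eventuallyEq ?_
    filter_upwards [χ.open_source.mem_nhds hz] with y hy
    simp only [Function.comp_apply, tangentMapWithin]
    rw [mfderivWithin_of_isOpen χ.open_target (χ.map_source hy)]
    have h5 := hχ.mdifferentiable.symm_comp_deriv hy
    refine Bundle.TotalSpace.ext (χ.left_inv hy).symm ?_
    have h6 : mfderiv 𝓘(ℝ, V) (𝓡 n) χ.symm (χ y) (coordD χ y (X y)) = X y :=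
      congrArg (fun A => A (X y)) h5
    exact (heq_of_eq h6).symm

end IsSmoothCoord

end SmoothCoordinates

end

/-! ### Lie brackets and tensors in coordinates. -/

section

section SmoothCoordinates

variable {n : ℕ} {M : Type u} [TopologicalSpace M] [ChartedSpace (EuclideanSpace ℝ (Fin n)) M]
  {V : Type v} [NormedAddCommGroup V] [NormedSpace ℝ V]

namespace IsSmoothCoord

variable {χ : OpenPartialHomeomorph M V}

/-- A vector field is differentiable where its coordinate expression is. -/
lemma fieldDifferentiableAt_iff [IsManifold (𝓡 n) ∞ M] (hχ : IsSmoothCoord (n := n) χ) {z : M}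
    (hz : z ∈ χ.source) {X : ∀ z : M, TangentSpace (𝓡 n) z} :
    FieldDifferentiableAt X z ↔
      MDifferentiableAt (𝓡 n) 𝓘(ℝ, V) (fun x => coordD χ x (X x)) z := by
  constructor
  · intro h
    have h1 := hχ.smooth.contMDiffOn_tangentMapWithin (m := ∞) (by simp)
      χ.open_source.uniqueMDiffOn
    have h2 : ContMDiffAt (𝓡 n).tangent 𝓘(ℝ, V).tangent ∞
        (tangentMapWithin (𝓡 n) 𝓘(ℝ, V) χ χ.source) (⟨z, X z⟩ : TangentBundle (𝓡 n) M) :=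
      h1.contMDiffAt ((χ.open_source.preimage
        (FiberBundle.continuous_proj _ _)).mem_nhds hz)
    have h3 := ((contMDiff_snd_tangentBundle_modelSpace V 𝓘(ℝ, V)
      (n := ∞)).contMDiffAt.mdifferentiableAt (by simp)).comp z
      ((h2.mdifferentiableAt (by simp)).comp z h)
    refine h3.congr_of_eventuallyEq ?_
    filter_upwards [χ.open_source.mem_nhds hz] with y hy
    have h4 : mfderivWithin (𝓡 n) 𝓘(ℝ, V) χ χ.source y = coordD χ y :=
      mfderivWithin_of_isOpen χ.open_source hy
    exact (congrArg (fun A => A (X y)) h4).symm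
  · intro h
    have h1 := hχ.smooth_symm.contMDiffOn_tangentMapWithin (m := ∞) (by simp)
      χ.open_target.uniqueMDiffOn
    have h2 : ContMDiffAt 𝓘(ℝ, V).tangent (𝓡 n).tangent ∞
        (tangentMapWithin 𝓘(ℝ, V) (𝓡 n) χ.symm χ.target)
        (⟨χ z, coordD χ z (X z)⟩ : TangentBundle 𝓘(ℝ, V) V) :=
      h1.contMDiffAt ((χ.open_target.preimage
        (FiberBundle.continuous_proj _ _)).mem_nhds (χ.map_source hz))
    have h4 : MDifferentiableAt (𝓡 n) 𝓘(ℝ, V).tangent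
        (fun x => (⟨χ x, coordD χ x (X x)⟩ : TangentBundle 𝓘(ℝ, V) V)) z := by
      rw [mdifferentiableAt_totalSpace]
      exact ⟨(hχ.contMDiffAt hz).mdifferentiableAt (by simp), by simpa using h⟩
    refine ((h2.mdifferentiableAt (by simp)).comp z h4).congr_of_eventuallyEq ?_
    filter_upwards [χ.open_source.mem_nhds hz] with y hy
    simp only [Function.comp_apply, tangentMapWithin]
    rw [mfderivWithin_of_isOpen χ.open_target (χ.map_source hy)]
    have h5 := hχ.mdifferentiable.symm_comp_deriv hy
    refine Bundle.TotalSpace.ext (χ.left_inv hy).symm ?_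
    have h6 : mfderiv 𝓘(ℝ, V) (𝓡 n) χ.symm (χ y) (coordD χ y (X y)) = X y :=
      congrArg (fun A => A (X y)) h5
    exact (heq_of_eq h6).symm

lemma smoothFieldAt_coordField [IsManifold (𝓡 n) ∞ M] (hχ : IsSmoothCoord (n := n) χ) {z : M}
    (hz : z ∈ χ.source) {X : V → V} (hX : ContDiffAt ℝ ∞ X (χ z)) :
    ContMDiffAt (𝓡 n) (𝓡 n).tangent ∞
      (fun x => (⟨x, coordField χ X x⟩ : TangentBundle (𝓡 n) M)) z := by
  rw [hχ.contMDiffAt_field_iff hz]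
  refine (hX.contMDiffAt.comp z (hχ.contMDiffAt hz)).congr_of_eventuallyEq ?_
  filter_upwards [χ.open_source.mem_nhds hz] with y hy using hχ.coordD_coordField hy X

lemma fieldDifferentiableAt_coordField [IsManifold (𝓡 n) ∞ M] (hχ : IsSmoothCoord (n := n) χ)
    {z : M} (hz : z ∈ χ.source) {X : V → V} (hX : DifferentiableAt ℝ X (χ z)) :
    FieldDifferentiableAt (n := n) (coordField χ X) z := by
  rw [hχ.fieldDifferentiableAt_iff hz]
  refine (hX.mdifferentiableAt.comp z
    ((hχ.contMDiffAt hz).mdifferentiableAt (by simp))).congr_of_eventuallyEq ?_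
  filter_upwards [χ.open_source.mem_nhds hz] with y hy using hχ.coordD_coordField hy X

/-- The Lie bracket in coordinates. -/
lemma coordD_mlieBracket_coordField [IsManifold (𝓡 n) ∞ M] [FiniteDimensional ℝ V]
    (hχ : IsSmoothCoord (n := n) χ) {z : M} (hz : z ∈ χ.source) {X Y : V → V}
    (hX : DifferentiableAt ℝ X (χ z)) (hY : DifferentiableAt ℝ Y (χ z)) :
    coordD χ z (VectorField.mlieBracket (𝓡 n) (coordField χ X) (coordField χ Y) z)
      = fderiv ℝ Y (χ z) (X (χ z)) - fderiv ℝ X (χ z) (Y (χ z)) := by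
  have : CompleteSpace V := FiniteDimensional.complete ℝ V
  have hsec : ∀ {X : V → V}, DifferentiableAt ℝ X (χ z) → MDifferentiableAt 𝓘(ℝ, V)
      𝓘(ℝ, V).tangent (fun p => (⟨p, X p⟩ : TangentBundle 𝓘(ℝ, V) V)) (χ z) := by
    intro X hX
    rw [mdifferentiableAt_totalSpace]
    exact ⟨mdifferentiableAt_id, by simpa using hX.mdifferentiableAt⟩
  have : IsManifold (𝓡 n) (minSmoothness ℝ 3) M := by
    rw [minSmoothness_of_isRCLikeNormedField]
    exact IsManifold.of_le (n := ∞) (WithTop.coe_le_coe.2 (le_top (a := (3 : ℕ∞))))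
  -- `coordField χ X` is the pullback of `X` by `χ`, so naturality of the bracket reduces the
  -- computation to `V`.
  have h1 := VectorField.mpullback_mlieBracket (I := 𝓡 n) (I' := 𝓘(ℝ, V)) (f := χ) (x₀ := z)
    (n := ∞) (V := X) (W := Y) (hsec hX) (hsec hY) (hχ.contMDiffAt hz)
    (by rw [minSmoothness_of_isRCLikeNormedField]; exact WithTop.coe_le_coe.2 (le_top (a := (2 : ℕ∞))))
  have h2 : VectorField.mlieBracket (𝓡 n) (coordField χ X) (coordField χ Y) z =
    (coordD χ z).inverse (VectorField.mlieBracket 𝓘(ℝ, V) X Y (χ z)) := h1.symm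
  have h3 : VectorField.mlieBracket 𝓘(ℝ, V) X Y = VectorField.lieBracket ℝ X Y := by
    refine VectorField.mlieBracketWithin_univ.symm.trans ?_
    refine VectorField.mlieBracketWithin_eq_lieBracketWithin.trans ?_
    exact VectorField.lieBracketWithin_univ
  rw [h2]
  refine (hχ.coordD_inverse hz _).trans ?_
  exact congrFun h3 (χ z)

/-- The expression of a vector field in coordinates. -/
def _root_.coordExpr (χ : OpenPartialHomeomorph M V) (X : ∀ z : M, TangentSpace (𝓡 n) z) (p : V) :
    V :=
  coordD χ (χ.symm p) (X (χ.symm p))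

lemma coordField_coordExpr (hχ : IsSmoothCoord (n := n) χ) {z : M} (hz : z ∈ χ.source)
    (X : ∀ z : M, TangentSpace (𝓡 n) z) : coordField χ (coordExpr χ X) z = X z := by
  refine hχ.coordD_injective hz ?_
  rw [hχ.coordD_coordField hz, coordExpr, χ.left_inv hz]

lemma differentiableAt_coordExpr [IsManifold (𝓡 n) ∞ M] (hχ : IsSmoothCoord (n := n) χ) {z : M}
    (hz : z ∈ χ.source) {X : ∀ z : M, TangentSpace (𝓡 n) z} (hX : FieldDifferentiableAt X z) :
    DifferentiableAt ℝ (coordExpr χ X) (χ z) := by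
  rw [hχ.fieldDifferentiableAt_iff hz] at hX
  have h1 : MDifferentiableAt 𝓘(ℝ, V) 𝓘(ℝ, V) (coordExpr χ X) (χ z) :=
    MDifferentiableAt.comp (g := fun x => coordD χ x (X x)) (χ z) (by rwa [χ.left_inv hz])
      ((hχ.contMDiffAt_symm (χ.map_source hz)).mdifferentiableAt (by simp))
  exact h1.differentiableAt

lemma coordD_mlieBracket [IsManifold (𝓡 n) ∞ M] [FiniteDimensional ℝ V]
    (hχ : IsSmoothCoord (n := n) χ) {z : M} (hz : z ∈ χ.source)
    {X Y : ∀ z : M, TangentSpace (𝓡 n) z}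
    (hX : FieldDifferentiableAt X z) (hY : FieldDifferentiableAt Y z) :
    coordD χ z (VectorField.mlieBracket (𝓡 n) X Y z)
      = fderiv ℝ (coordExpr χ Y) (χ z) (coordD χ z (X z))
        - fderiv ℝ (coordExpr χ X) (χ z) (coordD χ z (Y z)) := by
  have h1 : ∀ X : ∀ z : M, TangentSpace (𝓡 n) z, X =ᶠ[𝓝 z] coordField χ (coordExpr χ X) := by
    intro X
    filter_upwards [χ.open_source.mem_nhds hz] with y hy using (hχ.coordField_coordExpr hy X).symm
  rw [(h1 X).mlieBracket_vectorField_eq (h1 Y), hχ.coordD_mlieBracket_coordField hz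
    (hχ.differentiableAt_coordExpr hz hX) (hχ.differentiableAt_coordExpr hz hY)]
  have h2 : ∀ X : ∀ z : M, TangentSpace (𝓡 n) z, coordExpr χ X (χ z) = coordD χ z (X z) := by
    intro X
    rw [coordExpr, χ.left_inv hz]
  rw [h2, h2]

end IsSmoothCoord

variable [IsManifold (𝓡 n) ∞ M]

/-- The expression of a `(1,1)` tensor field in coordinates. -/
def Tensor11.coord (Θ : Tensor11 n M) (χ : OpenPartialHomeomorph M V) (p : V) : V →L[ℝ] V :=
  (coordD χ (χ.symm p)).comp ((Θ (χ.symm p)).comp (coordD χ (χ.symm p)).inverse)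

namespace IsSmoothCoord

variable {χ : OpenPartialHomeomorph M V} (Θ : Tensor11 n M)

lemma coordD_tensor (hχ : IsSmoothCoord (n := n) χ) {z : M} (hz : z ∈ χ.source)
    (ξ : TangentSpace (𝓡 n) z) :
    coordD χ z (Θ z ξ) = Θ.coord χ (χ z) (coordD χ z ξ) := by
  simp only [Tensor11.coord, ContinuousLinearMap.comp_apply]
  rw [χ.left_inv hz, hχ.inverse_coordD hz]

lemma smoothField_tensor {z : M} {X : ∀ z : M, TangentSpace (𝓡 n) z}
    (hX : ContMDiffAt (𝓡 n) (𝓡 n).tangent ∞ (fun x => (⟨x, X x⟩ : TangentBundle (𝓡 n) M)) z) :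
    ContMDiffAt (𝓡 n) (𝓡 n).tangent ∞
      (fun x => (⟨x, Θ x (X x)⟩ : TangentBundle (𝓡 n) M)) z :=
  ContMDiffAt.clm_bundle_apply (Θ.contMDiff z) hX

lemma fieldDifferentiableAt_tensor {z : M} {X : ∀ z : M, TangentSpace (𝓡 n) z}
    (hX : FieldDifferentiableAt X z) : FieldDifferentiableAt (fun x => Θ x (X x)) z :=
  MDifferentiableAt.clm_bundle_apply ((Θ.contMDiff z).mdifferentiableAt (by simp)) hX

/-- In finite dimension smoothness can be tested on fixed vectors `v`, and `Θ.coord χ · v` is the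
expression of `Θ` applied to the constant coordinate field `v`. -/
lemma contDiffOn_coord [FiniteDimensional ℝ V] (hχ : IsSmoothCoord (n := n) χ) :
    ContDiffOn ℝ ∞ (Θ.coord χ) χ.target := by
  rw [contDiffOn_clm_apply]
  intro v p hp
  refine ContDiffAt.contDiffWithinAt ?_
  have hz := χ.map_target hp
  have h1 := smoothField_tensor Θ (hχ.smoothFieldAt_coordField hz
    (contDiffAt_const (c := v)))
  rw [hχ.contMDiffAt_field_iff hz] at h1
  exact (h1.comp p (hχ.contMDiffAt_symm hp)).contDiffAt

end IsSmoothCoord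

end SmoothCoordinates

end

/-! ### The Nijenhuis condition in coordinates. -/

section

section SmoothCoordinates

variable {n : ℕ} {M : Type u} [TopologicalSpace M] [ChartedSpace (EuclideanSpace ℝ (Fin n)) M]
  {V : Type v} [NormedAddCommGroup V] [NormedSpace ℝ V] [IsManifold (𝓡 n) ∞ M]

/-- A vector field which is smooth near a point coincides near that point with a globally smooth
one. -/
lemma exists_smoothField_eventuallyEq [T2Space M] {X : ∀ z : M, TangentSpace (𝓡 n) z} {W : Set M}
    (hW : IsOpen W) {z : M} (hz : z ∈ W) (hX : ∀ x ∈ W, ContMDiffAt (𝓡 n) (𝓡 n).tangent ∞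
      (fun x => (⟨x, X x⟩ : TangentBundle (𝓡 n) M)) x) :
    ∃ X' : ∀ z : M, TangentSpace (𝓡 n) z, SmoothFieldOn X' univ ∧ X' =ᶠ[𝓝 z] X := by
  obtain ⟨f, -, hf⟩ := (SmoothBumpFunction.nhds_basis_tsupport (I := 𝓡 n) z).mem_iff.1
    (hW.mem_nhds hz)
  refine ⟨fun x => f x • X x, contMDiffOn_univ.2 fun x => ?_, ?_⟩
  · by_cases hx : x ∈ tsupport f
    · exact ContMDiffAt.smul_section (V := (TangentSpace (𝓡 n) : M → Type _)) (f.contMDiff x) (hX x (hf hx))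
    · have h0 : ContMDiff (𝓡 n) (𝓡 n).tangent ∞
          (fun x => (⟨x, 0⟩ : TangentBundle (𝓡 n) M)) :=
        Bundle.contMDiff_zeroSection (F := EuclideanSpace ℝ (Fin n)) ℝ
          (TangentSpace (𝓡 n) : M → Type _)
      refine (h0 x).congr_of_eventuallyEq ?_
      filter_upwards [(isClosed_tsupport f).isOpen_compl.mem_nhds hx] with y hy
      refine Bundle.TotalSpace.ext rfl (heq_of_eq ?_)
      have : f y = 0 := image_eq_zero_of_notMem_tsupport hy
      simp [this]
  · filter_upwards [f.eventuallyEq_one] with y hy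
    have h1 : f y = 1 := hy
    rw [h1]
    exact one_smul ℝ (X y)

/-- The vanishing of the Nijenhuis tensor in coordinates. -/
lemma Tensor11.NijenhuisVanishes.coord_eq [T2Space M] [FiniteDimensional ℝ V] {Θ : Tensor11 n M}
    (hN : Θ.NijenhuisVanishes) {χ : OpenPartialHomeomorph M V} (hχ : IsSmoothCoord (n := n) χ)
    {p : V} (hp : p ∈ χ.target) (a b : V) :
    Θ.coord χ p (fderiv ℝ (Θ.coord χ) p a b - fderiv ℝ (Θ.coord χ) p b a) =
      fderiv ℝ (Θ.coord χ) p (Θ.coord χ p a) b - fderiv ℝ (Θ.coord χ) p (Θ.coord χ p b) a := by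
  set T := Θ.coord χ with hT
  set z := χ.symm p with hz'
  have hz : z ∈ χ.source := χ.map_target hp
  have hχz : χ z = p := χ.right_inv hp
  have hTp : DifferentiableAt ℝ T p :=
    ((hχ.contDiffOn_coord Θ).contDiffAt (χ.open_target.mem_nhds hp)).differentiableAt (by simp)
  have hTa : ∀ a, DifferentiableAt ℝ (fun q => T q a) (χ z) := fun a => by
    rw [hχz]; exact hTp.clm_apply (differentiableAt_const a)
  have hfd : ∀ a c, fderiv ℝ (fun q => T q a) p c = fderiv ℝ T p c a := fun a c => by
    rw [fderiv_clm_apply hTp (differentiableAt_const a)]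
    simp
  have hc : ∀ a : V, DifferentiableAt ℝ (fun _ : V => a) (χ z) := fun a => differentiableAt_const a
  -- The hypothesis concerns global smooth fields only, so the constant coordinate fields are cut
  -- off away from `z`; brackets at `z` do not notice.
  have key : ∀ a : V, ∃ X : ∀ z : M, TangentSpace (𝓡 n) z, SmoothFieldOn X univ ∧
      X =ᶠ[𝓝 z] coordField χ (fun _ => a) ∧
      (fun x => Θ x (X x)) =ᶠ[𝓝 z] coordField χ (fun q => T q a) := by
    intro a
    obtain ⟨X, hX, hXz⟩ := exists_smoothField_eventuallyEq (X := coordField χ (fun _ => a))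
      χ.open_source hz fun x hx => hχ.smoothFieldAt_coordField hx contDiffAt_const
    refine ⟨X, hX, hXz, ?_⟩
    filter_upwards [hXz, χ.open_source.mem_nhds hz] with y hy hys
    refine hχ.coordD_injective hys ?_
    rw [hy, hχ.coordD_tensor Θ hys, hχ.coordD_coordField hys, hχ.coordD_coordField hys]
  obtain ⟨X, hX, hXz, hΘX⟩ := key a
  obtain ⟨Y, hY, hYz, hΘY⟩ := key b
  have h := congrArg (coordD χ z) (hN X Y hX hY z)
  rw [Tensor11.nijenhuis, hΘX.mlieBracket_vectorField_eq hYz,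
    hXz.mlieBracket_vectorField_eq hΘY, hΘX.mlieBracket_vectorField_eq hΘY,
    hXz.mlieBracket_vectorField_eq hYz] at h
  simp only [map_sub, map_add, map_zero, hχ.coordD_tensor Θ hz] at h
  rw [hχ.coordD_mlieBracket_coordField hz (hTa a) (hc b),
    hχ.coordD_mlieBracket_coordField hz (hc a) (hTa b),
    hχ.coordD_mlieBracket_coordField hz (hTa a) (hTa b),
    hχ.coordD_mlieBracket_coordField hz (hc a) (hc b)] at h
  simp only [hχz, hfd, ← hT, fderiv_fun_const, Pi.zero_apply, zero_apply, sub_zero, zero_sub, map_neg,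
    map_zero, map_sub] at h ⊢
  rw [← sub_eq_zero, ← h]
  abel

end SmoothCoordinates

end

/-! ### Adapted coordinates: a constant image as second factor. -/

section

lemma LinearEquiv.finrank_range_eq {V W : Type*} [AddCommGroup V] [Module ℝ V] [AddCommGroup W]
    [Module ℝ W] (A : V ≃ₗ[ℝ] W) {f : V →ₗ[ℝ] V} {g : W →ₗ[ℝ] W} (h : ∀ v, A (f v) = g (A v)) :
    Module.finrank ℝ (LinearMap.range f) = Module.finrank ℝ (LinearMap.range g) := by
  have h1 : LinearMap.range g = (LinearMap.range f).map A.toLinearMap := by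
    ext w
    constructor
    · rintro ⟨v, rfl⟩
      refine ⟨f (A.symm v), ⟨_, rfl⟩, ?_⟩
      have := h (A.symm v)
      rwa [A.apply_symm_apply] at this
    · rintro ⟨-, ⟨v, rfl⟩, rfl⟩
      exact ⟨A v, (h v).symm⟩
  rw [h1]
  exact (LinearEquiv.finrank_map_eq A _).symm

/-- Linear coordinates in which a given subspace is the second factor. -/
lemma Submodule.exists_equiv_prod {V : Type*} [NormedAddCommGroup V] [NormedSpace ℝ V]
    [FiniteDimensional ℝ V] (K : Submodule ℝ V) {m r : ℕ} (hr : Module.finrank ℝ K = r)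
    (hm : Module.finrank ℝ V = m + r) :
    ∃ L : V ≃L[ℝ] EuclideanSpace ℝ (Fin m) × EuclideanSpace ℝ (Fin r),
      ∀ v, (L v).1 = 0 ↔ v ∈ K := by
  obtain ⟨C, hC⟩ := K.exists_isCompl
  have h1 := Submodule.finrank_add_eq_of_isCompl hC
  let L : V ≃ₗ[ℝ] EuclideanSpace ℝ (Fin m) × EuclideanSpace ℝ (Fin r) :=
    (Submodule.prodEquivOfIsCompl C K hC.symm).symm.trans
      (LinearEquiv.prodCongr (LinearEquiv.ofFinrankEq _ _ (by rw [finrank_euclideanSpace_fin]; omega))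
        (LinearEquiv.ofFinrankEq _ _ (by rw [finrank_euclideanSpace_fin]; omega)))
  refine ⟨L.toContinuousLinearEquiv, fun v => ?_⟩
  have h2 : (L v).1 = 0 ↔ ((Submodule.prodEquivOfIsCompl C K hC.symm).symm v).1 = 0 := by
    simp only [L, LinearEquiv.trans_apply, LinearEquiv.prodCongr_apply]
    exact LinearEquiv.map_eq_zero_iff _
  exact h2.trans (Submodule.prodEquivOfIsCompl_symm_apply_fst_eq_zero _ _ hC.symm)

section SmoothCoordinates

variable {n : ℕ} {M : Type u} [TopologicalSpace M] [ChartedSpace (EuclideanSpace ℝ (Fin n)) M]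

lemma isSmoothCoord_of_mem_maximalAtlas {χ : OpenPartialHomeomorph M (EuclideanSpace ℝ (Fin n))}
    (hχ : χ ∈ IsManifold.maximalAtlas (𝓡 n) ∞ M) : IsSmoothCoord (n := n) χ where
  smooth := contMDiffOn_of_mem_maximalAtlas hχ
  smooth_symm := contMDiffOn_symm_of_mem_maximalAtlas hχ

variable [IsManifold (𝓡 n) ∞ M]

/-- Constancy of the rank is all that the proof draws from algebraic constancy. -/
lemma Tensor11.AlgebraicallyConstant.finrank_range_eq {Θ : Tensor11 n M}
    (hΘ : Θ.AlgebraicallyConstant) (x y : M) :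
    Module.finrank ℝ (Θ x).range = Module.finrank ℝ (Θ y).range := by
  obtain ⟨A, hA⟩ := hΘ x y
  exact A.finrank_range_eq hA

lemma IsSmoothCoord.finrank_range_coord {V : Type v} [NormedAddCommGroup V] [NormedSpace ℝ V]
    {χ : OpenPartialHomeomorph M V} (hχ : IsSmoothCoord (n := n) χ) (Θ : Tensor11 n M) {z : M}
    (hz : z ∈ χ.source) :
    Module.finrank ℝ (Θ z).range = Module.finrank ℝ (Θ.coord χ (χ z)).range :=
  (hχ.mdifferentiable.mfderiv hz).toLinearEquiv.finrank_range_eq (hχ.coordD_tensor Θ hz)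

section Adapted

variable {F E : Type*} [NormedAddCommGroup F] [NormedSpace ℝ F] [NormedAddCommGroup E]
  [NormedSpace ℝ E]

/-- Coordinates in which the tensor `Θ` is `(f, e) ↦ (0, H f)`. -/
def Tensor11.IsAdapted (Θ : Tensor11 n M) (χ : OpenPartialHomeomorph M (F × E))
    (H : F × E → F →L[ℝ] E) : Prop :=
  ∀ z ∈ χ.source, ∀ ξ : TangentSpace (𝓡 n) z,
    coordD χ z (Θ z ξ) = (0, H (χ z) (coordD χ z ξ).1)

namespace Tensor11.IsAdapted

variable {Θ : Tensor11 n M} {χ : OpenPartialHomeomorph M (F × E)} {H : F × E → F →L[ℝ] E}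

lemma coord_apply (h : Θ.IsAdapted χ H) (hχ : IsSmoothCoord (n := n) χ) {p : F × E}
    (hp : p ∈ χ.target) (v : F × E) : Θ.coord χ p v = (0, H p v.1) := by
  have hz := χ.map_target hp
  have h1 := h _ hz ((coordD χ (χ.symm p)).inverse v)
  rw [hχ.coordD_tensor Θ hz, hχ.coordD_inverse hz, χ.right_inv hp] at h1
  exact h1

lemma contDiffOn [FiniteDimensional ℝ F] [FiniteDimensional ℝ E] (h : Θ.IsAdapted χ H)
    (hχ : IsSmoothCoord (n := n) χ) : ContDiffOn ℝ ∞ H χ.target := by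
  have h1 : ContDiffOn ℝ ∞ (fun p => (ContinuousLinearMap.snd ℝ F E).comp
      ((Θ.coord χ p).comp (ContinuousLinearMap.inl ℝ F E))) χ.target :=
    contDiffOn_const.clm_comp ((hχ.contDiffOn_coord Θ).clm_comp contDiffOn_const)
  refine h1.congr fun p hp => ?_
  ext f
  simp [h.coord_apply hχ hp]

/-- Apply the coordinate Nijenhuis identity to `(f, 0)` and `(g, 0)`. Derivatives of `Θ.coord χ`
take values in `0 × E`, which `Θ` kills, so one side vanishes. What is left says that the vertical
fields `(0, H f)` and `(0, H g)` commute. -/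
lemma fderiv_apply_comm [T2Space M] [FiniteDimensional ℝ F] [FiniteDimensional ℝ E]
    (h : Θ.IsAdapted χ H) (hχ : IsSmoothCoord (n := n) χ) (hN : Θ.NijenhuisVanishes) {p : F × E}
    (hp : p ∈ χ.target) (f g : F) :
    fderiv ℝ H p (0, H p f) g = fderiv ℝ H p (0, H p g) f := by
  have hH : HasFDerivAt H (fderiv ℝ H p) p :=
    (((h.contDiffOn hχ).contDiffAt (χ.open_target.mem_nhds hp)).differentiableAt
      (by simp)).hasFDerivAt
  have hT : HasFDerivAt (Θ.coord χ) (fderiv ℝ (Θ.coord χ) p) p :=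
    (((hχ.contDiffOn_coord Θ).contDiffAt (χ.open_target.mem_nhds hp)).differentiableAt
      (by simp)).hasFDerivAt
  have hD : ∀ c v : F × E, fderiv ℝ (Θ.coord χ) p c v = (0, fderiv ℝ H p c v.1) := by
    intro c v
    have h1 : HasFDerivAt (fun q => Θ.coord χ q v) _ p := hT.clm_apply (hasFDerivAt_const v p)
    have h2 : HasFDerivAt (fun q => H q v.1) _ p := hH.clm_apply (hasFDerivAt_const v.1 p)
    have h3 : HasFDerivAt (fun q => ((0 : F), H q v.1)) _ p := (hasFDerivAt_const 0 p).prodMk h2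
    have h4 : (fun q => Θ.coord χ q v) =ᶠ[𝓝 p] fun q => ((0 : F), H q v.1) := by
      filter_upwards [χ.open_target.mem_nhds hp] with q hq using h.coord_apply hχ hq v
    have h5 := congrArg (fun A => A c) (h1.unique (h3.congr_of_eventuallyEq h4))
    simpa using h5
  have h1 := hN.coord_eq hχ hp (f, 0) (g, 0)
  simp only [hD, h.coord_apply hχ hp, Prod.mk_sub_mk, sub_zero, map_zero] at h1
  exact sub_eq_zero.1 (congrArg Prod.snd h1).symm

end Tensor11.IsAdapted

/-- Adapted coordinates exist. -/
theorem Tensor11.exists_isAdapted [T2Space M] {Θ : Tensor11 n M} (hconst : Θ.AlgebraicallyConstant)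
    (hsq : ∀ (x : M) (ξ : TangentSpace (𝓡 n) x), Θ x (Θ x ξ) = 0) (hN : Θ.NijenhuisVanishes)
    (x₀ : M) :
    ∃ (m r : ℕ) (χ : OpenPartialHomeomorph M (EuclideanSpace ℝ (Fin m) × EuclideanSpace ℝ (Fin r)))
      (H : EuclideanSpace ℝ (Fin m) × EuclideanSpace ℝ (Fin r) →
        EuclideanSpace ℝ (Fin m) →L[ℝ] EuclideanSpace ℝ (Fin r))
      (S : EuclideanSpace ℝ (Fin r) →L[ℝ] EuclideanSpace ℝ (Fin m)),
      n = m + r ∧ IsSmoothCoord (n := n) χ ∧ x₀ ∈ χ.source ∧ Θ.IsAdapted χ H ∧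
        ∀ h, H (χ x₀) (S h) = h := by
  set c := chartAt (EuclideanSpace ℝ (Fin n)) x₀ with hc
  have hcs : IsSmoothCoord (n := n) c :=
    isSmoothCoord_of_mem_maximalAtlas (IsManifold.chart_mem_maximalAtlas x₀)
  have hx₀ : x₀ ∈ c.source := mem_chart_source _ _
  have hrank : ∀ p ∈ c.target, Module.finrank ℝ (Θ.coord c p).range
      = Module.finrank ℝ (Θ x₀).range := by
    intro p hp
    rw [← hconst.finrank_range_eq (c.symm p) x₀, hcs.finrank_range_coord Θ (c.map_target hp),
      c.right_inv hp]
  obtain ⟨Φ, hΦ₀, -, -, hΦ, hΦs, hΦr⟩ := exists_straightening_range (hcs.contDiffOn_coord Θ)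
    c.open_target (c.map_source hx₀)
    (fun p hp => (hrank p hp).trans (hrank _ (c.map_source hx₀)).symm)
    (fun p hp => hN.coord_eq hcs hp)
  set K := (Θ.coord c (c x₀)).range with hK
  set χ := c.trans Φ with hχ'
  have hχ : IsSmoothCoord (n := n) χ := hcs.trans hΦ hΦs
  have hxχ : x₀ ∈ χ.source := ⟨hx₀, hΦ₀⟩
  set T := Θ.coord χ with hT
  -- Straightening gives one inclusion and constancy of the rank gives equality.
  have hTK : ∀ z ∈ χ.source, (T (χ z)).range = K := by
    intro z hz
    refine Submodule.eq_of_le_of_finrank_eq ?_ ?_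
    · rintro - ⟨v, rfl⟩
      obtain ⟨ξ, rfl⟩ : ∃ ξ, coordD χ z ξ = v := ⟨_, hχ.coordD_inverse hz v⟩
      have h1 := hχ.coordD_tensor Θ hz ξ
      have h2 := hcs.coordD_trans hΦ hz (Θ z ξ)
      rw [hcs.coordD_tensor Θ hz.1] at h2
      have h3 : T (χ z) (coordD χ z ξ) ∈ K := by
        rw [← h1]
        exact h2 ▸ hΦr _ hz.2 _
      exact h3
    · rw [← hχ.finrank_range_coord Θ hz, hconst.finrank_range_eq z x₀, hrank _ (c.map_source hx₀)]
  have hTT : ∀ z ∈ χ.source, ∀ v, T (χ z) (T (χ z) v) = 0 := by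
    intro z hz v
    obtain ⟨ξ, rfl⟩ : ∃ ξ, coordD χ z ξ = v := ⟨_, hχ.coordD_inverse hz v⟩
    rw [← hχ.coordD_tensor Θ hz, ← hχ.coordD_tensor Θ hz, hsq, map_zero]
  have hTK0 : ∀ z ∈ χ.source, ∀ v ∈ K, T (χ z) v = 0 := by
    intro z hz v hv
    rw [← hTK z hz] at hv
    obtain ⟨w, rfl⟩ := hv
    exact hTT z hz w
  have hKn : Module.finrank ℝ K ≤ n := by
    simpa using Submodule.finrank_le K
  obtain ⟨L, hL⟩ := K.exists_equiv_prod (m := n - Module.finrank ℝ K) rfl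
    (by rw [finrank_euclideanSpace_fin]; omega)
  have hLK : ∀ e, L.symm (0, e) ∈ K := fun e => by rw [← hL]; simp
  let Ψ := L.toHomeomorph.toOpenPartialHomeomorph
  have hΨ : ContDiffOn ℝ ∞ Ψ Ψ.source := L.contDiff.contDiffOn
  have hΨs : ContDiffOn ℝ ∞ Ψ.symm Ψ.target := L.symm.contDiff.contDiffOn
  have hχΨ : ∀ z ∈ χ.source, z ∈ (χ.trans Ψ).source := fun z hz => ⟨hz, trivial⟩
  have hD : ∀ z ∈ χ.source, ∀ ξ : TangentSpace (𝓡 n) z,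
      coordD (χ.trans Ψ) z ξ = L (coordD χ z ξ) := by
    intro z hz ξ
    rw [hχ.coordD_trans hΨ (hχΨ z hz)]
    exact congrArg (fun A => A (coordD χ z ξ)) L.fderiv
  let H := fun p => (ContinuousLinearMap.snd ℝ _ _).comp (L.toContinuousLinearMap.comp
    ((T (L.symm p)).comp (L.symm.toContinuousLinearMap.comp (ContinuousLinearMap.inl ℝ _ _))))
  -- `T` takes values in `K` and, by `Θ² = 0`, kills `K`. Only the block from the complement to `K`
  -- survives.
  have hH : ∀ z ∈ χ.source, ∀ v, L (T (χ z) v) = (0, H (L (χ z)) (L v).1) := by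
    intro z hz v
    refine Prod.ext ((hL _).2 ?_) ?_
    · rw [← hTK z hz]
      exact ⟨v, rfl⟩
    · have h1 : v = L.symm ((L v).1, 0) + L.symm (0, (L v).2) := by
        rw [← map_add]
        simp
      have h2 : T (χ z) v = T (χ z) (L.symm ((L v).1, 0)) := by
        conv_lhs => rw [h1]
        rw [map_add, hTK0 z hz _ (hLK _), add_zero]
      simp [H, h2]
  have hsurj : Function.Surjective (H (L (χ x₀))) := by
    intro e
    have h1 : L.symm (0, e) ∈ (T (χ x₀)).range := by
      rw [hTK x₀ hxχ]
      exact hLK e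
    obtain ⟨w, hw⟩ := h1
    have h2 : T (χ x₀) w = L.symm (0, e) := hw
    refine ⟨(L w).1, ?_⟩
    have h3 := hH x₀ hxχ w
    rw [h2, L.apply_symm_apply] at h3
    exact (congrArg Prod.snd h3).symm
  obtain ⟨S, hS⟩ := LinearMap.exists_clm_rightInverse hsurj
  refine ⟨_, _, χ.trans Ψ, H, S, by omega, hχ.trans hΨ hΨs, hχΨ _ hxχ, ?_, hS⟩
  intro z hz ξ
  rw [hD z hz.1, hD z hz.1, hχ.coordD_tensor Θ hz.1]
  exact hH z hz.1 _

end Adapted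

end SmoothCoordinates

end

/-! ### Normal form: the tensor depends on the base coordinate only. -/

section

section SmoothCoordinates

variable {n : ℕ} {M : Type u} [TopologicalSpace M] [ChartedSpace (EuclideanSpace ℝ (Fin n)) M]
  [IsManifold (𝓡 n) ∞ M] {Θ : Tensor11 n M}

/-- Adapted coordinates can be straightened along the fibres. -/
lemma Tensor11.IsAdapted.exists_rightInverse [T2Space M] {F E : Type v} [NormedAddCommGroup F]
    [NormedSpace ℝ F] [NormedAddCommGroup E] [NormedSpace ℝ E] [FiniteDimensional ℝ F]
    [FiniteDimensional ℝ E] {χ : OpenPartialHomeomorph M (F × E)} {H : F × E → F →L[ℝ] E}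
    (h : Θ.IsAdapted χ H) (hχ : IsSmoothCoord (n := n) χ) (hN : Θ.NijenhuisVanishes) {x₀ : M}
    (hx₀ : x₀ ∈ χ.source) {S : E →L[ℝ] F} (hS : ∀ e, H (χ x₀) (S e) = e) :
    ∃ (χ' : OpenPartialHomeomorph M (F × E)) (H' : F × E → F →L[ℝ] E),
      IsSmoothCoord (n := n) χ' ∧ x₀ ∈ χ'.source ∧ Θ.IsAdapted χ' H' ∧
        ∀ p ∈ χ'.target, ∀ e, H' p (S e) = e := by
  obtain ⟨Φ, hΦ₀, -, -, hΦ, hΦs, hΦS, hΦ1⟩ := exists_straightening_vertical (h.contDiffOn hχ)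
    χ.open_target (χ.map_source hx₀) (fun p hp => h.fderiv_apply_comm hχ hN hp) hS
  have hfst : ∀ p ∈ Φ.source, ∀ v, (fderiv ℝ Φ p v).1 = v.1 := by
    intro p hp v
    have h1 : HasFDerivAt Φ (fderiv ℝ Φ p) p :=
      ((hΦ.contDiffAt (Φ.open_source.mem_nhds hp)).differentiableAt (by simp)).hasFDerivAt
    have h2 : HasFDerivAt (fun q => (Φ q).1) _ p := h1.fst
    have h3 : (fun q => (Φ q).1) =ᶠ[𝓝 p] Prod.fst := by
      filter_upwards [Φ.open_source.mem_nhds hp] with q hq using hΦ1 q hq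
    exact congrArg (fun A => A v) (h2.unique (hasFDerivAt_fst.congr_of_eventuallyEq h3))
  -- The new `H'` is the vertical part of the derivative of `Φ` applied to `(0, H f)`; since `Φ`
  -- sends `(0, H (S e))` to `(0, e)`, it has the constant right inverse `S`.
  refine ⟨χ.trans Φ, fun q => (ContinuousLinearMap.snd ℝ F E).comp ((fderiv ℝ Φ (Φ.symm q)).comp
    ((ContinuousLinearMap.inr ℝ F E).comp (H (Φ.symm q)))), hχ.trans hΦ hΦs, ⟨hx₀, hΦ₀⟩, ?_, ?_⟩
  · intro z hz ξ
    have h1 : Φ.symm ((χ.trans Φ) z) = χ z := Φ.left_inv hz.2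
    rw [hχ.coordD_trans hΦ hz, hχ.coordD_trans hΦ hz, h z hz.1]
    refine Prod.ext (hfst _ hz.2 _) ?_
    simp only [ContinuousLinearMap.comp_apply, ContinuousLinearMap.inr_apply, h1]
    exact congrArg (fun f => (fderiv ℝ Φ (χ z) (0, H (χ z) f)).2) (hfst _ hz.2 _).symm
  · intro q hq e
    have h1 := hΦS _ (Φ.map_target hq.1) e
    exact congrArg Prod.snd h1

set_option maxHeartbeats 400000 in
/-- Adapted coordinates in which `Θ` has the normal form `(f, e) ↦ (0, G y f)`, with `G`
depending only on the first coordinate, which ranges over the whole space. -/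
theorem Tensor11.IsAdapted.exists_normal_form [T2Space M] {m r : ℕ}
    {χ : OpenPartialHomeomorph M (EuclideanSpace ℝ (Fin m) × EuclideanSpace ℝ (Fin r))}
    {H : EuclideanSpace ℝ (Fin m) × EuclideanSpace ℝ (Fin r) →
      EuclideanSpace ℝ (Fin m) →L[ℝ] EuclideanSpace ℝ (Fin r)}
    (h : Θ.IsAdapted χ H) (hχ : IsSmoothCoord (n := n) χ) (hN : Θ.NijenhuisVanishes) {x₀ : M}
    (hx₀ : x₀ ∈ χ.source) {S : EuclideanSpace ℝ (Fin r) →L[ℝ] EuclideanSpace ℝ (Fin m)}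
    (hS : ∀ p ∈ χ.target, ∀ e, H p (S e) = e) :
    ∃ (χ' : OpenPartialHomeomorph M (EuclideanSpace ℝ (Fin m) × EuclideanSpace ℝ (Fin r)))
      (G : EuclideanSpace ℝ (Fin m) → EuclideanSpace ℝ (Fin m) →L[ℝ] EuclideanSpace ℝ (Fin r))
      (T : EuclideanSpace ℝ (Fin m) → EuclideanSpace ℝ (Fin r) →L[ℝ] EuclideanSpace ℝ (Fin m)),
      IsSmoothCoord (n := n) χ' ∧ x₀ ∈ χ'.source ∧ IsConnected χ'.source ∧
      (∀ y, ∃ z ∈ χ'.source, (χ' z).1 = y) ∧ ContDiff ℝ ∞ G ∧ ContDiff ℝ ∞ T ∧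
      (∀ y e, G y (T y e) = e) ∧ Θ.IsAdapted χ' fun p => G p.1 := by
  set y₀ := (χ x₀).1 with hy₀
  set z₀ := (χ x₀).2 with hz₀
  obtain ⟨ε, hε, hB⟩ := Metric.isOpen_iff.1 χ.open_target _ (χ.map_source hx₀)
  rw [← ball_prod_same] at hB
  set B := Metric.ball y₀ ε ×ˢ Metric.ball z₀ ε with hB'
  have hBo : IsOpen B := Metric.isOpen_ball.prod Metric.isOpen_ball
  have hBc : Convex ℝ B := (convex_ball _ _).prod (convex_ball _ _)
  have hz₀B : z₀ ∈ Metric.ball z₀ ε := Metric.mem_ball_self hε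
  -- Stretching the base ball to the whole Euclidean space lets this space serve as `Σ`, with `G`
  -- and `T` globally defined and every fibre met; the product domain stays connected.
  set g := OpenPartialHomeomorph.univBall y₀ ε with hg
  have hgt : g.target = Metric.ball y₀ ε := OpenPartialHomeomorph.univBall_target y₀ hε
  have hgs : g.source = univ := OpenPartialHomeomorph.univBall_source y₀ ε
  have hgb : ∀ y, g y ∈ Metric.ball y₀ ε := fun y => by
    rw [← hgt]; exact g.map_source (by rw [hgs]; trivial)
  have hgd : ContDiff ℝ ∞ g := OpenPartialHomeomorph.contDiff_univBall
  have hgsd : ContDiffOn ℝ ∞ g.symm (Metric.ball y₀ ε) :=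
    OpenPartialHomeomorph.contDiffOn_univBall_symm
  have hgsd' : ∀ y ∈ Metric.ball y₀ ε, HasFDerivAt g.symm (fderiv ℝ g.symm y) y := fun y hy =>
    ((hgsd.contDiffAt (Metric.isOpen_ball.mem_nhds hy)).differentiableAt (by simp)).hasFDerivAt
  have hinv : ∀ y ∈ Metric.ball y₀ ε, ∀ f,
      fderiv ℝ g (g.symm y) (fderiv ℝ g.symm y f) = f := by
    intro y hy f
    have h1 : HasFDerivAt (fun w => g (g.symm w)) _ y :=
      (hgd.differentiable (by simp) (g.symm y)).hasFDerivAt.comp y (hgsd' y hy)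
    have h2 : (fun w => g (g.symm w)) =ᶠ[𝓝 y] id := by
      filter_upwards [Metric.isOpen_ball.mem_nhds hy] with w hw
      exact g.right_inv (by rwa [hgt])
    exact congrArg (fun A => A f) (h1.unique ((hasFDerivAt_id y).congr_of_eventuallyEq h2))
  set Ψ := g.symm.prod (OpenPartialHomeomorph.ofSet (Metric.ball z₀ ε) Metric.isOpen_ball) with hΨ'
  have hΨsource : Ψ.source = B := by
    simp [hΨ', hgt, hB']
  have hΨtarget : Ψ.target = univ ×ˢ Metric.ball z₀ ε := by
    simp [hΨ', hgs]
  have hΨa : ∀ p, Ψ p = (g.symm p.1, p.2) := fun p => rfl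
  have hΨsa : ∀ p, Ψ.symm p = (g p.1, p.2) := fun p => rfl
  have hΨ : ContDiffOn ℝ ∞ Ψ Ψ.source := by
    rw [hΨsource]
    exact (hgsd.comp contDiff_fst.contDiffOn fun p hp => hp.1).prodMk contDiff_snd.contDiffOn
  have hΨs : ContDiffOn ℝ ∞ Ψ.symm Ψ.target :=
    ((hgd.comp contDiff_fst).prodMk contDiff_snd).contDiffOn
  have hΨD : ∀ p ∈ B, ∀ v, fderiv ℝ Ψ p v = (fderiv ℝ g.symm p.1 v.1, v.2) := by
    intro p hp v
    have h1 : HasFDerivAt (fun q : EuclideanSpace ℝ (Fin m) × EuclideanSpace ℝ (Fin r) =>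
        (g.symm q.1, q.2)) _ p :=
      ((hgsd' p.1 hp.1).comp p hasFDerivAt_fst).prodMk hasFDerivAt_snd
    exact congrArg (fun A => A v) h1.fderiv
  have htarget : (χ.trans Ψ).target = univ ×ˢ Metric.ball z₀ ε := by
    rw [OpenPartialHomeomorph.trans_target, hΨtarget, inter_eq_left]
    intro p hp
    exact hB ⟨hgb _, hp.2⟩
  have hχΨ : IsSmoothCoord (n := n) (χ.trans Ψ) := hχ.trans hΨ hΨs
  have hsource : ∀ z ∈ (χ.trans Ψ).source, χ z ∈ B := fun z hz => hΨsource ▸ hz.2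
  have hH := h.contDiffOn hχ
  have hgB : ∀ y, (g y, z₀) ∈ B := fun y => mk_mem_prod (hgb y) hz₀B
  have hgt' : ∀ y, (g y, z₀) ∈ χ.target := fun y => hB (hgB y)
  clear_value Ψ g
  have hx₀Ψ : x₀ ∈ (χ.trans Ψ).source := by
    refine ⟨hx₀, ?_⟩
    rw [hΨsource]
    exact ⟨Metric.mem_ball_self hε, hz₀B⟩
  refine ⟨χ.trans Ψ, fun y => (H (g y, z₀)).comp (fderiv ℝ g y),
    fun y => (fderiv ℝ g.symm (g y)).comp S, hχΨ, hx₀Ψ, ?_, ?_, ?_, ?_, ?_, ?_⟩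
  · rw [← (χ.trans Ψ).symm_image_target_eq_source, htarget]
    have h1 : IsConnected ((univ : Set (EuclideanSpace ℝ (Fin m))) ×ˢ Metric.ball z₀ ε) :=
      isConnected_univ.prod ((convex_ball z₀ ε).isConnected ⟨z₀, hz₀B⟩)
    exact h1.image _ ((χ.trans Ψ).continuousOn_symm.mono (by rw [htarget]))
  · intro y
    have h1 : (y, z₀) ∈ (χ.trans Ψ).target := by
      rw [htarget]
      exact ⟨trivial, hz₀B⟩
    exact ⟨(χ.trans Ψ).symm (y, z₀), (χ.trans Ψ).map_target h1, by
      rw [(χ.trans Ψ).right_inv h1]⟩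
  · refine ContDiff.clm_comp ?_ (hgd.fderiv_right (m := ∞) (by simp))
    exact ContDiffOn.comp_contDiff (f := fun y => (g y, z₀)) hH (hgd.prodMk contDiff_const)
      hgt'
  · refine ContDiff.clm_comp ?_ contDiff_const
    exact (hgsd.fderiv_of_isOpen (m := ∞) Metric.isOpen_ball (by simp)).comp_contDiff hgd hgb
  · intro y e
    have h1 := hinv (g y) (hgb y) (S e)
    rw [g.left_inv (by rw [hgs]; trivial)] at h1
    simp only [ContinuousLinearMap.comp_apply, h1]
    exact hS _ (hgt' y) e
  · intro z hz ξ
    have hzB := hsource z hz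
    rw [hχ.coordD_trans hΨ hz, hχ.coordD_trans hΨ hz, h z hz.1, hΨD _ hzB, hΨD _ hzB]
    have h1 : ((χ.trans Ψ) z).1 = g.symm (χ z).1 := congrArg Prod.fst (hΨa (χ z))
    have h2 : g (g.symm (χ z).1) = (χ z).1 := g.right_inv (by rw [hgt]; exact hzB.1)
    -- On the convex box `H` does not depend on the second coordinate, which may therefore be frozen
    -- at `z₀`.
    have h3 := eq_of_fst_eq_of_rightInverse hBo hBc (hH.mono hB)
      (fun p hp => h.fderiv_apply_comm hχ hN (hB hp)) (fun p hp => hS p (hB hp))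
      (y := (χ z).1) (z := (χ z).2) (z' := z₀) hzB ⟨hzB.1, hz₀B⟩
    simp only [map_zero, h1, h2, ContinuousLinearMap.comp_apply, hinv _ hzB.1]
    rw [← h3]

end SmoothCoordinates

end

/-! ### The model: the affine bundle of a kernel distribution. -/

section

section KernelBundle

variable {n m r : ℕ}
  {G : EuclideanSpace ℝ (Fin m) → EuclideanSpace ℝ (Fin m) →L[ℝ] EuclideanSpace ℝ (Fin r)}
  {T : EuclideanSpace ℝ (Fin m) → EuclideanSpace ℝ (Fin r) →L[ℝ] EuclideanSpace ℝ (Fin m)}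

/-- The distribution on a Euclidean space formed by the kernels of a smooth family of surjective
linear maps. -/
def kernelDistribution (hG : ContDiff ℝ ∞ G) (hT : ContDiff ℝ ∞ T) (hGT : ∀ y e, G y (T y e) = e) :
    SmoothDistribution m (EuclideanSpace ℝ (Fin m)) where
  space y := (G y).ker
  exists_local_frame y₀ := by
    have hfin : ∀ y, Module.finrank ℝ (G y).ker = Module.finrank ℝ (G y₀).ker := by
      intro y
      have h1 : ∀ y, Module.finrank ℝ (G y).range = r := fun y => by
        rw [LinearMap.range_eq_top.2 fun e => ⟨T y e, hGT y e⟩, finrank_top,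
          finrank_euclideanSpace_fin]
      have h2 := (G y).toLinearMap.finrank_range_add_finrank_ker
      have h3 := (G y₀).toLinearMap.finrank_range_add_finrank_ker
      have h4 := h1 y
      have h5 := h1 y₀
      omega
    let b := Module.finBasis ℝ (G y₀).ker
    -- `v ↦ v - T y (G y v)` projects onto `ker (G y)`. It moves a basis of the kernel at `y₀` to
    -- nearby kernels, where it stays independent and spans by dimension.
    let X : Fin _ → EuclideanSpace ℝ (Fin m) → EuclideanSpace ℝ (Fin m) :=
      fun i y => b i - T y (G y (b i))
    have hX : ∀ i, ContDiff ℝ ∞ (X i) := fun i =>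
      contDiff_const.sub (hT.clm_apply (hG.clm_apply contDiff_const))
    have hXk : ∀ i y, X i y ∈ (G y).ker := by
      intro i y
      change G y (b i - T y (G y (b i))) = 0
      rw [map_sub, hGT, sub_self]
    have hX0 : ∀ i, X i y₀ = b i := by
      intro i
      have h1 : G y₀ (b i) = 0 := (b i).2
      simp [X, h1]
    let W := (fun y i => X i y) ⁻¹' {f | LinearIndependent ℝ f}
    have hW : IsOpen W := isOpen_setOfPred_linearIndependent.preimage
      (continuous_pi fun i => (hX i).continuous)
    have hspan : ∀ y ∈ W, Submodule.span ℝ (Set.range fun i => X i y) = (G y).ker := by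
      intro y hy
      refine Submodule.eq_of_le_of_finrank_eq (Submodule.span_le.2 ?_) ?_
      · rintro - ⟨i, rfl⟩
        exact hXk i y
      · rw [finrank_span_eq_card hy, Fintype.card_fin]
        exact (hfin y).symm
    refine ⟨_, W, X, hW, ?_, ?_, fun y hy => ⟨hy, hspan y hy⟩⟩
    · change LinearIndependent ℝ fun i => X i y₀
      simp only [hX0]
      exact b.linearIndependent.map' (G y₀).ker.subtype (by simp)
    · intro i y _
      exact ContMDiffAt.contMDiffWithinAt (contMDiffAt_vectorSpace_iff_contDiffAt.2 (hX i).contDiffAt)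

variable (hG : ContDiff ℝ ∞ G) (hT : ContDiff ℝ ∞ T) (hGT : ∀ y e, G y (T y e) = e)

/-- The quotient by the kernel of a surjective linear map, identified with its target. -/
def kernelDistribution.quotEquiv (y : EuclideanSpace ℝ (Fin m)) :
    (kernelDistribution hG hT hGT).Quot y ≃ₗ[ℝ] EuclideanSpace ℝ (Fin r) :=
  (G y).toLinearMap.quotKerEquivOfSurjective fun e => ⟨T y e, hGT y e⟩

lemma kernelDistribution.quotEquiv_mkQ (y : EuclideanSpace ℝ (Fin m))
    (η : EuclideanSpace ℝ (Fin m)) :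
    quotEquiv hG hT hGT y (((kernelDistribution hG hT hGT).space y).mkQ η) = G y η :=
  rfl

variable (L : EuclideanSpace ℝ (Fin n) ≃L[ℝ] EuclideanSpace ℝ (Fin m) × EuclideanSpace ℝ (Fin r))

/-- The trivial affine bundle associated with the quotient by the distribution of kernels. -/
def kernelBundle : AffineQuotientBundle n (kernelDistribution hG hT hGT) where
  Total := EuclideanSpace ℝ (Fin n)
  proj p := (L p).1
  torsor y :=
    -- The class of `η` translates the second coordinate by `G y η`.
    { vadd q p := ⟨p.1 + L.symm (0, kernelDistribution.quotEquiv hG hT hGT y q), by simp [p.2]⟩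
      zero_vadd p := Subtype.ext (by
        change p.1 + L.symm (0, kernelDistribution.quotEquiv hG hT hGT y 0) = p.1
        rw [map_zero, ← Prod.zero_eq_mk, map_zero, add_zero])
      add_vadd q q' p := Subtype.ext (by
        change p.1 + L.symm (0, kernelDistribution.quotEquiv hG hT hGT y (q + q')) =
          p.1 + L.symm (0, kernelDistribution.quotEquiv hG hT hGT y q') +
            L.symm (0, kernelDistribution.quotEquiv hG hT hGT y q)
        rw [map_add, add_assoc, add_right_inj, ← map_add L.symm, Prod.mk_add_mk, add_zero,
          add_comm])
      vsub p p' := (kernelDistribution.quotEquiv hG hT hGT y).symm ((L p.1).2 - (L p'.1).2)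
      nonempty := ⟨⟨L.symm (y, 0), by simp⟩⟩
      vsub_vadd' p p' := Subtype.ext (by
        change p'.1 + L.symm (0, kernelDistribution.quotEquiv hG hT hGT y
          ((kernelDistribution.quotEquiv hG hT hGT y).symm ((L p.1).2 - (L p'.1).2))) = p.1
        apply L.injective
        rw [LinearEquiv.apply_symm_apply, map_add, L.apply_symm_apply]
        refine Prod.ext ?_ ?_
        · simp [p.2, p'.2]
        · simp)
      vadd_vsub' q p := by
        change (kernelDistribution.quotEquiv hG hT hGT y).symm
          ((L (p.1 + L.symm (0, kernelDistribution.quotEquiv hG hT hGT y q))).2 - (L p.1).2) = q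
        simp }
  locally_trivial y₀ := by
    let b := (EuclideanSpace.basisFun (Fin r) ℝ).toBasis
    have hb : ∀ y i, ((kernelDistribution hG hT hGT).space y).mkQ (T y (b i)) =
        (b.map (kernelDistribution.quotEquiv hG hT hGT y).symm) i := by
      intro y i
      rw [Module.Basis.map_apply, LinearEquiv.eq_symm_apply, kernelDistribution.quotEquiv_mkQ, hGT]
    -- The trivialization is global: the zero section, with the frame `T y (b i)` whose classes
    -- correspond to the standard basis under `G y`.
    refine ⟨r, univ, fun y => ⟨L.symm (y, 0), by simp⟩, fun i y => T y (b i),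
      L.toHomeomorph.toOpenPartialHomeomorph, isOpen_univ, trivial, ?_, ?_, rfl, ?_, ?_, ?_, ?_⟩
    · intro i y _
      exact ContMDiffAt.contMDiffWithinAt (contMDiffAt_vectorSpace_iff_contDiffAt.2
        (hT.clm_apply contDiff_const).contDiffAt)
    · intro y _
      simp only [hb]
      exact ⟨Module.Basis.linearIndependent _, Module.Basis.span_eq _⟩
    · simp
    · exact (((ContinuousLinearMap.fst ℝ _ _).contDiff.comp L.contDiff).contMDiff.prodMk
        ((ContinuousLinearMap.snd ℝ _ _).contDiff.comp L.contDiff).contMDiff).contMDiffOn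
    · have h1 : ContMDiff ((𝓡 m).prod (𝓡 r)) (𝓡 n) ∞
          fun q : EuclideanSpace ℝ (Fin m) × EuclideanSpace ℝ (Fin r) =>
            L.symm (q.1, 0) + L.symm (0, q.2) :=
        ((L.symm.contDiff.comp (ContinuousLinearMap.inl ℝ _ _).contDiff).contMDiff.comp
          contMDiff_fst).add ((L.symm.contDiff.comp
            (ContinuousLinearMap.inr ℝ _ _).contDiff).contMDiff.comp contMDiff_snd)
      refine h1.contMDiffOn.congr fun q _ => ?_
      rw [← map_add]
      simp
    · intro y _ c
      change L.symm (y, c) = L.symm (y, 0) + L.symm (0, kernelDistribution.quotEquiv hG hT hGT y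
        (∑ i, c i • ((kernelDistribution hG hT hGT).space y).mkQ (T y (b i))))
      have h1 : kernelDistribution.quotEquiv hG hT hGT y
          (∑ i, c i • ((kernelDistribution hG hT hGT).space y).mkQ (T y (b i))) = c := by
        simp only [map_sum, map_smul, kernelDistribution.quotEquiv_mkQ, hGT]
        exact b.sum_repr c
      rw [h1, ← map_add]
      simp

/-- Fibre lines are affine lines and the projection is linear, so both derivatives in the canonical
tensor are explicit. The result is the normal form `(f, e) ↦ (0, G f)` transported by `L`. -/
lemma kernelBundle_tensor (p ξ : EuclideanSpace ℝ (Fin n)) :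
    (kernelBundle hG hT hGT L).tensor p ξ = L.symm (0, G (L p).1 (L ξ).1) := by
  have h1 : ∀ q, (kernelBundle hG hT hGT L).vertical p q =
      L.symm (0, kernelDistribution.quotEquiv hG hT hGT _ q) := by
    intro q
    let v : EuclideanSpace ℝ (Fin n) := L.symm (0, kernelDistribution.quotEquiv hG hT hGT _ q)
    let γ : ℝ → EuclideanSpace ℝ (Fin n) := (kernelBundle hG hT hGT L).fibreLine p q
    have h2 : HasFDerivAt γ ((ContinuousLinearMap.id ℝ ℝ).smulRight v) 0 := by
      have h3 : γ = fun t : ℝ => p + t • v := by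
        funext t
        change p + L.symm (0, kernelDistribution.quotEquiv hG hT hGT _ (t • q)) = _
        rw [map_smul, ← map_smul L.symm, Prod.smul_mk, smul_zero]
      rw [h3]
      exact ((hasFDerivAt_id (0 : ℝ)).smul_const v).const_add p
    have h3 : mfderiv 𝓘(ℝ, ℝ) (𝓡 n) γ 0 (1 : ℝ) = (1 : ℝ) • v :=
      DFunLike.congr_fun h2.hasMFDerivAt.mfderiv (1 : ℝ)
    exact h3.trans (one_smul ℝ v)
  let f : EuclideanSpace ℝ (Fin n) → EuclideanSpace ℝ (Fin m) := fun p => (L p).1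
  have h2 : HasFDerivAt f ((ContinuousLinearMap.fst ℝ _ _).comp L.toContinuousLinearMap) p :=
    ((ContinuousLinearMap.fst ℝ _ _).comp L.toContinuousLinearMap).hasFDerivAt
  have h3 : mfderiv (𝓡 n) (𝓡 m) f p ξ = (L ξ).1 :=
    congrArg (fun A => A ξ) h2.hasMFDerivAt.mfderiv
  refine (h1 _).trans ?_
  exact congrArg (fun η => L.symm (0, G (L p).1 η)) h3

end KernelBundle

section Realization

variable {n : ℕ} {M : Type u} [TopologicalSpace M] [ChartedSpace (EuclideanSpace ℝ (Fin n)) M]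
  [IsManifold (𝓡 n) ∞ M] {Θ : Tensor11 n M}

/-- Algebraically constant tensors with vanishing square and Nijenhuis tensor arise locally from
the affine bundle construction. -/
theorem Tensor11.exists_localRealization [T2Space M] (hconst : Θ.AlgebraicallyConstant)
    (hsq : ∀ (x : M) (ξ : TangentSpace (𝓡 n) x), Θ x (Θ x ξ) = 0) (hN : Θ.NijenhuisVanishes)
    (x : M) : ∃ R : LocalRealization.{u, 0} Θ, x ∈ R.φ.source ∧ IsConnected R.φ.source := by
  obtain ⟨m, r, χ₀, H₀, S, hn, hχ₀, hx₀, hH₀, hS₀⟩ := exists_isAdapted hconst hsq hN x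
  obtain ⟨χ₁, H₁, hχ₁, hx₁, hH₁, hS₁⟩ := hH₀.exists_rightInverse hχ₀ hN hx₀ hS₀
  obtain ⟨χ, G, T, hχ, hx, hconn, hsurj, hG, hT, hGT, hadapted⟩ :=
    hH₁.exists_normal_form hχ₁ hN hx₁ hS₁
  let L : EuclideanSpace ℝ (Fin n) ≃L[ℝ] EuclideanSpace ℝ (Fin m) × EuclideanSpace ℝ (Fin r) :=
    ContinuousLinearEquiv.ofFinrankEq (by simp [hn])
  let Ψ := L.symm.toHomeomorph.toOpenPartialHomeomorph
  have hΨ : ContDiffOn ℝ ∞ Ψ Ψ.source := L.symm.contDiff.contDiffOn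
  have hΨs : ContDiffOn ℝ ∞ Ψ.symm Ψ.target := L.contDiff.contDiffOn
  have hsource : (χ.trans Ψ).source = χ.source := by simp [Ψ]
  have hχΨ := hχ.trans hΨ hΨs
  have hmem : ∀ {z}, z ∈ (χ.trans Ψ).source ↔ z ∈ χ.source := fun {z} => by rw [hsource]
  have hconn' : IsConnected (χ.trans Ψ).source := hsource ▸ hconn
  have hD : ∀ z ∈ χ.source, ∀ ξ : TangentSpace (𝓡 n) z,
      coordD (χ.trans Ψ) z ξ = L.symm (coordD χ z ξ) := by
    intro z hz ξ
    rw [hχ.coordD_trans hΨ (hmem.2 hz)]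
    exact congrArg (fun A => A (coordD χ z ξ)) L.symm.fderiv
  refine ⟨{ baseDim := m, Base := EuclideanSpace ℝ (Fin m), dist := kernelDistribution hG hT hGT,
            bundle := kernelBundle hG hT hGT L, φ := χ.trans Ψ, smooth_φ := hχΨ.smooth,
            smooth_φ_symm := hχΨ.smooth_symm, meets_fibres := ?_, map_tensor := ?_ }, hmem.2 hx, hconn'⟩
  · intro y
    obtain ⟨z, hz, rfl⟩ := hsurj y
    refine ⟨z, hmem.2 hz, ?_⟩
    change (L (L.symm (χ z))).1 = _
    rw [L.apply_symm_apply]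
  · intro z hz ξ
    replace hz : z ∈ χ.source := hmem.1 hz
    refine (hD z hz _).trans ?_
    rw [hadapted z hz]
    refine Eq.trans ?_ (kernelBundle_tensor hG hT hGT L _ _).symm
    have h1 : ∀ a b : EuclideanSpace ℝ (Fin n), a = L.symm (χ z) → b = L.symm (coordD χ z ξ) →
        L.symm (0, G (χ z).1 (coordD χ z ξ).1) = L.symm (0, G (L a).1 (L b).1) := by
      rintro _ _ rfl rfl
      rw [L.apply_symm_apply, L.apply_symm_apply]
    exact h1 _ _ rfl (hD z hz ξ)

end Realization

end

/-! ### Coordinates on an arbitrary affine bundle. -/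

section

section

variable {n m : ℕ} {B : Type v} [TopologicalSpace B]
  [ChartedSpace (EuclideanSpace ℝ (Fin m)) B] [IsManifold (𝓡 m) ∞ B] {D : SmoothDistribution m B}

/-- Coordinates on the total space of an affine bundle built from coordinates on the base and a
local trivialization. -/
theorem AffineQuotientBundle.exists_coord (A : AffineQuotientBundle n D)
    {κ : OpenPartialHomeomorph B (EuclideanSpace ℝ (Fin m))} (hκ : IsSmoothCoord (n := m) κ) {y₀ : B}
    (hy₀ : y₀ ∈ κ.source) :
    ∃ (r : ℕ) (W : Set B)
      (ψ : OpenPartialHomeomorph A.Total (EuclideanSpace ℝ (Fin m) × EuclideanSpace ℝ (Fin r)))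
      (Q : ∀ y : B, TangentSpace (𝓡 m) y →L[ℝ] EuclideanSpace ℝ (Fin r)),
      y₀ ∈ W ∧ W ⊆ κ.source ∧ IsSmoothCoord (n := n) ψ ∧ ψ.source = A.proj ⁻¹' W ∧
      (∀ p ∈ ψ.source, (ψ p).1 = κ (A.proj p)) ∧
      (∀ y ∈ W, Function.Surjective (Q y) ∧ ∀ η, η ∈ D.space y ↔ Q y η = 0) ∧
      ∀ p ∈ ψ.source, ∀ ξ : TangentSpace (𝓡 n) p,
        coordD ψ p (A.tensor p ξ) = (0, Q (A.proj p) (mfderiv (𝓡 n) (𝓡 m) A.proj p ξ)) ∧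
        (coordD ψ p ξ).1 = coordD κ (A.proj p) (mfderiv (𝓡 n) (𝓡 m) A.proj p ξ) := by
  obtain ⟨r, W, s, X, e, hW, hy₀W, -, hX, hes, het, he, hes', hform⟩ := A.locally_trivial y₀
  -- `Q y η` lists the coefficients of the class of `η` in the frame given by the `X i`. It is
  -- chosen point by point, with no smoothness claimed.
  have hQ : ∀ y : B, ∃ Q : TangentSpace (𝓡 m) y →L[ℝ] EuclideanSpace ℝ (Fin r), y ∈ W →
      (Function.Surjective Q ∧ ∀ η, η ∈ D.space y ↔ Q η = 0) ∧
      ∀ η, (D.space y).mkQ η = ∑ i, Q η i • (D.space y).mkQ (X i y) := by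
    intro y
    by_cases hy : y ∈ W
    · let b : Module.Basis (Fin r) ℝ (D.Quot y) := Module.Basis.mk (hX y hy).1 (hX y hy).2.ge
      let j : D.Quot y ≃ₗ[ℝ] EuclideanSpace ℝ (Fin r) :=
        b.equivFun.trans (WithLp.linearEquiv 2 ℝ (Fin r → ℝ)).symm
      let Q₀ : EuclideanSpace ℝ (Fin m) →ₗ[ℝ] EuclideanSpace ℝ (Fin r) :=
        j.toLinearMap.comp (D.space y).mkQ
      let Q₁ : EuclideanSpace ℝ (Fin m) →L[ℝ] EuclideanSpace ℝ (Fin r) :=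
        LinearMap.toContinuousLinearMap Q₀
      refine ⟨Q₁, fun _ => ⟨⟨?_, fun η => ?_⟩, fun η => ?_⟩⟩
      · exact j.surjective.comp (Submodule.mkQ_surjective (D.space y))
      · refine Iff.trans ?_ (LinearEquiv.map_eq_zero_iff
          j).symm
        exact (Submodule.Quotient.mk_eq_zero _).symm
      · have h1 := (b.sum_equivFun ((D.space y).mkQ η)).symm
        simp only [b, Module.Basis.mk_apply] at h1
        exact h1
    · exact ⟨0, fun h => absurd h hy⟩
  choose Q hQ using hQ
  have hproj : ∀ p ∈ e.source, A.proj p = (e p).1 := by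
    intro p hp
    have h1 := e.map_source hp
    rw [het] at h1
    have h2 := hform (e p).1 h1.1 (e p).2
    rw [Prod.mk.eta, e.left_inv hp] at h2
    have h3 : ∀ (y : B) (q : {p : A.Total // A.proj p = y}), A.proj q = y := fun _ q => q.2
    exact (congrArg A.proj h2).trans (h3 _ _)
  let σ := κ.prod (OpenPartialHomeomorph.refl (EuclideanSpace ℝ (Fin r)))
  let ψ := e.trans σ
  have hψs : ψ.source = A.proj ⁻¹' (W ∩ κ.source) := by
    ext p
    simp only [ψ, σ, OpenPartialHomeomorph.trans_source, mem_inter_iff, mem_preimage,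
      OpenPartialHomeomorph.prod_source, OpenPartialHomeomorph.refl_source, mem_prod, mem_univ,
      and_true]
    constructor
    · rintro ⟨h1, h2⟩
      rw [hproj p h1]
      exact ⟨by rw [← hproj p h1]; exact (hes ▸ h1 : p ∈ A.proj ⁻¹' W), h2⟩
    · rintro ⟨h1, h2⟩
      have h3 : p ∈ e.source := by rw [hes]; exact h1
      exact ⟨h3, by rw [← hproj p h3]; exact h2⟩
  have hψa : ∀ p, ψ p = (κ (e p).1, (e p).2) := fun p => rfl
  have hψ : IsSmoothCoord (n := n) ψ := by
    refine ⟨?_, ?_⟩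
    · have h1 : ContMDiffOn (𝓡 n) ((𝓡 m).prod (𝓡 r)) ∞ e ψ.source := he.mono inter_subset_left
      exact (hκ.smooth.comp (contMDiff_fst.comp_contMDiffOn h1) fun p hp => hp.2.1).prodMk_space
        (contMDiff_snd.comp_contMDiffOn h1)
    · refine hes'.comp (t := e.target) ?_ fun p hp => hp.2
      exact (hκ.smooth_symm.comp contDiff_fst.contMDiff.contMDiffOn fun p hp => hp.1.1).prodMk
        contDiff_snd.contMDiff.contMDiffOn
  have hψp : ∀ p ∈ ψ.source, (ψ p).1 = κ (A.proj p) := fun p hp => by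
    rw [hψa, hproj p hp.1]
  have hprojd : ∀ p ∈ e.source, MDifferentiableAt (𝓡 n) (𝓡 m) A.proj p := by
    intro p hp
    have h1 : MDifferentiableAt (𝓡 n) (𝓡 m) (fun p => (e p).1) p :=
      (contMDiff_fst.contMDiffAt.comp p
        (he.contMDiffAt (e.open_source.mem_nhds hp))).mdifferentiableAt (by simp)
    refine h1.congr_of_eventuallyEq ?_
    filter_upwards [e.open_source.mem_nhds hp] with q hq using hproj q hq
  refine ⟨r, W ∩ κ.source, ψ, Q, ⟨hy₀W, hy₀⟩, inter_subset_right, hψ, hψs, hψp,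
    fun y hy => (hQ y hy.1).1, fun p hp ξ => ⟨?_, ?_⟩⟩
  · have hpW : A.proj p ∈ W := (hψs ▸ hp : p ∈ A.proj ⁻¹' (W ∩ κ.source)).1
    have hpκ : A.proj p ∈ κ.source := (hψs ▸ hp : p ∈ A.proj ⁻¹' (W ∩ κ.source)).2
    set η := mfderiv (𝓡 n) (𝓡 m) A.proj p ξ with hη
    set c := Q (A.proj p) η with hc
    set a := (e p).2 with ha
    -- In the trivialization the line `p + t [η]` is straight with velocity `(0, Q η)`. This yields
    -- both its differentiability and the value of `vertical`.
    have hline : ∀ t : ℝ, A.fibreLine p ((D.space (A.proj p)).mkQ η) t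
        = ψ.symm (κ (A.proj p), a + t • c) := by
      intro t
      have h1 : p = ((∑ i, a i • (D.space (A.proj p)).mkQ (X i (A.proj p))) +ᵥ s (A.proj p) :
          {p' : A.Total // A.proj p' = A.proj p}) := by
        rw [← hform _ hpW, hproj p hp.1, Prod.mk.eta, e.left_inv hp.1]
      have h2 : (⟨p, rfl⟩ : {p' : A.Total // A.proj p' = A.proj p}) =
          (∑ i, a i • (D.space (A.proj p)).mkQ (X i (A.proj p))) +ᵥ s (A.proj p) :=
        Subtype.ext h1
      rw [AffineQuotientBundle.fibreLine, h2, vadd_vadd, (hQ _ hpW).2 η]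
      change _ = e.symm (κ.symm (κ (A.proj p)), a + t • c)
      rw [κ.left_inv hpκ, hform _ hpW]
      congr 2
      simp only [PiLp.add_apply, PiLp.smul_apply, add_smul, Finset.sum_add_distrib, Finset.smul_sum,
        smul_assoc]
      exact add_comm _ _
    have htar : ∀ t : ℝ, (κ (A.proj p), a + t • c) ∈ ψ.target := by
      intro t
      refine ⟨⟨κ.map_source hpκ, trivial⟩, ?_⟩
      change (κ.symm (κ (A.proj p)), a + t • c) ∈ e.target
      rw [het, κ.left_inv hpκ]
      exact ⟨hpW, trivial⟩
    let γ : ℝ → EuclideanSpace ℝ (Fin m) × EuclideanSpace ℝ (Fin r) :=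
      fun t => (κ (A.proj p), a + t • c)
    have hγ : HasFDerivAt γ ((0 : ℝ →L[ℝ] EuclideanSpace ℝ (Fin m)).prod
        ((ContinuousLinearMap.id ℝ ℝ).smulRight c)) 0 :=
      (hasFDerivAt_const _ _).prodMk (((hasFDerivAt_id (0 : ℝ)).smul_const c).const_add a)
    have hline' : A.fibreLine p ((D.space (A.proj p)).mkQ η) = ψ.symm ∘ γ := funext hline
    have hfd : MDifferentiableAt 𝓘(ℝ, ℝ) (𝓡 n)
        (A.fibreLine p ((D.space (A.proj p)).mkQ η)) 0 := by
      rw [hline']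
      exact ((hψ.contMDiffAt_symm (htar 0)).mdifferentiableAt (by simp)).comp 0
        hγ.differentiableAt.mdifferentiableAt
    have hf0 : A.fibreLine p ((D.space (A.proj p)).mkQ η) 0 = p := by
      rw [AffineQuotientBundle.fibreLine, zero_smul, zero_vadd]
    have h3 : HasMFDerivAt (𝓡 n) 𝓘(ℝ, EuclideanSpace ℝ (Fin m) × EuclideanSpace ℝ (Fin r)) ψ
        (A.fibreLine p ((D.space (A.proj p)).mkQ η) 0) (coordD ψ p) := by
      rw [hf0]
      exact hψ.hasMFDerivAt hp
    have h4 := h3.comp 0 hfd.hasMFDerivAt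
    have h5 : (ψ ∘ A.fibreLine p ((D.space (A.proj p)).mkQ η)) = γ := by
      funext t
      rw [Function.comp_apply, hline t, ψ.right_inv (htar t)]
    rw [h5] at h4
    have h6 := hasMFDerivAt_unique h4 hγ.hasMFDerivAt
    refine (DFunLike.congr_fun h6 (1 : ℝ)).trans ?_
    change ((0 : EuclideanSpace ℝ (Fin m)), (1 : ℝ) • c) = _
    rw [one_smul]
  · have hpκ : A.proj p ∈ κ.source := (hψs ▸ hp : p ∈ A.proj ⁻¹' (W ∩ κ.source)).2
    have h1 := (hκ.hasMFDerivAt hpκ).comp p (hprojd p hp.1).hasMFDerivAt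
    have h2 : HasMFDerivAt (𝓡 n) 𝓘(ℝ, EuclideanSpace ℝ (Fin m)) (fun q => (ψ q).1) p
        ((ContinuousLinearMap.fst ℝ _ _).comp (coordD ψ p)) :=
      (hasFDerivAt_fst (𝕜 := ℝ) (p := ψ p)).hasMFDerivAt.comp p (hψ.hasMFDerivAt hp)
    have h3 : (fun q => (ψ q).1) =ᶠ[𝓝 p] κ ∘ A.proj := by
      filter_upwards [ψ.open_source.mem_nhds hp] with q hq using hψp q hq
    have h4 := hasMFDerivAt_unique h2 (h1.congr_of_eventuallyEq h3)
    exact DFunLike.congr_fun h4 ξ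

end

end

/-! ### Normal form of a realization, and the rank of its distribution. -/

section

variable {n : ℕ} {M : Type u} [TopologicalSpace M] [ChartedSpace (EuclideanSpace ℝ (Fin n)) M]
  [IsManifold (𝓡 n) ∞ M] {Θ : Tensor11 n M}

/-- Coordinates on the base of a realization extend to adapted coordinates of the tensor. -/
theorem LocalRealization.exists_isAdapted (R : LocalRealization.{u, v} Θ)
    {κ : OpenPartialHomeomorph R.Base (EuclideanSpace ℝ (Fin R.baseDim))}
    (hκ : IsSmoothCoord (n := R.baseDim) κ) {x₀ : M} (hx₀ : x₀ ∈ R.φ.source)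
    (hκx₀ : R.bundle.proj (R.φ x₀) ∈ κ.source) :
    ∃ (r : ℕ)
      (χ : OpenPartialHomeomorph M
        (EuclideanSpace ℝ (Fin R.baseDim) × EuclideanSpace ℝ (Fin r)))
      (G : EuclideanSpace ℝ (Fin R.baseDim) →
        EuclideanSpace ℝ (Fin R.baseDim) →L[ℝ] EuclideanSpace ℝ (Fin r))
      (Ω : Set (EuclideanSpace ℝ (Fin R.baseDim))),
      IsSmoothCoord (n := n) χ ∧ x₀ ∈ χ.source ∧ χ.source ⊆ R.φ.source ∧
      Θ.IsAdapted χ (fun p => G p.1) ∧ (χ x₀).1 = κ (R.bundle.proj (R.φ x₀)) ∧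
      IsOpen Ω ∧ (χ x₀).1 ∈ Ω ∧ ContDiffOn ℝ ∞ G Ω ∧
      (∀ u ∈ Ω, Function.Surjective (G u) ∧ (u, (χ x₀).2) ∈ χ.target) ∧
      Ω ⊆ κ.target ∧
      ∀ y ∈ κ.source, κ y ∈ Ω → ∀ η : TangentSpace (𝓡 R.baseDim) y,
        η ∈ R.dist.space y ↔ G (κ y) (coordD κ y η) = 0 := by
  obtain ⟨r, W, ψ, Q, hyW, hWκ, hψ, hψs, hψp, hQ, hψD⟩ := R.bundle.exists_coord hκ hκx₀
  set π₀ := R.bundle.proj with hπ₀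
  let χ := R.φ.trans ψ
  have hχ : IsSmoothCoord (n := n) χ :=
    ⟨hψ.smooth.comp (R.smooth_φ.mono inter_subset_left) fun _ hz => hz.2,
      R.smooth_φ_symm.comp (hψ.smooth_symm.mono inter_subset_left) fun _ hz => hz.2⟩
  have hD : ∀ z ∈ χ.source, ∀ ξ : TangentSpace (𝓡 n) z,
      coordD χ z ξ = coordD ψ (R.φ z) (mfderiv (𝓡 n) (𝓡 n) R.φ z ξ) := by
    intro z hz ξ
    have h1 := ((R.smooth_φ.contMDiffAt (R.φ.open_source.mem_nhds hz.1)).mdifferentiableAt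
      (by simp)).hasMFDerivAt
    exact DFunLike.congr_fun ((hψ.hasMFDerivAt hz.2).comp z h1).mfderiv ξ
  have hx₀χ : x₀ ∈ χ.source := by
    refine ⟨hx₀, ?_⟩
    rw [hψs]
    exact hyW
  have hW : ∀ z ∈ χ.source, π₀ (R.φ z) ∈ W := fun z hz => by
    have h1 : R.φ z ∈ ψ.source := hz.2
    rw [hψs] at h1
    exact h1
  have hχ1 : ∀ z ∈ χ.source, (χ z).1 = κ (π₀ (R.φ z)) := fun z hz => hψp _ hz.2
  let G : EuclideanSpace ℝ (Fin R.baseDim) →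
      EuclideanSpace ℝ (Fin R.baseDim) →L[ℝ] EuclideanSpace ℝ (Fin r) :=
    fun u => (Q (κ.symm u)).comp (coordD κ (κ.symm u)).inverse
  have hGκ : ∀ y ∈ κ.source, ∀ η, G (κ y) (coordD κ y η) = Q y η := by
    intro y hy η
    simp only [G, ContinuousLinearMap.comp_apply]
    rw [κ.left_inv hy, hκ.inverse_coordD hy]
  have hadapted : Θ.IsAdapted χ (fun p => G p.1) := by
    intro z hz ξ
    have h1 := hψD (R.φ z) hz.2 (mfderiv (𝓡 n) (𝓡 n) R.φ z ξ)
    rw [hD z hz, R.map_tensor z hz.1, h1.1]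
    beta_reduce
    rw [hχ1 z hz, hD z hz, h1.2, hGκ _ (hWκ (hW z hz))]
  -- A horizontal slice of the coordinate domain through `x₀`; each of its points lies over some `y
  -- ∈ W`, so statements about `G` become statements about `Q`.
  let Ω := (fun u => (u, (χ x₀).2)) ⁻¹' χ.target
  have hΩ : IsOpen Ω := χ.open_target.preimage (by fun_prop)
  have hΩW : ∀ u ∈ Ω, ∃ y ∈ W, κ y = u := by
    intro u hu
    have hz := χ.map_target hu
    refine ⟨_, hW _ hz, ?_⟩
    rw [← hχ1 _ hz, χ.right_inv hu]
  refine ⟨r, χ, G, Ω, hχ, hx₀χ, inter_subset_left, hadapted, hχ1 _ hx₀χ, hΩ, χ.map_source hx₀χ,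
    ?_, fun u hu => ⟨?_, hu⟩, ?_, ?_⟩
  -- Smoothness of `G` is inherited from `Θ`, of which it is a block on the slice.
  · exact (hadapted.contDiffOn hχ).comp (contDiff_id.prodMk contDiff_const).contDiffOn
      fun u hu => hu
  · obtain ⟨y, hy, rfl⟩ := hΩW u hu
    intro e
    obtain ⟨η, rfl⟩ := (hQ y hy).1 e
    exact ⟨coordD κ y η, hGκ y (hWκ hy) η⟩
  · intro u hu
    obtain ⟨y, hy, rfl⟩ := hΩW u hu
    exact κ.map_source (hWκ hy)
  · intro y hy hu η
    obtain ⟨y', hy', h⟩ := hΩW _ hu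
    obtain rfl : y' = y := κ.injOn (hWκ hy') hy h
    rw [hGκ y' hy, (hQ y' hy').2]

/-- The fibre dimension of the distribution of a realization. -/
theorem LocalRealization.finrank_dist (R : LocalRealization.{u, v} Θ)
    (hconst : Θ.AlgebraicallyConstant)
    (hsq : ∀ (x : M) (ξ : TangentSpace (𝓡 n) x), Θ x (Θ x ξ) = 0) (x : M) (y : R.Base) :
    Module.finrank ℝ (R.dist.space y) = Θ.codimImKer x := by
  obtain ⟨x₀, hx₀, rfl⟩ := R.meets_fibres y
  set y := R.bundle.proj (R.φ x₀) with hy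
  set κ := chartAt (EuclideanSpace ℝ (Fin R.baseDim)) y with hκ'
  have hκ : IsSmoothCoord (n := R.baseDim) κ :=
    isSmoothCoord_of_mem_maximalAtlas (IsManifold.chart_mem_maximalAtlas y)
  have hyκ : y ∈ κ.source := mem_chart_source _ _
  obtain ⟨r, χ, G, Ω, hχ, hx₀χ, -, had, hχ1, -, hΩ, -, hG, -, hker⟩ :=
    R.exists_isAdapted hκ hx₀ hyκ
  have hGs := (hG _ hΩ).1
  rw [hχ1] at hGs hΩ
  -- With `m` the base dimension, `dim D = m - r`, `n = m + r` and `rank Θ = r`, so `dim Ker Θ = m`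
  -- and the codimension is `m - r`. Constancy of the rank passes from `x₀` to an arbitrary `x`.
  have h1 : Module.finrank ℝ (R.dist.space y) + r = R.baseDim := by
    let f : EuclideanSpace ℝ (Fin R.baseDim) →ₗ[ℝ] EuclideanSpace ℝ (Fin r) :=
      ((G (κ y)).comp (coordD κ y)).toLinearMap
    have hf : Function.Surjective f := fun e => by
      obtain ⟨v, rfl⟩ := hGs e
      exact ⟨(coordD κ y).inverse v, congrArg (G (κ y)) (hκ.coordD_inverse hyκ v)⟩
    have hfk : R.dist.space y = LinearMap.ker f := Submodule.ext fun η => hker y hyκ hΩ η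
    have h2 := f.finrank_range_add_finrank_ker
    rw [LinearMap.range_eq_top.2 hf, finrank_top, finrank_euclideanSpace_fin,
      finrank_euclideanSpace_fin] at h2
    have h3 : Module.finrank ℝ (R.dist.space y) = Module.finrank ℝ (LinearMap.ker f) := by
      rw [hfk]
      rfl
    omega
  have h2 : n = R.baseDim + r := by
    have h3 := (hχ.mdifferentiable.mfderiv hx₀χ).toLinearEquiv.finrank_eq
    have h4 : Module.finrank ℝ (TangentSpace (𝓡 n) x₀) = n := finrank_euclideanSpace_fin
    have h5 : Module.finrank ℝ (TangentSpace 𝓘(ℝ, EuclideanSpace ℝ (Fin R.baseDim) ×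
        EuclideanSpace ℝ (Fin r)) (χ x₀)) = R.baseDim + r := by
      refine (Module.finrank_prod (R := ℝ)).trans ?_
      rw [finrank_euclideanSpace_fin, finrank_euclideanSpace_fin]
    omega
  have h3 : Module.finrank ℝ (Θ x).range = r := by
    rw [hconst.finrank_range_eq x x₀, hχ.finrank_range_coord Θ hx₀χ]
    have h4 : (Θ.coord χ (χ x₀)).range =
        LinearMap.range (LinearMap.inr ℝ (EuclideanSpace ℝ (Fin R.baseDim))
          (EuclideanSpace ℝ (Fin r))) := by
      ext p
      constructor
      · rintro ⟨v, rfl⟩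
        exact ⟨G (χ x₀).1 v.1, (had.coord_apply hχ (χ.map_source hx₀χ) v).symm⟩
      · rintro ⟨e, rfl⟩
        obtain ⟨f, rfl⟩ := hGs e
        refine ⟨(f, 0), (had.coord_apply hχ (χ.map_source hx₀χ) _).trans ?_⟩
        rw [hχ1]
        rfl
    rw [h4, LinearMap.finrank_range_of_inj LinearMap.inr_injective, finrank_euclideanSpace_fin]
  have : FiniteDimensional ℝ (TangentSpace (𝓡 n) x) :=
    inferInstanceAs (FiniteDimensional ℝ (EuclideanSpace ℝ (Fin n)))
  have h4 := (Θ x).toLinearMap.finrank_range_add_finrank_ker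
  have h5 : (Θ x).range ≤ (Θ x).ker := by
    rintro - ⟨ξ, rfl⟩
    exact hsq x ξ
  have h6 := Submodule.finrank_quotient_add_finrank ((Θ x).range.submoduleOf (Θ x).ker)
  have h7 := (Submodule.submoduleOfEquivOfLe h5).finrank_eq
  have h8 : Module.finrank ℝ (TangentSpace (𝓡 n) x) = n := finrank_euclideanSpace_fin
  rw [Tensor11.codimImKer]
  omega

end

/-! ### An integrable tensor has integrable distributions. -/

section

variable {n : ℕ} {M : Type u} [TopologicalSpace M] [ChartedSpace (EuclideanSpace ℝ (Fin n)) M]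
  [IsManifold (𝓡 n) ∞ M] {Θ : Tensor11 n M}

/-- The kernel of a parallel tensor is closed under brackets. -/
lemma Tensor11.IsIntegrableOn.tensor_mlieBracket_eq_zero {U : Set M} (hΘ : Θ.IsIntegrableOn U)
    (hU : IsOpen U) {x : M} (hx : x ∈ U) {X Y : ∀ z : M, TangentSpace (𝓡 n) z}
    (hX : FieldDifferentiableAt X x) (hY : FieldDifferentiableAt Y x)
    (hΘX : ∀ᶠ z in 𝓝 x, Θ z (X z) = 0) (hΘY : ∀ᶠ z in 𝓝 x, Θ z (Y z) = 0) :
    Θ x (VectorField.mlieBracket (𝓡 n) X Y x) = 0 := by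
  obtain ⟨conn, hconn, -, htor, hpar⟩ := hΘ
  -- If `ΘX = 0` near `x`, then `Θ(∇X) = ∇(ΘX) = 0` at `x`; vanishing torsion writes the bracket as
  -- a difference of two such terms.
  have key : ∀ {X : ∀ z : M, TangentSpace (𝓡 n) z}, FieldDifferentiableAt X x →
      (∀ᶠ z in 𝓝 x, Θ z (X z) = 0) → ∀ ξ, Θ x (conn X x ξ) = 0 := by
    intro X hX hΘX ξ
    rw [← hpar x hx X hX ξ]
    have h0 : FieldDifferentiableAt (0 : ∀ z : M, TangentSpace (𝓡 n) z) x :=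
      Bundle.mdifferentiableAt_zeroSection ..
    have h1 := hconn.congr_of_eventuallyEq (IsSmoothCoord.fieldDifferentiableAt_tensor Θ hX) h0
      (hU.mem_nhds hx) hΘX
    rw [h1, hconn.zero hx]
    rfl
  rw [← htor x hx X Y hX hY, map_sub, key hY hΘY, key hX hΘX, sub_zero]

/-- If the tensor is integrable, so is the distribution of any realization. -/
theorem LocalRealization.isIntegrable_dist (R : LocalRealization.{u, v} Θ) {U : Set M}
    (hΘ : Θ.IsIntegrableOn U) (hU : IsOpen U) (hRU : R.φ.source ⊆ U) : R.dist.IsIntegrable := by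
  intro y
  obtain ⟨x₀, hx₀, rfl⟩ := R.meets_fibres y
  set y := R.bundle.proj (R.φ x₀) with hy
  set κ := chartAt (EuclideanSpace ℝ (Fin R.baseDim)) y with hκ'
  have hκ : IsSmoothCoord (n := R.baseDim) κ :=
    isSmoothCoord_of_mem_maximalAtlas (IsManifold.chart_mem_maximalAtlas y)
  have hyκ : y ∈ κ.source := mem_chart_source _ _
  obtain ⟨r, χ, G, Ω, hχ, hx₀χ, hχU, had, hχ1, hΩ, hu₀, hG, hGs, -, hker⟩ :=
    R.exists_isAdapted hκ hx₀ hyκ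
  obtain ⟨Φ, hΦ₀, hΦΩ, hΦ, hΦs, F, hF⟩ := exists_straightening_ker hG hΩ hu₀ (hGs _ hu₀).1 (by
    intro u hu η₁ η₂ hη₁ hη₂ h₁ h₂
    set z := χ.symm (u, (χ x₀).2) with hz'
    have hp := (hGs u hu).2
    have hz : z ∈ χ.source := χ.map_target hp
    have hχz : χ z = (u, (χ x₀).2) := χ.right_inv hp
    -- A field `η` on the base lifts to `(η, 0)`, which `Θ` kills wherever `G η = 0`. The bracket of
    -- two lifts has first component the bracket on the base, so closure of `Ker Θ` is involutivity
    -- of `ker G`.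
    let X : (EuclideanSpace ℝ (Fin R.baseDim) → EuclideanSpace ℝ (Fin R.baseDim)) →
      EuclideanSpace ℝ (Fin R.baseDim) × EuclideanSpace ℝ (Fin r) →
      EuclideanSpace ℝ (Fin R.baseDim) × EuclideanSpace ℝ (Fin r) := fun η p => (η p.1, 0)
    have hX : ∀ {η}, DifferentiableAt ℝ η u →
        HasFDerivAt (X η) (((fderiv ℝ η u).comp (ContinuousLinearMap.fst ℝ _ _)).prod 0) (χ z) := by
      intro η hη
      rw [hχz]
      exact (HasFDerivAt.comp (u, (χ x₀).2) hη.hasFDerivAt hasFDerivAt_fst).prodMk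
        (hasFDerivAt_const _ _)
    have hΘX : ∀ {η}, (∀ᶠ y in 𝓝 u, G y (η y) = 0) →
        ∀ᶠ w in 𝓝 z, Θ w (coordField χ (X η) w) = 0 := by
      intro η hη
      have hc : Tendsto (fun w => (χ w).1) (𝓝 z) (𝓝 u) := by
        have h3 : Tendsto (fun w => (χ w).1) (𝓝 z) (𝓝 (χ z).1) :=
          continuous_fst.continuousAt.comp (χ.continuousAt hz)
        rwa [hχz] at h3
      filter_upwards [hc.eventually hη, χ.open_source.mem_nhds hz] with w hw hws
      refine hχ.coordD_injective hws ?_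
      rw [had w hws, hχ.coordD_coordField hws, map_zero]
      exact Prod.ext rfl hw
    have h3 := hΘ.tensor_mlieBracket_eq_zero hU (hRU (hχU hz))
      (hχ.fieldDifferentiableAt_coordField hz (hX hη₁).differentiableAt)
      (hχ.fieldDifferentiableAt_coordField hz (hX hη₂).differentiableAt) (hΘX h₁) (hΘX h₂)
    have h4 := congrArg (coordD χ z) h3
    rw [had z hz, hχ.coordD_mlieBracket_coordField hz (hX hη₁).differentiableAt
      (hX hη₂).differentiableAt, (hX hη₁).fderiv, (hX hη₂).fderiv, map_zero, hχz] at h4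
    exact congrArg Prod.snd h4)
  rw [hχ1] at hΦ₀
  have hκΦ := hκ.trans hΦ hΦs
  refine ⟨κ.trans Φ, (κ.trans Φ).mem_maximalAtlas_of_contMDiffOn hκΦ.smooth
    hκΦ.smooth_symm, ⟨hyκ, hΦ₀⟩, F, fun y' hy' η => ?_⟩
  have h1 : chartDifferential (κ.trans Φ) y' η = fderiv ℝ Φ (κ y') (coordD κ y' η) :=
    hκ.coordD_trans hΦ hy' η
  rw [h1]
  exact (hker y' hy'.1 (hΦΩ hy'.2) η).trans (hF (κ y') hy'.2 _)

end

/-! ### Flat connections for tensors constant in coordinates. -/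

section

variable {n : ℕ} {M : Type u} [TopologicalSpace M] [ChartedSpace (EuclideanSpace ℝ (Fin n)) M]

/-- A family of linear maps on a finite-dimensional space is smooth if its values at fixed vectors
are. -/
lemma ContMDiffAt.of_clm_apply {E F : Type*} [NormedAddCommGroup E] [NormedSpace ℝ E]
    [FiniteDimensional ℝ E] [NormedAddCommGroup F] [NormedSpace ℝ F] {f : M → E →L[ℝ] F} {x : M}
    (hf : ∀ v, ContMDiffAt (𝓡 n) 𝓘(ℝ, F) ∞ (fun z => f z v) x) :
    ContMDiffAt (𝓡 n) 𝓘(ℝ, E →L[ℝ] F) ∞ f x := by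
  let b := Module.finBasis ℝ E
  have h1 : f = fun z => ∑ i, ContinuousLinearMap.smulRightL ℝ E F
      (LinearMap.toContinuousLinearMap (b.coord i)) (f z (b i)) := by
    funext z
    ext v
    have h2 := congrArg (f z) (b.sum_repr v)
    simp only [map_sum, map_smul] at h2
    rw [← h2]
    simp
  rw [h1]
  exact contMDiffAt_finsetSum fun i _ =>
    (ContinuousLinearMap.contDiff _).contMDiff.contMDiffAt.comp x (hf (b i))

variable [IsManifold (𝓡 n) ∞ M]

/-- A field of endomorphisms of the tangent spaces is smooth if it sends smooth vector fields to
smooth vector fields. -/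
lemma contMDiffAt_endomorphism {A : ∀ z : M, TangentSpace (𝓡 n) z →L[ℝ] TangentSpace (𝓡 n) z}
    {x : M} (hA : ∀ X : ∀ z : M, TangentSpace (𝓡 n) z,
      ContMDiffAt (𝓡 n) (𝓡 n).tangent ∞ (fun z => (⟨z, X z⟩ : TangentBundle (𝓡 n) M)) x →
      ContMDiffAt (𝓡 n) (𝓡 n).tangent ∞ (fun z => (⟨z, A z (X z)⟩ : TangentBundle (𝓡 n) M)) x) :
    ContMDiffAt (𝓡 n)
      ((𝓡 n).prod 𝓘(ℝ, EuclideanSpace ℝ (Fin n) →L[ℝ] EuclideanSpace ℝ (Fin n))) ∞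
      (fun z => (⟨z, A z⟩ : Bundle.TotalSpace (EuclideanSpace ℝ (Fin n) →L[ℝ] EuclideanSpace ℝ (Fin n))
        fun z : M => TangentSpace (𝓡 n) z →L[ℝ] TangentSpace (𝓡 n) z)) x := by
  rw [contMDiffAt_hom_bundle]
  refine ⟨contMDiffAt_id, ContMDiffAt.of_clm_apply fun v => ?_⟩
  set e := trivializationAt (EuclideanSpace ℝ (Fin n)) (TangentSpace (𝓡 n)) x with he
  have hx : x ∈ e.baseSet := FiberBundle.mem_baseSet_trivializationAt' x
  -- Fields constant in the trivialization detect the columns of the local matrix of `A`.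
  have hX : ContMDiffAt (𝓡 n) (𝓡 n).tangent ∞
      (fun z => (⟨z, e.symm z v⟩ : TangentBundle (𝓡 n) M)) x := by
    have h1 : ContMDiffAt (𝓡 n) ((𝓡 n).prod (𝓡 n)) ∞ (fun z : M => (z, v)) x :=
      contMDiffAt_id.prodMk contMDiffAt_const
    have h2 := (e.contMDiffOn_symm (IB := 𝓡 n) (n := ∞)).contMDiffAt
      (e.open_target.mem_nhds (e.mk_mem_target.2 hx : (x, v) ∈ e.target))
    refine (h2.comp x h1).congr_of_eventuallyEq ?_
    filter_upwards [e.open_baseSet.mem_nhds hx] with z hz using e.mk_symm hz v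
  have h3 := (Bundle.contMDiffAt_section x).1 (hA _ hX)
  refine h3.congr_of_eventuallyEq ?_
  filter_upwards [e.open_baseSet.mem_nhds hx] with z hz
  rw [ContinuousLinearMap.inCoordinates_eq hz hz]
  simp only [ContinuousLinearMap.comp_apply]
  rfl

/-- A tensor which is constant in suitable coordinates is integrable. -/
theorem Tensor11.isIntegrableOn_of_constant {V : Type v} [NormedAddCommGroup V] [NormedSpace ℝ V]
    [FiniteDimensional ℝ V] {Θ : Tensor11 n M} {χ : OpenPartialHomeomorph M V}
    (hχ : IsSmoothCoord (n := n) χ) {T : V →L[ℝ] V}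
    (hT : ∀ z ∈ χ.source, ∀ ξ : TangentSpace (𝓡 n) z, coordD χ z (Θ z ξ) = T (coordD χ z ξ)) :
    Θ.IsIntegrableOn χ.source := by
  -- The flat connection of `V`, transported by `χ`; its values outside `χ.source` play no role.
  let conn : (∀ x : M, TangentSpace (𝓡 n) x) →
      (∀ x : M, TangentSpace (𝓡 n) x →L[ℝ] TangentSpace (𝓡 n) x) := fun Y x =>
    (coordD χ x).inverse.comp ((fderiv ℝ (coordExpr χ Y) (χ x)).comp (coordD χ x))
  have hconn : ∀ x ∈ χ.source, ∀ Y ξ, coordD χ x (conn Y x ξ) =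
      fderiv ℝ (coordExpr χ Y) (χ x) (coordD χ x ξ) := fun x hx Y ξ =>
    hχ.coordD_inverse hx _
  refine ⟨conn, ⟨?_, ?_⟩, ⟨?_⟩, ?_, ?_⟩
  · intro Y Y' x hY hY' hx
    have h1 : coordExpr χ (Y + Y') = coordExpr χ Y + coordExpr χ Y' := by
      funext p
      exact map_add (coordD χ (χ.symm p)) _ _
    ext1 ξ
    refine hχ.coordD_injective hx ?_
    rw [hconn x hx, h1, fderiv_add (hχ.differentiableAt_coordExpr hx hY)
      (hχ.differentiableAt_coordExpr hx hY')]
    have h2 : (conn Y x + conn Y' x) ξ = conn Y x ξ + conn Y' x ξ := rfl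
    rw [h2, map_add, hconn x hx, hconn x hx]
    rfl
  · intro Y g x hY hg hx
    have h1 : coordExpr χ (g • Y) = fun p => (g ∘ χ.symm) p • coordExpr χ Y p := by
      funext p
      exact map_smul (coordD χ (χ.symm p)) _ _
    have h2 : MDifferentiableAt 𝓘(ℝ, V) 𝓘(ℝ, ℝ) (g ∘ χ.symm) (χ x) :=
      MDifferentiableAt.comp (g := g) (χ x) (by rwa [χ.left_inv hx])
        ((hχ.contMDiffAt_symm (χ.map_source hx)).mdifferentiableAt (by simp))
    have h3 : DifferentiableAt ℝ (g ∘ χ.symm) (χ x) := h2.differentiableAt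
    have h4 : mfderiv (𝓡 n) 𝓘(ℝ, ℝ) g x = (fderiv ℝ (g ∘ χ.symm) (χ x)).comp (coordD χ x) := by
      have h5 := h3.hasFDerivAt.hasMFDerivAt.comp x (hχ.hasMFDerivAt hx)
      refine (h5.congr_of_eventuallyEq ?_).mfderiv
      filter_upwards [χ.open_source.mem_nhds hx] with y hy
      simp [χ.left_inv hy]
    ext1 ξ
    refine hχ.coordD_injective hx ?_
    rw [hconn x hx, h1, fderiv_fun_smul h3 (hχ.differentiableAt_coordExpr hx hY)]
    have h6 : coordExpr χ Y (χ x) = coordD χ x (Y x) := by rw [coordExpr, χ.left_inv hx]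
    have h7 : mvfderiv (𝓡 n) g x ξ = fderiv ℝ (g ∘ χ.symm) (χ x) (coordD χ x ξ) :=
      DFunLike.congr_fun h4 ξ
    have h8 : (g ∘ χ.symm) (χ x) = g x := congrArg g (χ.left_inv hx)
    have h9 : (g x • conn Y x + (mvfderiv (𝓡 n) g x).smulRight (Y x)) ξ =
      g x • conn Y x ξ + mvfderiv (𝓡 n) g x ξ • Y x := rfl
    rw [h9, map_add, map_smul, map_smul, hconn x hx, h7, h8, h6]
    rfl
  · intro σ hσ x hx
    refine ContMDiffAt.contMDiffWithinAt (contMDiffAt_endomorphism fun X hX => ?_)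
    have hσ' : ∀ p ∈ χ.target, ContDiffAt ℝ ∞ (coordExpr χ σ) p := by
      intro p hp
      have hz := χ.map_target hp
      have h1 := (hχ.contMDiffAt_field_iff hz).1 ((hσ _ hz).contMDiffAt
        (χ.open_source.mem_nhds hz))
      exact (h1.comp p (hχ.contMDiffAt_symm hp)).contDiffAt
    have hσ'' : ContDiffOn ℝ ∞ (coordExpr χ σ) χ.target := fun p hp =>
      (hσ' p hp).contDiffWithinAt
    have h1 := ((hσ''.fderiv_of_isOpen (m := ∞) χ.open_target (by simp)).contDiffAt
      (χ.open_target.mem_nhds (χ.map_source hx))).contMDiffAt.comp x (hχ.contMDiffAt hx)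
    rw [hχ.contMDiffAt_field_iff hx] at hX ⊢
    refine (h1.clm_apply hX).congr_of_eventuallyEq ?_
    filter_upwards [χ.open_source.mem_nhds hx] with y hy using hconn y hy σ (X y)
  · intro x hx X Y hX hY
    refine hχ.coordD_injective hx ?_
    rw [map_sub, hconn x hx, hconn x hx, hχ.coordD_mlieBracket hx hX hY]
  · intro x hx Y hY ξ
    refine hχ.coordD_injective hx ?_
    have h1 : coordExpr χ (fun z => Θ z (Y z)) =ᶠ[𝓝 (χ x)] fun p => T (coordExpr χ Y p) := by
      filter_upwards [χ.open_target.mem_nhds (χ.map_source hx)] with p hp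
      exact hT _ (χ.map_target hp) _
    rw [hT x hx, hconn x hx, hconn x hx, h1.fderiv_eq]
    have h2 := T.hasFDerivAt.comp (χ x) (hχ.differentiableAt_coordExpr hx hY).hasFDerivAt
    exact DFunLike.congr_fun h2.fderiv _

end

/-! ### An integrable distribution makes the tensor locally integrable. -/

section

/-- The local diffeomorphism applying a smooth family of invertible maps in the second factor. -/
lemma exists_fibrewise_inverse {F E : Type*} [NormedAddCommGroup F] [NormedSpace ℝ F]
    [NormedAddCommGroup E] [NormedSpace ℝ E] {K K' : F → E →L[ℝ] E} {Ω : Set F} (hΩ : IsOpen Ω)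
    (hK : ContDiffOn ℝ ∞ K Ω) (hK' : ContDiffOn ℝ ∞ K' Ω) (h₁ : ∀ u ∈ Ω, ∀ c, K u (K' u c) = c)
    (h₂ : ∀ u ∈ Ω, ∀ c, K' u (K u c) = c) :
    ∃ Φ : OpenPartialHomeomorph (F × E) (F × E), Φ.source = Ω ×ˢ univ ∧
      ContDiffOn ℝ ∞ Φ Φ.source ∧ ContDiffOn ℝ ∞ Φ.symm Φ.target ∧
      ∀ p ∈ Φ.source, (∀ v, (fderiv ℝ Φ p v).1 = v.1) ∧
        ∀ c, fderiv ℝ Φ p (0, c) = (0, K' p.1 c) := by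
  have hsm : ∀ {K : F → E →L[ℝ] E}, ContDiffOn ℝ ∞ K Ω →
      ContDiffOn ℝ ∞ (fun p : F × E => (p.1, K p.1 p.2)) (Ω ×ˢ univ) := fun hK =>
    contDiff_fst.contDiffOn.prodMk ((hK.comp contDiff_fst.contDiffOn fun p hp => hp.1).clm_apply
      contDiff_snd.contDiffOn)
  let Φ : OpenPartialHomeomorph (F × E) (F × E) :=
    { toFun := fun p => (p.1, K' p.1 p.2)
      invFun := fun p => (p.1, K p.1 p.2)
      source := Ω ×ˢ univ
      target := Ω ×ˢ univ
      map_source' := fun p hp => ⟨hp.1, trivial⟩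
      map_target' := fun p hp => ⟨hp.1, trivial⟩
      left_inv' := fun p hp => Prod.ext rfl (h₁ p.1 hp.1 p.2)
      right_inv' := fun p hp => Prod.ext rfl (h₂ p.1 hp.1 p.2)
      open_source := hΩ.prod isOpen_univ
      open_target := hΩ.prod isOpen_univ
      continuousOn_toFun := (hsm hK').continuousOn
      continuousOn_invFun := (hsm hK).continuousOn }
  refine ⟨Φ, rfl, hsm hK', hsm hK, fun p hp => ?_⟩
  have hd : HasFDerivAt Φ (fderiv ℝ Φ p) p :=
    (((hsm hK').contDiffAt (Φ.open_source.mem_nhds hp)).differentiableAt (by simp)).hasFDerivAt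
  refine ⟨fun v => ?_, fun c => ?_⟩
  · have h1 : HasFDerivAt (fun q => (Φ q).1) _ p := hd.fst
    exact DFunLike.congr_fun (h1.unique hasFDerivAt_fst) v
  · have h1 : HasFDerivAt (fun e : E => Φ (p.1, e)) _ p.2 :=
      HasFDerivAt.comp (f := fun e => (p.1, id e)) p.2 (g := Φ) (by exact hd)
        ((hasFDerivAt_const p.1 p.2).prodMk (hasFDerivAt_id p.2))
    have h2 : HasFDerivAt (fun e : E => Φ (p.1, e))
        ((0 : E →L[ℝ] F).prod (K' p.1)) p.2 :=
      (hasFDerivAt_const p.1 p.2).prodMk (K' p.1).hasFDerivAt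
    exact DFunLike.congr_fun (h1.unique h2) c

variable {n : ℕ} {M : Type u} [TopologicalSpace M] [ChartedSpace (EuclideanSpace ℝ (Fin n)) M]
  [IsManifold (𝓡 n) ∞ M] {Θ : Tensor11 n M}

/-- If the distribution of a realization is integrable, the tensor is integrable near each point of
its domain. -/
theorem LocalRealization.exists_isIntegrableOn (R : LocalRealization.{u, v} Θ)
    (hD : R.dist.IsIntegrable) {x₀ : M} (hx₀ : x₀ ∈ R.φ.source) :
    ∃ W : Set M, IsOpen W ∧ x₀ ∈ W ∧ W ⊆ R.φ.source ∧ Θ.IsIntegrableOn W := by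
  obtain ⟨κ, hκ', hyκ, F, hF⟩ := hD (R.bundle.proj (R.φ x₀))
  have hκ : IsSmoothCoord (n := R.baseDim) κ := isSmoothCoord_of_mem_maximalAtlas hκ'
  obtain ⟨r, χ, G, Ω, hχ, hx₀χ, hχφ, had, hχ1, hΩ, hu₀, hG, hGs, hΩκ, hker⟩ :=
    R.exists_isAdapted hκ hx₀ hyκ
  set u₀ := (χ x₀).1 with hu₀'
  have hGF : ∀ u ∈ Ω, ∀ v, G u v = 0 ↔ v ∈ F := by
    intro u hu v
    have hy := κ.map_target (hΩκ hu)
    have hκy := κ.right_inv (hΩκ hu)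
    have h1 := hker _ hy (by rwa [hκy]) ((coordD κ (κ.symm u)).inverse v)
    rw [hκ.coordD_inverse hy, hκy] at h1
    rw [← h1, hF _ hy]
    have h2 : chartDifferential κ (κ.symm u) ((coordD κ (κ.symm u)).inverse v) = v :=
      hκ.coordD_inverse hy v
    rw [h2]
  obtain ⟨S, hS⟩ := LinearMap.exists_clm_rightInverse (hGs u₀ hu₀).1
  let K : EuclideanSpace ℝ (Fin R.baseDim) →
    EuclideanSpace ℝ (Fin r) →L[ℝ] EuclideanSpace ℝ (Fin r) := fun u => (G u).comp S
  have hK : ContDiffOn ℝ ∞ K Ω := hG.clm_comp contDiffOn_const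
  have hK₀ : K u₀ = ContinuousLinearMap.id ℝ _ := ContinuousLinearMap.ext hS
  -- All `G u` have kernel `F`, which contains `v - S (G u₀ v)`; hence `G u` factors through `G u₀`.
  have hGK : ∀ u ∈ Ω, ∀ v, G u v = K u (G u₀ v) := by
    intro u hu v
    have h1 : v - S (G u₀ v) ∈ F := by
      rw [← hGF u₀ hu₀, map_sub, hS, sub_self]
    rw [← hGF u hu, map_sub, sub_eq_zero] at h1
    exact h1
  obtain ⟨Ω', hΩ'Ω, hΩ', hu₀Ω', hK', hinv⟩ := hK.exists_inverse hΩ hu₀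
    (by rw [hK₀]; exact ⟨ContinuousLinearEquiv.refl ℝ _, rfl⟩)
  obtain ⟨Φ, hΦsource, hΦ, hΦs, hΦd⟩ := exists_fibrewise_inverse hΩ' (hK.mono hΩ'Ω) hK'
    (fun u hu => (hinv u hu).1) (fun u hu => (hinv u hu).2)
  refine ⟨(χ.trans Φ).source, (χ.trans Φ).open_source, ⟨hx₀χ, ?_⟩,
    inter_subset_left.trans hχφ, ?_⟩
  · have h1 : χ x₀ ∈ Φ.source := by
      rw [hΦsource]
      exact ⟨hu₀Ω', trivial⟩
    exact h1
  -- `Φ` turns `(0, K u (G u₀ f))` into `(0, G u₀ f)`. Its derivative on horizontal vectors may also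
  -- have a vertical part, but `Θ` ignores it.
  · refine Tensor11.isIntegrableOn_of_constant (hχ.trans hΦ hΦs)
      (T := (ContinuousLinearMap.inr ℝ _ _).comp ((G u₀).comp (ContinuousLinearMap.fst ℝ _ _)))
      fun z hz ξ => ?_
    have hzΦ : χ z ∈ Φ.source := hz.2
    have hzΩ : (χ z).1 ∈ Ω' := by
      rw [hΦsource] at hzΦ
      exact hzΦ.1
    rw [hχ.coordD_trans hΦ hz, hχ.coordD_trans hΦ hz, had z hz.1, (hΦd _ hzΦ).2,
      hGK _ (hΩ'Ω hzΩ), (hinv _ hzΩ).2]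
    refine Prod.ext rfl ?_
    exact congrArg (G u₀) ((hΦd _ hzΦ).1 _).symm

end

/-! ### Gluing local connections. -/

section

variable {n : ℕ} {M : Type u} [TopologicalSpace M] [ChartedSpace (EuclideanSpace ℝ (Fin n)) M]
  [IsManifold (𝓡 n) ∞ M] [T2Space M] [SecondCountableTopology M]

/-- A smooth partition of unity on an open subset, extended by zero. -/
lemma exists_partition_of_unity_on_open {U : Set M} (hU : IsOpen U) {W : M → Set M}
    (hW : ∀ x ∈ U, IsOpen (W x) ∧ x ∈ W x) :
    ∃ g : U → M → ℝ, ∀ x ∈ U, ∃ I : Finset U, (∀ i ∈ I, x ∈ W i) ∧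
      (∀ᶠ y in 𝓝 x, ∀ i ∉ I, g i y = 0) ∧
      (∀ i ∈ I, ContMDiffAt (𝓡 n) 𝓘(ℝ, ℝ) ∞ (g i) x) ∧ ∑ i ∈ I, g i x = 1 := by
  classical
  let O : TopologicalSpace.Opens M := ⟨U, hU⟩
  have : LocallyCompactSpace M := ChartedSpace.locallyCompactSpace (EuclideanSpace ℝ (Fin n)) M
  have : LocallyCompactSpace O := hU.locallyCompactSpace
  have : SigmaCompactSpace O := sigmaCompactSpace_of_locallyCompact_secondCountable
  obtain ⟨f, hf⟩ := SmoothPartitionOfUnity.exists_isSubordinate (𝓡 n) (M := O) (s := univ)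
    isClosed_univ (fun i : O => Subtype.val ⁻¹' W i)
    (fun i => (hW i i.2).1.preimage continuous_subtype_val)
    (fun x _ => mem_iUnion.2 ⟨x, (hW x x.2).2⟩)
  -- The partition of unity lives on the open submanifold `U`. Its extension by zero may fail to be
  -- smooth on the boundary of `U`, so smoothness is claimed only at points of `U`.
  let g : U → M → ℝ := fun i y => if h : y ∈ U then f i ⟨y, h⟩ else 0
  have hg : ∀ i (y : O), g i y = f i y := fun i y => dif_pos y.2
  -- Taking indices by closed supports places `x` in each `W i` and makes all other functions vanish
  -- near `x`.
  refine ⟨g, fun x hx => ⟨f.fintsupport ⟨x, hx⟩, fun i hi => ?_, ?_, fun i hi => ?_, ?_⟩⟩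
  · exact hf i ((f.mem_fintsupport_iff ⟨x, hx⟩ i).1 hi)
  · have h1 := f.eventually_finsupport_subset ⟨x, hx⟩
    have h2 : Filter.map (Subtype.val : O → M) (𝓝 ⟨x, hx⟩) = 𝓝 x :=
      map_nhds_subtype_coe_eq_nhds hx (hU.mem_nhds hx)
    rw [← h2, eventually_map]
    filter_upwards [h1] with y hy i hi
    rw [hg]
    by_contra h
    exact hi (hy ((f.mem_finsupport y).2 h))
  · have h1 : ContMDiffAt (𝓡 n) 𝓘(ℝ, ℝ) ∞ (fun y : O => g i y) ⟨x, hx⟩ :=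
      ((f i).contMDiff _).congr_of_eventuallyEq (Eventually.of_forall (hg i))
    exact contMDiffAt_subtype_iff.1 h1
  · rw [← f.sum_finsupport' (⟨x, hx⟩ : O) (mem_univ _) (f.finsupport_subset_fintsupport _)]
    exact Finset.sum_congr rfl fun i _ => hg i ⟨x, hx⟩

/-- Local torsion-free connections making a tensor parallel can be glued. -/
theorem Tensor11.isIntegrableOn_of_locally {Θ : Tensor11 n M} {U : Set M} (hU : IsOpen U)
    (h : ∀ x ∈ U, ∃ W : Set M, IsOpen W ∧ x ∈ W ∧ W ⊆ U ∧ Θ.IsIntegrableOn W) :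
    Θ.IsIntegrableOn U := by
  have h' : ∀ x : M, ∃ W : Set M, x ∈ U → IsOpen W ∧ x ∈ W ∧ W ⊆ U ∧ Θ.IsIntegrableOn W :=
    fun x => by
      by_cases hx : x ∈ U
      · obtain ⟨W, hW⟩ := h x hx
        exact ⟨W, fun _ => hW⟩
      · exact ⟨∅, fun hx' => absurd hx' hx⟩
  choose W hW using h'
  obtain ⟨g, hg⟩ := exists_partition_of_unity_on_open (n := n) (W := W) hU
    fun x hx => ⟨(hW x hx).1, (hW x hx).2.1⟩
  have hWi : ∀ i : U, Θ.IsIntegrableOn (W i) := fun i => (hW i i.2).2.2.2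
  choose c hcov hsm htor hpar using hWi
  let conn : (∀ x : M, TangentSpace (𝓡 n) x) →
      (∀ x : M, TangentSpace (𝓡 n) x →L[ℝ] TangentSpace (𝓡 n) x) :=
    fun Y x => ∑ᶠ i, g i x • c i Y x
  have hconn : ∀ (I : Finset U) (x : M), (∀ i ∉ I, g i x = 0) → ∀ Y,
      conn Y x = ∑ i ∈ I, g i x • c i Y x := by
    intro I x hI Y
    refine finsum_eq_sum_of_support_subset _ fun i hi => ?_
    by_contra hiI
    refine hi ?_
    change g i x • c i Y x = 0
    rw [hI i hiI, zero_smul]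
  have happ : ∀ (I : Finset U) (x : M), (∀ i ∉ I, g i x = 0) → ∀ Y (ξ : TangentSpace (𝓡 n) x),
      conn Y x ξ = ∑ i ∈ I, g i x • c i Y x ξ := by
    intro I x hI Y ξ
    rw [hconn I x hI Y, sum_apply]
    rfl
  refine ⟨conn, ⟨?_, ?_⟩, ⟨?_⟩, ?_, ?_⟩
  · intro Y Y' x hY hY' hx
    obtain ⟨I, hIW, hI, -, -⟩ := hg x hx
    rw [hconn I x hI.self_of_nhds, hconn I x hI.self_of_nhds, hconn I x hI.self_of_nhds,
      ← Finset.sum_add_distrib]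
    exact Finset.sum_congr rfl fun i hi => by
      rw [(hcov i).add hY hY' (hIW i hi), smul_add]
  · intro Y f x hY hf hx
    obtain ⟨I, hIW, hI, -, h1⟩ := hg x hx
    rw [hconn I x hI.self_of_nhds, hconn I x hI.self_of_nhds, Finset.smul_sum]
    -- The Leibniz rule has an inhomogeneous term, as does the torsion identity below; these two are
    -- where the weights must sum to one.
    have h2 : ∀ A : TangentSpace (𝓡 n) x →L[ℝ] TangentSpace (𝓡 n) x,
        A = ∑ i ∈ I, g i x • A := fun A => by rw [← Finset.sum_smul, h1, one_smul]
    conv_rhs => rw [h2 ((mvfderiv (𝓡 n) f x).smulRight (Y x))]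
    rw [← Finset.sum_add_distrib]
    exact Finset.sum_congr rfl fun i hi => by
      rw [(hcov i).leibniz hY hf (hIW i hi), smul_add, smul_comm]
  · intro σ hσ x hx
    obtain ⟨I, hIW, hI, hIs, -⟩ := hg x hx
    refine ContMDiffAt.contMDiffWithinAt ?_
    have h1 : ContMDiffAt (𝓡 n)
        ((𝓡 n).prod 𝓘(ℝ, EuclideanSpace ℝ (Fin n) →L[ℝ] EuclideanSpace ℝ (Fin n))) ∞
        (fun z => (⟨z, ∑ i ∈ I, g i z • c i σ z⟩ :
          Bundle.TotalSpace (EuclideanSpace ℝ (Fin n) →L[ℝ] EuclideanSpace ℝ (Fin n))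
          fun z : M => TangentSpace (𝓡 n) z →L[ℝ] TangentSpace (𝓡 n) z)) x := by
      refine ContMDiffAt.sum_section
        (V := fun z : M => TangentSpace (𝓡 n) z →L[ℝ] TangentSpace (𝓡 n) z)
        (t := fun i z => g i z • c i σ z) fun i hi => ?_
      refine ContMDiffAt.smul_section
        (V := fun z : M => TangentSpace (𝓡 n) z →L[ℝ] TangentSpace (𝓡 n) z) (hIs i hi) ?_
      exact ((hsm i).contMDiff (hσ.mono (hW i i.2).2.2.1)).contMDiffAt
        ((hW i i.2).1.mem_nhds (hIW i hi))
    refine h1.congr_of_eventuallyEq ?_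
    filter_upwards [hI] with y hy
    exact Bundle.TotalSpace.ext rfl (heq_of_eq (hconn I y hy σ))
  · intro x hx X Y hX hY
    obtain ⟨I, hIW, hI, -, h1⟩ := hg x hx
    rw [happ I x hI.self_of_nhds, happ I x hI.self_of_nhds, ← Finset.sum_sub_distrib]
    have h2 : ∀ ξ : TangentSpace (𝓡 n) x, ξ = ∑ i ∈ I, g i x • ξ := fun ξ => by
      rw [← Finset.sum_smul, h1, one_smul]
    conv_rhs => rw [h2 (VectorField.mlieBracket (𝓡 n) X Y x)]
    exact Finset.sum_congr rfl fun i hi => by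
      rw [← smul_sub, htor i x (hIW i hi) X Y hX hY]
  · intro x hx Y hY ξ
    obtain ⟨I, hIW, hI, -, -⟩ := hg x hx
    rw [happ I x hI.self_of_nhds, happ I x hI.self_of_nhds, map_sum]
    exact Finset.sum_congr rfl fun i hi => by
      rw [hpar i x (hIW i hi) Y hY ξ, map_smul]

end

end Development

/-! ### The main theorem. -/

theorem mainTheorem7 {n : ℕ} {M : Type u} [TopologicalSpace M]
    [ChartedSpace (EuclideanSpace ℝ (Fin n)) M] [IsManifold (𝓡 n) ∞ M]
    [T2Space M] [SecondCountableTopology M]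
    (Θ : Tensor11 n M) (hconst : Θ.AlgebraicallyConstant)
    (hsq : ∀ (x : M) (ξ : TangentSpace (𝓡 n) x), Θ x (Θ x ξ) = 0)
    (hN : Θ.NijenhuisVanishes) :
    -- `Θ` arises, locally, from the affine-bundle construction
    (∀ x : M, ∃ R : LocalRealization.{u, 0} Θ, x ∈ R.φ.source ∧ IsConnected R.φ.source) ∧
    -- in every such local realization, the rank of `D` is the codimension of `Im Θ` in `Ker Θ`,
    -- and `Θ` is integrable (where realized) if and only if `D` is
    (∀ R : LocalRealization.{u, v} Θ,
      (∀ (x : M) (y : R.Base), Module.finrank ℝ (R.dist.space y) = Θ.codimImKer x) ∧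
      (Θ.IsIntegrableOn R.φ.source ↔ R.dist.IsIntegrable)) ∧
    -- `Θ` is integrable on `M` if and only if all distributions `D` are, for any family of local
    -- realizations over sets covering `M`
    (∀ (ι : Type w) (R : ι → LocalRealization.{u, v} Θ), (⋃ i, (R i).φ.source) = Set.univ →
      (Θ.IsIntegrable ↔ ∀ i, (R i).dist.IsIntegrable)) := by
  have hloc : ∀ R : LocalRealization.{u, v} Θ, R.dist.IsIntegrable → ∀ x ∈ R.φ.source,
      ∃ W : Set M, IsOpen W ∧ x ∈ W ∧ W ⊆ R.φ.source ∧ Θ.IsIntegrableOn W :=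
    fun R hR _ hx => R.exists_isIntegrableOn hR hx
  refine ⟨Tensor11.exists_localRealization hconst hsq hN, fun R => ⟨R.finrank_dist hconst hsq,
    fun h => R.isIntegrable_dist h R.φ.open_source subset_rfl,
    fun h => Tensor11.isIntegrableOn_of_locally R.φ.open_source (hloc R h)⟩, fun ι R hR => ⟨
    fun h i => (R i).isIntegrable_dist h isOpen_univ (Set.subset_univ _),
    fun h => Tensor11.isIntegrableOn_of_locally isOpen_univ fun x _ => ?_⟩⟩
  -- The covering gives a local connection near each point of `M`, and one gluing over all of `M`
  -- suffices.
  obtain ⟨i, hi⟩ := Set.mem_iUnion.1 (hR ▸ Set.mem_univ x)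
  obtain ⟨W, hW, hxW, -, hΘ⟩ := hloc (R i) (h i) x hi
  exact ⟨W, hW, hxW, Set.subset_univ _, hΘ⟩
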